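/- Let $N\ge 1$, let $\Omega\subset\mathbb{R}^N$ be a bounded open set with Lipschitz boundary (for instance a bounded open set of class $C^1$ or $C^\infty$), and let $s\in(0,1)$, $d>0$, $T>0$, $Q_T=(0,T)\times\Omega$. Fix the homogeneous Dirichlet or Neumann boundary condition on $\partial\Omega$; let $(\lambda_k)_{k\ge1}$ be the eigenvalues of $-\Delta$ in $\Omega$ with this boundary condition (in the weak sense, in $H^1_0(\Omega)$, respectively $H^1(\Omega)$) and $(e_k)_{k\ge1}$ a corresponding orthonormal basis of $L^2(\Omega)$ of eigenfunctions. Let $(-\Delta)^s_{Sp}u=\sum_k\lambda_k^s u_k e_k$, with $u_k=\int_\Omega u\,e_k$, be the spectral fractional Laplacian and let $$T_s(t)u=\sum_k e^{-t d\lambda_k^s}u_k e_k,\qquad t\ge 0,$$ be the semigroup generated by $-d(-\Delta)^s_{Sp}$ on $L^2(\Omega)$, extended by continuity from $L^2(\Omega)\cap L^p(\Omega)$ to $L^p(\Omega)$ for $1\le p<\infty$. Let $\frac{N+2s}{2s}<p<\infty$. Then there is a constant $C>0$, depending only on $\Omega$ (hence on $N$), the boundary condition, $s$, $d$, $T$ and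 $p$, with the following property. Let $w_0\in L^\infty(\Omega)$ and $h\in L^p(Q_T)$, and let $w\in\mathcal{C}([0,T];L^p(\Omega))$ be the weak solution of $$\partial_t w+d(-\Delta)^s_{Sp}w=h\ \text{ in } Q_T,\qquad w(0,\cdot)=w_0\ \text{ in }\Omega,$$ with the chosen boundary condition, that is, $$w(t)=T_s(t)w_0+\int_0^t T_s(t-\tau)h(\tau)\,d\tau\ \text{ in } L^p(\Omega),\qquad 0\le t<T.$$ Then $$\|w\|_{L^\infty(Q_T)}\le\|w_0\|_{L^\infty(\Omega)}+C\,\|h\|_{L^p(Q_T)}.$$ -/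

import Mathlib

open MeasureTheory Set Filter Topology
open scoped ENNReal NNReal

noncomputable section

namespace SpectralFractional

/-- `ℝ^N` with its Euclidean norm. -/
abbrev Space (N : ℕ) : Type := EuclideanSpace ℝ (Fin N)

/-- A bounded open set with Lipschitz boundary: near each boundary point, after a rotation that sends
some unit vector `ν` to the last coordinate direction, `Ω` is the strict epigraph of a Lipschitz
function of the remaining `N - 1` coordinates (`y - ⟪ν, y⟫ ν` is the projection of `y` to `ν^⊥`).
All bounded open sets of class `C^1`, `C^2`, ..., `C^∞` are of this kind. -/
structure IsBoundedRegularOpen {N : ℕ} (Ω : Set (Space N)) : Prop where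
  isOpen : IsOpen Ω
  isBounded : Bornology.IsBounded Ω
  boundary : ∀ x ∈ frontier Ω, ∃ ν : Space N, ‖ν‖ = 1 ∧ ∃ r : ℝ, 0 < r ∧
    ∃ (K : ℝ≥0) (g : Space N → ℝ), LipschitzWith K g ∧
      ∀ y ∈ Metric.ball x r, y ∈ Ω ↔ g (y - inner ℝ ν y • ν) < inner ℝ ν y

/-- The homogeneous boundary condition: `u = 0` or `∂u/∂ν = 0` on `∂Ω`. -/
inductive BoundaryCondition where
  | dirichlet
  | neumann

/-- `φ ∈ C_c^∞(Ω)`. -/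
structure IsTestFunction {N : ℕ} (Ω : Set (Space N)) (φ : Space N → ℝ) : Prop where
  contDiff : ContDiff ℝ (⊤ : ℕ∞) φ
  hasCompactSupport : HasCompactSupport φ
  tsupport_subset : tsupport φ ⊆ Ω

/-- `L^2(Ω)`. -/
abbrev L2 {N : ℕ} (Ω : Set (Space N)) : Type := Lp ℝ 2 (volume.restrict Ω)

/-- `L^2(Ω; ℝ^N)`. -/
abbrev L2Vec {N : ℕ} (Ω : Set (Space N)) : Type := Lp (Space N) 2 (volume.restrict Ω)

theorem IsTestFunction.memLp {N : ℕ} {Ω : Set (Space N)} {φ : Space N → ℝ}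
    (hφ : IsTestFunction Ω φ) : MemLp φ 2 (volume.restrict Ω) :=
  (hφ.contDiff.continuous.memLp_of_hasCompactSupport hφ.hasCompactSupport).restrict Ω

theorem IsTestFunction.memLp_gradient {N : ℕ} {Ω : Set (Space N)} {φ : Space N → ℝ}
    (hφ : IsTestFunction Ω φ) : MemLp (gradient φ) 2 (volume.restrict Ω) := by
  have h1 : Continuous (gradient φ) :=
    (InnerProductSpace.toDual ℝ (Space N)).symm.continuous.comp
      (hφ.contDiff.continuous_fderiv (by simp))
  have h2 : HasCompactSupport (gradient φ) :=
    (hφ.hasCompactSupport.fderiv (𝕜 := ℝ)).comp_left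
      (g := (InnerProductSpace.toDual ℝ (Space N)).symm) (map_zero _)
  exact (h1.memLp_of_hasCompactSupport h2).restrict Ω

/-- The Sobolev space `H^1(Ω)`, as the space of pairs `(u, ∇u)` where `u ∈ L^2(Ω)` has the weak
gradient `∇u ∈ L^2(Ω; ℝ^N)`: `∫ u ∇φ = - ∫ φ ∇u` for all `φ ∈ C_c^∞(Ω)`. -/
def sobolevH1 {N : ℕ} (Ω : Set (Space N)) : Submodule ℝ (L2 Ω × L2Vec Ω) where
  carrier := {z | ∀ φ : Space N → ℝ, IsTestFunction Ω φ →
    ∫ x in Ω, z.1 x • gradient φ x = - ∫ x in Ω, φ x • z.2 x}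
  zero_mem' := by
    intro φ _
    have e1 : ∫ x in Ω, (0 : L2 Ω) x • gradient φ x = 0 := by
      rw [← integral_zero (Space N) (Space N) (μ := volume.restrict Ω)]
      apply integral_congr_ae
      filter_upwards [Lp.coeFn_zero ℝ 2 (volume.restrict Ω)] with x hx
      rw [hx, Pi.zero_apply, zero_smul]
    have e2 : ∫ x in Ω, φ x • (0 : L2Vec Ω) x = 0 := by
      rw [← integral_zero (Space N) (Space N) (μ := volume.restrict Ω)]
      apply integral_congr_ae
      filter_upwards [Lp.coeFn_zero (Space N) 2 (volume.restrict Ω)] with x hx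
      rw [hx, Pi.zero_apply, smul_zero]
    simp only [Prod.fst_zero, Prod.snd_zero, e1, e2, neg_zero]
  add_mem' := by
    rintro ⟨u, G⟩ ⟨v, H⟩ hu hv φ hφ
    have hu' := hu φ hφ
    have hv' := hv φ hφ
    dsimp only at hu' hv'
    have i1 : ∀ u : L2 Ω, Integrable (fun x => u x • gradient φ x) (volume.restrict Ω) :=
      fun u => memLp_one_iff_integrable.1 (hφ.memLp_gradient.smul (Lp.memLp u))
    have i2 : ∀ G : L2Vec Ω, Integrable (fun x => φ x • G x) (volume.restrict Ω) :=
      fun G => memLp_one_iff_integrable.1 ((Lp.memLp G).smul hφ.memLp)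
    have e1 : ∫ x in Ω, (u + v) x • gradient φ x
        = ∫ x in Ω, u x • gradient φ x + v x • gradient φ x := by
      apply integral_congr_ae
      filter_upwards [Lp.coeFn_add u v] with x hx
      rw [hx, Pi.add_apply, add_smul]
    have e2 : ∫ x in Ω, φ x • (G + H) x = ∫ x in Ω, φ x • G x + φ x • H x := by
      apply integral_congr_ae
      filter_upwards [Lp.coeFn_add G H] with x hx
      rw [hx, Pi.add_apply, smul_add]
    simp only [Prod.mk_add_mk]
    rw [e1, e2, integral_add (i1 u) (i1 v), integral_add (i2 G) (i2 H), hu', hv', neg_add]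
  smul_mem' := by
    rintro c ⟨u, G⟩ hu φ hφ
    have hu' := hu φ hφ
    dsimp only at hu'
    have e1 : ∫ x in Ω, (c • u) x • gradient φ x = ∫ x in Ω, c • (u x • gradient φ x) := by
      apply integral_congr_ae
      filter_upwards [Lp.coeFn_smul c u] with x hx
      rw [hx, Pi.smul_apply, smul_assoc]
    have e2 : ∫ x in Ω, φ x • (c • G) x = ∫ x in Ω, c • (φ x • G x) := by
      apply integral_congr_ae
      filter_upwards [Lp.coeFn_smul c G] with x hx
      rw [hx, Pi.smul_apply, smul_comm]
    simp only [Prod.smul_mk]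
    rw [e1, e2, integral_smul, integral_smul, hu', smul_neg]

/-- `H^1_0(Ω)`, as the closure in `H^1(Ω)` of the pairs `(φ, ∇φ)` with `φ ∈ C_c^∞(Ω)`. -/
def sobolevH10 {N : ℕ} (Ω : Set (Space N)) : Submodule ℝ (L2 Ω × L2Vec Ω) :=
  (Submodule.span ℝ {z : L2 Ω × L2Vec Ω | ∃ φ : Space N → ℝ, ∃ hφ : IsTestFunction Ω φ,
    z = (hφ.memLp.toLp φ, hφ.memLp_gradient.toLp (gradient φ))}).topologicalClosure

/-- The form domain of the Laplacian: `H^1_0(Ω)` for the Dirichlet condition and `H^1(Ω)` for the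
Neumann condition. -/
def formDomain {N : ℕ} (Ω : Set (Space N)) :
    BoundaryCondition → Submodule ℝ (L2 Ω × L2Vec Ω)
  | .dirichlet => sobolevH10 Ω
  | .neumann => sobolevH1 Ω

/-- The solutions `e` of `-Δ e = lam e` in `Ω` with the homogeneous Dirichlet or Neumann boundary
condition, in the weak sense: `∫ ∇e · ∇v = lam ∫ e v` for all `v` in the form domain. It is `{0}`
unless `lam` is an eigenvalue. -/
def eigenspace {N : ℕ} (Ω : Set (Space N)) (bc : BoundaryCondition) (lam : ℝ) :
    Submodule ℝ (L2 Ω) where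
  carrier := {e | ∃ G : L2Vec Ω, (e, G) ∈ formDomain Ω bc ∧
    ∀ z ∈ formDomain Ω bc, inner ℝ G z.2 = lam * inner ℝ e z.1}
  zero_mem' := ⟨0, (formDomain Ω bc).zero_mem, fun z _ => by simp⟩
  add_mem' := by
    rintro e f ⟨G, hG, hG'⟩ ⟨H, hH, hH'⟩
    refine ⟨G + H, (formDomain Ω bc).add_mem hG hH, fun z hz => ?_⟩
    rw [inner_add_left, inner_add_left, hG' z hz, hH' z hz, mul_add]
  smul_mem' := by
    rintro c e ⟨G, hG, hG'⟩
    refine ⟨c • G, (formDomain Ω bc).smul_mem c hG, fun z hz => ?_⟩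
    rw [real_inner_smul_left, real_inner_smul_left, hG' z hz]
    ring

/-- The orthogonal projection of `L^2(Ω)` to the eigenspace of `lam`, `u ↦ ∑ u_k e_k` over an
orthonormal basis of it. Eigenspaces are closed, so the closure only serves to make the projection
available. -/
def eigenprojection {N : ℕ} (Ω : Set (Space N)) (bc : BoundaryCondition) (lam : ℝ) :
    L2 Ω →L[ℝ] L2 Ω :=
  (eigenspace Ω bc lam).topologicalClosure.starProjection

/-- The spectral fractional Laplacian `(-Δ)^s u = ∑_k λ_k^s u_k e_k`, the terms of the series
being grouped by the distinct eigenvalues (all the other terms vanish); its domain is the set of `u`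
for which the series converges in `L^2(Ω)`. -/
def fractionalLaplacian {N : ℕ} (Ω : Set (Space N)) (bc : BoundaryCondition) (s : ℝ)
    (u : L2 Ω) : L2 Ω :=
  ∑' lam : ℝ, lam ^ s • eigenprojection Ω bc lam u

/-- The semigroup `T_s(t) = exp(- t d (-Δ)^s)` on `L^2(Ω)`:
`T_s(t) u = ∑_k exp(- t d λ_k^s) u_k e_k`, the terms being grouped by the distinct eigenvalues. -/
def semigroupL2 {N : ℕ} (Ω : Set (Space N)) (bc : BoundaryCondition) (s d t : ℝ)
    (u : L2 Ω) : L2 Ω :=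
  ∑' lam : ℝ, Real.exp (-(t * (d * lam ^ s))) • eigenprojection Ω bc lam u

/-- The class in `L^p` of a function that belongs to `L^p` (and `0` for other functions). -/
def toLpOrZero {X : Type*} [MeasurableSpace X] (p : ℝ≥0∞) (μ : Measure X) (f : X → ℝ) :
    Lp ℝ p μ :=
  open Classical in if hf : MemLp f p μ then hf.toLp f else 0

/-- The operator `T_s(t)` on `L^p(Ω)`: the continuous extension of the restriction of `T_s(t)` to
`L^2(Ω) ∩ L^p(Ω)`, that is, `T_s(t) f` is the limit in `L^p(Ω)` of `T_s(t) g` as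
`g ∈ L^2(Ω) ∩ L^p(Ω)` tends to `f` in `L^p(Ω)`. -/
def semigroupLp {N : ℕ} (Ω : Set (Space N)) (bc : BoundaryCondition) (s d : ℝ)
    (p : ℝ≥0∞) [Fact (1 ≤ p)] (t : ℝ) (f : Lp ℝ p (volume.restrict Ω)) :
    Lp ℝ p (volume.restrict Ω) :=
  limUnder
    (comap (Subtype.val : {g : Lp ℝ p (volume.restrict Ω) // MemLp g 2 (volume.restrict Ω)} → _)
      (𝓝 f))
    (fun g => toLpOrZero p (volume.restrict Ω)
      (semigroupL2 Ω bc s d t (toLpOrZero 2 (volume.restrict Ω) g.1)))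

/-- The cylinder `Q_T = (0, T) × Ω`. -/
def cylinder {N : ℕ} (Ω : Set (Space N)) (T : ℝ) : Set (ℝ × Space N) := Ioo 0 T ×ˢ Ω

/-- `w ∈ C([0, T]; L^p(Ω))` is the weak solution of `∂_t w + d (-Δ)^s w = h` in `Q_T` with the
boundary condition `bc` and the initial value `w₀`:
`w(t) = T_s(t) w₀ + ∫_0^t T_s(t - τ) h(τ) dτ` in `L^p(Ω)` for `0 ≤ t < T` (Bochner integral).
The measurable function `w` of `(t, x)` represents the curve `t ↦ w(t, ·)` in `L^p(Ω)`. -/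
structure IsWeakSolution {N : ℕ} (Ω : Set (Space N)) (bc : BoundaryCondition) (s d T : ℝ)
    (p : ℝ≥0∞) [Fact (1 ≤ p)] (w₀ : Space N → ℝ) (h w : ℝ × Space N → ℝ) : Prop where
  aestronglyMeasurable : AEStronglyMeasurable w (volume.restrict (cylinder Ω T))
  memLp : ∀ t ∈ Icc 0 T, MemLp (fun x => w (t, x)) p (volume.restrict Ω)
  continuousOn :
    ContinuousOn (fun t => toLpOrZero p (volume.restrict Ω) (fun x => w (t, x))) (Icc 0 T)
  mild : ∀ t ∈ Ico 0 T,
    toLpOrZero p (volume.restrict Ω) (fun x => w (t, x)) =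
      semigroupLp Ω bc s d p t (toLpOrZero p (volume.restrict Ω) w₀) +
        ∫ τ in (0 : ℝ)..t, semigroupLp Ω bc s d p (t - τ)
          (toLpOrZero p (volume.restrict Ω) (fun x => h (τ, x)))

end SpectralFractional

end

/-
The resolvents `r (r + L)⁻¹` of the Laplacian `L` preserve upper bounds `u ≤ c`, as one sees by
testing the equation with a smooth positive part of `u - c`. The exponential formula and the
binomial series of `(1 - x)^s`, whose coefficients of positive degree are nonpositive for `s ≤ 1`,
carry this over to `T_s(t)`, which is therefore a contraction of `L^∞` and, by duality, of `L^1`.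

On a domain satisfying a uniform cone condition, averaging over small cones gives the Nash-type
inequality `‖u‖_2 ≤ C (ε ‖∇u‖_2 + ε^(-N/2) ‖u‖_1)` for small `ε`. With the decay of the energy along
the semigroup it gives the smoothing of `T_s(t)` from `L^1` to `L^2`, hence to `L^∞`, with norm
`O(t^(-N/(2s)))`; interpolation with the contraction of `L^∞` yields the norm `O(t^(-N/(2sp)))` from
`L^p` to `L^∞`. This kernel is in `L^{p'}(0, T)` exactly when `p > (N + 2s)/(2s)`, and then Hölder's
inequality in time bounds the Duhamel integral.
-/

open MeasureTheory Set Filter Topology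
open scoped ENNReal NNReal

noncomputable section

namespace SpectralFractional

section FunctionalCalculus

variable {H : Type*} [NormedAddCommGroup H] [InnerProductSpace ℝ H]

/-- The spectral projections `P a` of a nonnegative self-adjoint operator `L` with discrete
spectrum, `P a` being the orthogonal projection to the eigenspace of `a` (zero if `a` is not an
eigenvalue). -/
structure IsSpectralFamily (P : ℝ → H →L[ℝ] H) : Prop where
  symm : ∀ a u v, inner ℝ (P a u) v = inner ℝ u (P a v)
  idem : ∀ a u, P a (P a u) = P a u
  orth : ∀ a b u, a ≠ b → P a (P b u) = 0
  hasSum : ∀ u, HasSum (fun a => P a u) u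
  neg : ∀ a u, a < 0 → P a u = 0

/-- The functional calculus `f(L) u = ∑ f(a) P_a u` of the operator `L` with spectral projections
`P`; the series converges for all `u` when `f` is bounded on `[0, ∞)`. -/
def spectralCalculus (P : ℝ → H →L[ℝ] H) (f : ℝ → ℝ) (u : H) : H := ∑' a, f a • P a u

namespace IsSpectralFamily

variable {P : ℝ → H →L[ℝ] H} (hP : IsSpectralFamily P)

include hP

theorem inner_self_apply (a : ℝ) (u : H) : inner ℝ u (P a u) = ‖P a u‖ ^ 2 := by
  rw [← real_inner_self_eq_norm_sq, hP.symm, hP.idem]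

theorem hasSum_norm_sq (u : H) : HasSum (fun a => ‖P a u‖ ^ 2) (‖u‖ ^ 2) := by
  have := (hP.hasSum u).mapL (innerSL ℝ u)
  simpa [hP.inner_self_apply, real_inner_self_eq_norm_sq] using this

theorem eq_of_forall {u v : H} (h : ∀ a, P a u = P a v) : u = v := by
  have hu := hP.hasSum u
  simp only [h] at hu
  exact hu.unique (hP.hasSum v)

theorem orthogonalFamily : OrthogonalFamily ℝ (fun a => LinearMap.range (P a).toLinearMap)
    (fun a => (LinearMap.range (P a).toLinearMap).subtypeₗᵢ) := by
  rintro a b hab ⟨_, u, rfl⟩ ⟨_, v, rfl⟩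
  simp [hP.symm, hP.orth a b v hab]

variable {f g : ℝ → ℝ} {M M' : ℝ}

theorem summable_norm_sq_smul (hf : ∀ a, 0 ≤ a → |f a| ≤ M) (u : H) :
    Summable (fun a => ‖f a • P a u‖ ^ 2) := by
  refine Summable.of_nonneg_of_le (fun a => by positivity) (fun a => ?_)
    ((hP.hasSum_norm_sq u).summable.mul_left (M ^ 2))
  rcases lt_or_ge a 0 with ha | ha
  · simp [hP.neg a u ha]
  · rw [norm_smul, mul_pow, Real.norm_eq_abs]
    gcongr
    exact hf a ha

variable [CompleteSpace H]

theorem hasSum_calculus (hf : ∀ a, 0 ≤ a → |f a| ≤ M) (u : H) :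
    HasSum (fun a => f a • P a u) (spectralCalculus P f u) := by
  refine Summable.hasSum ?_
  have := (hP.orthogonalFamily.summable_iff_norm_sq_summable
    (fun a => ⟨f a • P a u, f a • u, by simp⟩)).2 (hP.summable_norm_sq_smul hf u)
  simpa using this

theorem apply_calculus (hf : ∀ a, 0 ≤ a → |f a| ≤ M) (u : H) (b : ℝ) :
    P b (spectralCalculus P f u) = f b • P b u := by
  refine ((hP.hasSum_calculus hf u).mapL (P b)).unique ?_
  have hsingle := hasSum_single (f := fun a => P b (f a • P a u)) b (fun a hab => by
    simp [hP.orth b a u hab.symm])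
  simpa [hP.idem] using hsingle

theorem calculus_eq (hf : ∀ a, 0 ≤ a → |f a| ≤ M) {u v : H}
    (h : ∀ a, 0 ≤ a → P a v = f a • P a u) : spectralCalculus P f u = v := by
  refine hP.eq_of_forall fun a => ?_
  rw [hP.apply_calculus hf]
  rcases lt_or_ge a 0 with ha | ha
  · simp [hP.neg a _ ha]
  · exact (h a ha).symm

theorem hasSum_norm_sq_calculus (hf : ∀ a, 0 ≤ a → |f a| ≤ M) (u : H) :
    HasSum (fun a => f a ^ 2 * ‖P a u‖ ^ 2) (‖spectralCalculus P f u‖ ^ 2) := by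
  have := hP.hasSum_norm_sq (spectralCalculus P f u)
  simpa [hP.apply_calculus hf, norm_smul, mul_pow] using this

theorem inner_calculus_left (hf : ∀ a, 0 ≤ a → |f a| ≤ M) (u v : H) :
    inner ℝ (spectralCalculus P f u) v = inner ℝ u (spectralCalculus P f v) := by
  have hsumu := (hP.hasSum_calculus hf u).mapL (innerSL ℝ v)
  have hsumv := (hP.hasSum_calculus hf v).mapL (innerSL ℝ u)
  simp only [innerSL_apply_apply, inner_smul_right] at hsumu hsumv
  rw [real_inner_comm]
  refine hsumu.unique ?_
  convert hsumv using 3 with a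
  rw [← hP.symm, real_inner_comm]

theorem calculus_add_right (hf : ∀ a, 0 ≤ a → |f a| ≤ M) (u v : H) :
    spectralCalculus P f (u + v) = spectralCalculus P f u + spectralCalculus P f v :=
  hP.calculus_eq hf fun a _ => by simp [hP.apply_calculus hf]

theorem calculus_smul_right (hf : ∀ a, 0 ≤ a → |f a| ≤ M) (c : ℝ) (u : H) :
    spectralCalculus P f (c • u) = c • spectralCalculus P f u :=
  hP.calculus_eq hf fun a _ => by
    rw [map_smul, map_smul, hP.apply_calculus hf, smul_comm]

theorem calculus_mul (hf : ∀ a, 0 ≤ a → |f a| ≤ M)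
    (hg : ∀ a, 0 ≤ a → |g a| ≤ M') (u : H) :
    spectralCalculus P (fun a => f a * g a) u = spectralCalculus P f (spectralCalculus P g u) := by
  have hM : 0 ≤ M := (abs_nonneg _).trans (hf 0 le_rfl)
  refine hP.calculus_eq (M := M * M') (fun a ha => ?_) fun a _ => ?_
  · rw [abs_mul]
    exact mul_le_mul (hf a ha) (hg a ha) (abs_nonneg _) hM
  · rw [hP.apply_calculus hf, hP.apply_calculus hg, smul_smul]

theorem calculus_add (hf : ∀ a, 0 ≤ a → |f a| ≤ M)
    (hg : ∀ a, 0 ≤ a → |g a| ≤ M') (u : H) :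
    spectralCalculus P (fun a => f a + g a) u
      = spectralCalculus P f u + spectralCalculus P g u := by
  refine hP.calculus_eq (M := M + M') (fun a ha => ?_) fun a _ => ?_
  · exact (abs_add_le _ _).trans (add_le_add (hf a ha) (hg a ha))
  · rw [map_add, hP.apply_calculus hf, hP.apply_calculus hg, add_smul]

theorem calculus_const_mul (hf : ∀ a, 0 ≤ a → |f a| ≤ M) (c : ℝ) (u : H) :
    spectralCalculus P (fun a => c * f a) u = c • spectralCalculus P f u := by
  refine hP.calculus_eq (M := |c| * M) (fun a ha => ?_) fun a _ => ?_
  · rw [abs_mul]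
    exact mul_le_mul_of_nonneg_left (hf a ha) (abs_nonneg _)
  · rw [map_smul, hP.apply_calculus hf, smul_smul]

theorem calculus_sub (hf : ∀ a, 0 ≤ a → |f a| ≤ M) (hg : ∀ a, 0 ≤ a → |g a| ≤ M') (u : H) :
    spectralCalculus P (fun a => f a - g a) u
      = spectralCalculus P f u - spectralCalculus P g u := by
  refine hP.calculus_eq (M := M + M') (fun a ha => ?_) fun a _ => ?_
  · exact (abs_sub _ _).trans (add_le_add (hf a ha) (hg a ha))
  · rw [map_sub, hP.apply_calculus hf, hP.apply_calculus hg, sub_smul]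

theorem calculus_one (u : H) : spectralCalculus P (fun _ => 1) u = u :=
  hP.calculus_eq (M := 1) (by simp) (by simp)

theorem norm_calculus_le (hf : ∀ a, 0 ≤ a → |f a| ≤ M) (u : H) :
    ‖spectralCalculus P f u‖ ≤ M * ‖u‖ := by
  have hM : 0 ≤ M := (abs_nonneg _).trans (hf 0 le_rfl)
  refine abs_le_of_sq_le_sq' ?_ (by positivity) |>.2
  rw [mul_pow]
  refine hasSum_le (fun a => ?_) (hP.hasSum_norm_sq_calculus hf u)
    ((hP.hasSum_norm_sq u).mul_left (M ^ 2))
  rcases lt_or_ge a 0 with ha | ha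
  · simp [hP.neg a _ ha]
  · exact mul_le_mul_of_nonneg_right (sq_le_sq' (abs_le.1 (hf a ha)).1 (abs_le.1 (hf a ha)).2)
      (by positivity)

theorem hasSum_norm_sq_calculus_sub (hf : ∀ a, 0 ≤ a → |f a| ≤ M) (hg : ∀ a, 0 ≤ a → |g a| ≤ M')
    (u : H) : HasSum (fun a => (f a - g a) ^ 2 * ‖P a u‖ ^ 2)
      (‖spectralCalculus P f u - spectralCalculus P g u‖ ^ 2) := by
  rw [← hP.calculus_sub hf hg]
  exact hP.hasSum_norm_sq_calculus (fun a ha =>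
    (abs_sub _ _).trans (add_le_add (hf a ha) (hg a ha))) u

theorem tendsto_calculus {F : ℕ → ℝ → ℝ} (hF : ∀ n a, 0 ≤ a → |F n a| ≤ M)
    (hlim : ∀ a, 0 ≤ a → Tendsto (fun n => F n a) atTop (𝓝 (f a))) (u : H) :
    Tendsto (fun n => spectralCalculus P (F n) u) atTop (𝓝 (spectralCalculus P f u)) := by
  have hf : ∀ a, 0 ≤ a → |f a| ≤ M := fun a ha =>
    le_of_tendsto (hlim a ha).abs (Eventually.of_forall fun n => hF n a ha)
  have hsq : Tendsto (fun n => ‖spectralCalculus P (F n) u - spectralCalculus P f u‖ ^ 2)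
      atTop (𝓝 (∑' _ : ℝ, 0)) := by
    simp only [← (hP.hasSum_norm_sq_calculus_sub (hF _) hf u).tsum_eq]
    refine tendsto_tsum_of_dominated_convergence
      ((hP.hasSum_norm_sq u).summable.mul_left ((M + M) ^ 2)) (fun a => ?_)
      (Eventually.of_forall fun n a => ?_) <;> rcases lt_or_ge a 0 with ha | ha
    · simp [hP.neg a _ ha]
    · simpa using (((hlim a ha).sub_const (f a)).pow 2).mul_const (‖P a u‖ ^ 2)
    · simp [hP.neg a _ ha]
    · rw [Real.norm_of_nonneg (by positivity), ← sq_abs (F n a - f a)]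
      gcongr
      exact (abs_sub _ _).trans (add_le_add (hF n a ha) (hf a ha))
  rw [tendsto_iff_norm_sub_tendsto_zero]
  simpa [Real.sqrt_sq (norm_nonneg _)] using hsq.sqrt

end IsSpectralFamily

end FunctionalCalculus

section SubMarkovian

variable {X : Type*} [MeasurableSpace X] {μ : Measure X}

theorem isClosed_setOf_ae_le {p : ℝ≥0∞} [Fact (1 ≤ p)] (g : X → ℝ) :
    IsClosed {v : Lp ℝ p μ | ∀ᵐ x ∂μ, v x ≤ g x} := by
  refine IsSeqClosed.isClosed fun v w hv hw => ?_
  obtain ⟨ns, -, hns⟩ := (tendstoInMeasure_of_tendsto_Lp hw).exists_seq_tendsto_ae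
  filter_upwards [hns, ae_all_iff.2 hv] with x hx hvx
  exact le_of_tendsto hx (Eventually.of_forall fun n => hvx _)

/-- The operator `f(L)` is sub-Markovian up to the factor `m`: `u ≤ c` implies `f(L) u ≤ m c` for
`c ≥ 0`. With `c = 0` this contains the preservation of positivity. The bounds on the symbol `f` are
included so that the functional calculus applies to it. -/
structure SubMarkovian (P : ℝ → Lp ℝ 2 μ →L[ℝ] Lp ℝ 2 μ) (m : ℝ) (f : ℝ → ℝ) : Prop where
  nonneg : ∀ a, 0 ≤ a → 0 ≤ f a
  le : ∀ a, 0 ≤ a → f a ≤ m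
  ae_le : ∀ (u : Lp ℝ 2 μ) (c : ℝ), 0 ≤ c → (∀ᵐ x ∂μ, u x ≤ c) →
    ∀ᵐ x ∂μ, spectralCalculus P f u x ≤ m * c

namespace SubMarkovian

variable {P : ℝ → Lp ℝ 2 μ →L[ℝ] Lp ℝ 2 μ} {m m' : ℝ} {f g : ℝ → ℝ}

theorem abs_le (hf : SubMarkovian P m f) (a : ℝ) (ha : 0 ≤ a) : |f a| ≤ m := by
  rw [abs_of_nonneg (hf.nonneg a ha)]
  exact hf.le a ha

theorem bound_nonneg (hf : SubMarkovian P m f) : 0 ≤ m :=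
  (hf.nonneg 0 le_rfl).trans (hf.le 0 le_rfl)

variable (hP : IsSpectralFamily P)

include hP

theorem one : SubMarkovian P 1 (fun _ => 1) where
  nonneg := by simp
  le := by simp
  ae_le u c _ hu := by simpa [hP.calculus_one] using hu

theorem add (hf : SubMarkovian P m f) (hg : SubMarkovian P m' g) :
    SubMarkovian P (m + m') (fun a => f a + g a) where
  nonneg a ha := add_nonneg (hf.nonneg a ha) (hg.nonneg a ha)
  le a ha := add_le_add (hf.le a ha) (hg.le a ha)
  ae_le u c hc hu := by
    rw [hP.calculus_add hf.abs_le hg.abs_le]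
    filter_upwards [hf.ae_le u c hc hu, hg.ae_le u c hc hu, Lp.coeFn_add
      (spectralCalculus P f u) (spectralCalculus P g u)] with x hfx hgx hsum
    rw [hsum, Pi.add_apply, add_mul]
    exact add_le_add hfx hgx

theorem mul (hf : SubMarkovian P m f) (hg : SubMarkovian P m' g) :
    SubMarkovian P (m * m') (fun a => f a * g a) where
  nonneg a ha := mul_nonneg (hf.nonneg a ha) (hg.nonneg a ha)
  le a ha := mul_le_mul (hf.le a ha) (hg.le a ha) (hg.nonneg a ha) hf.bound_nonneg
  ae_le u c hc hu := by
    rw [hP.calculus_mul hf.abs_le hg.abs_le, mul_assoc]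
    exact hf.ae_le _ _ (mul_nonneg hg.bound_nonneg hc) (hg.ae_le u c hc hu)

theorem const_mul (hf : SubMarkovian P m f) {k : ℝ} (hk : 0 ≤ k) :
    SubMarkovian P (k * m) (fun a => k * f a) where
  nonneg a ha := mul_nonneg hk (hf.nonneg a ha)
  le a ha := mul_le_mul_of_nonneg_left (hf.le a ha) hk
  ae_le u c hc hu := by
    rw [hP.calculus_const_mul hf.abs_le]
    filter_upwards [hf.ae_le u c hc hu, Lp.coeFn_smul k (spectralCalculus P f u)] with x hfx hsmul
    rw [hsmul, Pi.smul_apply, smul_eq_mul, mul_assoc]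
    exact mul_le_mul_of_nonneg_left hfx hk

theorem pow (hf : SubMarkovian P m f) (n : ℕ) : SubMarkovian P (m ^ n) (fun a => f a ^ n) := by
  induction n with
  | zero => simpa using SubMarkovian.one hP
  | succ n ih => simpa only [pow_succ] using ih.mul hP hf

theorem sum {F : ℕ → ℝ → ℝ} {M : ℕ → ℝ} (n : ℕ) (hF : ∀ k, SubMarkovian P (M k) (F k)) :
    SubMarkovian P (∑ k ∈ Finset.range n, M k) (fun a => ∑ k ∈ Finset.range n, F k a) := by
  induction n with
  | zero => simpa using (SubMarkovian.one hP).const_mul hP (le_refl 0)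
  | succ n ih => simpa only [Finset.sum_range_succ] using ih.add hP (hF n)

theorem of_tendsto {F : ℕ → ℝ → ℝ} {M : ℕ → ℝ} (hF : ∀ n, SubMarkovian P (M n) (F n))
    (hM : Tendsto M atTop (𝓝 m))
    (hlim : ∀ a, 0 ≤ a → Tendsto (fun n => F n a) atTop (𝓝 (f a))) : SubMarkovian P m f where
  nonneg a ha := ge_of_tendsto (hlim a ha) (Eventually.of_forall fun n => (hF n).nonneg a ha)
  le a ha := le_of_tendsto_of_tendsto (hlim a ha) hM
    (Eventually.of_forall fun n => (hF n).le a ha)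
  ae_le u c hc hu := by
    obtain ⟨B, hB⟩ := hM.bddAbove_range
    have hcalc : Tendsto (fun n => spectralCalculus P (F n) u) atTop
        (𝓝 (spectralCalculus P f u)) :=
      hP.tendsto_calculus (fun n a ha => ((hF n).abs_le a ha).trans (hB ⟨n, rfl⟩)) hlim u
    have happrox : ∀ k : ℕ, ∀ᵐ x ∂μ, spectralCalculus P f u x ≤ m * c + 1 / ((k : ℝ) + 1) :=
      fun k => by
        refine (isClosed_setOf_ae_le fun _ => m * c + 1 / ((k : ℝ) + 1)).mem_of_tendsto hcalc ?_
        filter_upwards [(hM.mul_const c).eventually_lt_const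
          (lt_add_of_pos_right (m * c) (Nat.one_div_pos_of_nat (n := k)))] with n hn
        filter_upwards [(hF n).ae_le u c hc hu] with x hx using hx.trans hn.le
    filter_upwards [ae_all_iff.2 happrox] with x hx
    simpa using ge_of_tendsto (tendsto_one_div_add_atTop_nhds_zero_nat.const_add (m * c))
      (Eventually.of_forall hx)

theorem exp (hf : SubMarkovian P m f) : SubMarkovian P (Real.exp m) (fun a => Real.exp (f a)) := by
  refine SubMarkovian.of_tendsto hP
    (F := fun n a => (1 + f a / n) ^ n) (M := fun n => (1 + m / n) ^ n) (fun n => ?_)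
    (Real.tendsto_one_add_div_pow_exp m)
    (fun a _ => Real.tendsto_one_add_div_pow_exp (f a))
  refine SubMarkovian.pow hP ?_ n
  have := (SubMarkovian.one hP).add hP (hf.const_mul hP (by positivity : (0 : ℝ) ≤ 1 / (n : ℝ)))
  simpa only [one_div, div_eq_inv_mul, mul_one] using this

end SubMarkovian

theorem choose_succ_mul (s : ℝ) (k : ℕ) :
    Ring.choose s (k + 1) * (k + 1) = Ring.choose s k * (s - k) := by
  simpa [mul_comm] using Ring.choose_smul_choose s k.le_succ

theorem neg_one_pow_mul_choose_succ_nonneg {s : ℝ} (hs0 : 0 ≤ s) (hs1 : s ≤ 1) (k : ℕ) :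
    0 ≤ (-1) ^ k * Ring.choose s (k + 1) := by
  induction k with
  | zero => simpa [Ring.choose_one_right] using hs0
  | succ k ih =>
    have hk : (0 : ℝ) < k + 1 + 1 := by positivity
    have hrec : (-1 : ℝ) ^ (k + 1) * Ring.choose s (k + 1 + 1)
        = ((-1) ^ k * Ring.choose s (k + 1)) * ((k + 1 - s) / (k + 1 + 1)) := by
      have h := choose_succ_mul s (k + 1)
      push_cast at h
      rw [pow_succ, mul_div_assoc', eq_div_iff hk.ne', mul_assoc, h]
      ring
    rw [hrec]
    exact mul_nonneg ih (div_nonneg (by linarith [(Nat.cast_nonneg k : (0 : ℝ) ≤ k)]) hk.le)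

theorem hasSum_one_sub_one_sub_rpow {s x : ℝ} (hx0 : 0 ≤ x) (hx1 : x < 1) :
    HasSum (fun k : ℕ => ((-1) ^ k * Ring.choose s (k + 1)) * x ^ (k + 1)) (1 - (1 - x) ^ s) := by
  have h := (Real.one_add_rpow_hasFPowerSeriesOnBall_zero (a := s)).hasSum (y := -x) (by
    simpa [abs_of_nonneg hx0, edist_dist, Real.dist_eq] using hx1)
  simp only [binomialSeries_apply, zero_add, List.ofFn_const, List.prod_replicate,
    smul_eq_mul] at h
  have htail := (hasSum_nat_add_iff' 1).2 h
  simp only [Finset.range_one, Finset.sum_singleton, Ring.choose_zero_right, pow_zero, mul_one,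
    ← sub_eq_add_neg] at htail
  have hterm : (fun k : ℕ => ((-1) ^ k * Ring.choose s (k + 1)) * x ^ (k + 1))
      = fun k : ℕ => -(Ring.choose s (k + 1) * (-x) ^ (k + 1)) := by
    funext k
    rw [neg_pow x, pow_succ (-1 : ℝ)]
    ring
  rw [hterm, ← neg_sub]
  exact htail.neg

namespace SubMarkovian

variable {P : ℝ → Lp ℝ 2 μ →L[ℝ] Lp ℝ 2 μ} (hP : IsSpectralFamily P) {s t m : ℝ} {f : ℝ → ℝ}

include hP

theorem one_sub_one_sub_rpow (hf : SubMarkovian P m f) (hm : m < 1) (hs0 : 0 ≤ s) (hs1 : s ≤ 1) :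
    SubMarkovian P (1 - (1 - m) ^ s) (fun a => 1 - (1 - f a) ^ s) :=
  SubMarkovian.of_tendsto hP
    (fun n => SubMarkovian.sum hP n fun k =>
      (hf.pow hP (k + 1)).const_mul hP (neg_one_pow_mul_choose_succ_nonneg hs0 hs1 k))
    (hasSum_one_sub_one_sub_rpow hf.bound_nonneg hm).tendsto_sum_nat
    fun a ha => (hasSum_one_sub_one_sub_rpow (hf.nonneg a ha)
      ((hf.le a ha).trans_lt hm)).tendsto_sum_nat

theorem exp_neg_mul_one_sub_rpow (hf : SubMarkovian P m f) (hm : m < 1) (hs0 : 0 ≤ s)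
    (hs1 : s ≤ 1) (ht : 0 ≤ t) :
    SubMarkovian P (Real.exp (-(t * (1 - m) ^ s))) (fun a => Real.exp (-(t * (1 - f a) ^ s))) := by
  have hsplit : ∀ y : ℝ, Real.exp (-(t * (1 - y) ^ s))
      = Real.exp (-t) * Real.exp (t * (1 - (1 - y) ^ s)) := fun y => by
    rw [← Real.exp_add]
    ring_nf
  simp only [hsplit]
  exact (((hf.one_sub_one_sub_rpow hP hm hs0 hs1).const_mul hP ht).exp hP).const_mul hP
    (Real.exp_nonneg _)

variable (hres : ∀ r : ℝ, 0 < r → SubMarkovian P 1 (fun a => r / (r + a)))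

include hres

/-- The bounded operator `1 - r (r + ε + L)⁻¹`, multiplied by `r`, approximates `ε + L` as
`r → ∞`; the shift by `ε` keeps `r (r + ε + L)⁻¹` away from norm `1`, where the binomial series
stops converging. -/
theorem exp_neg_add_rpow (hs0 : 0 ≤ s) (hs1 : s ≤ 1) (ht : 0 ≤ t) {ε : ℝ} (hε : 0 < ε) :
    SubMarkovian P (Real.exp (-(t * ε ^ s))) (fun a => Real.exp (-(t * (ε + a) ^ s))) := by
  have hlim : ∀ b, 0 < b → Tendsto (fun n : ℕ => Real.exp (-(t * (n : ℝ) ^ s *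
      (1 - n / (n + b)) ^ s))) atTop (𝓝 (Real.exp (-(t * b ^ s)))) := fun b hb => by
    have hone : Tendsto (fun n : ℕ => (n : ℝ) / (n + b)) atTop (𝓝 1) :=
      tendsto_natCast_div_add_atTop b
    have hmain : Tendsto (fun n : ℕ => b * ((n : ℝ) / (n + b))) atTop (𝓝 (b * 1)) :=
      hone.const_mul b
    rw [mul_one] at hmain
    refine ((Real.continuous_exp.tendsto _).comp
      ((hmain.rpow_const (Or.inr hs0)).const_mul t).neg).congr fun n => ?_
    have hnb : (n : ℝ) + b ≠ 0 := by positivity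
    rw [Function.comp_apply, mul_assoc, ← Real.mul_rpow (Nat.cast_nonneg n), one_sub_div hnb]
    · congr 4
      field_simp
      ring
    · rw [one_sub_div hnb, add_sub_cancel_left]
      positivity
  have happrox : ∀ n : ℕ, SubMarkovian P (n / (n + ε)) (fun a => n / (n + (ε + a))) := fun n => by
    have hε' : (n : ℝ) + ε ≠ 0 := by positivity
    simpa only [mul_one, add_assoc, div_mul_div_cancel₀ hε'] using
      (hres (n + ε) (by positivity)).const_mul hP (by positivity : 0 ≤ (n : ℝ) / (n + ε))
  exact SubMarkovian.of_tendsto hP (fun n => (happrox n).exp_neg_mul_one_sub_rpow hP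
    ((div_lt_one (by positivity)).2 (by linarith)) hs0 hs1
    (mul_nonneg ht (Real.rpow_nonneg (Nat.cast_nonneg n) s)))
    (hlim ε hε) fun a ha => hlim (ε + a) (by positivity)

theorem exp_neg_rpow (hs0 : 0 < s) (hs1 : s ≤ 1) (ht : 0 ≤ t) :
    SubMarkovian P 1 (fun a => Real.exp (-(t * a ^ s))) := by
  have hlim : ∀ a, Tendsto (fun n : ℕ => Real.exp (-(t * (1 / ((n : ℝ) + 1) + a) ^ s))) atTop
      (𝓝 (Real.exp (-(t * a ^ s)))) := fun a => by
    have hshift := (tendsto_one_div_add_atTop_nhds_zero_nat (𝕜 := ℝ)).add_const a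
    rw [zero_add] at hshift
    exact (Real.continuous_exp.tendsto _).comp
      ((hshift.rpow_const (Or.inr hs0.le)).const_mul t).neg
  refine SubMarkovian.of_tendsto hP
    (fun n => exp_neg_add_rpow hP hres hs0.le hs1 ht (Nat.one_div_pos_of_nat (n := n)))
    ?_ fun a _ => hlim a
  simpa [Real.zero_rpow hs0.ne'] using hlim 0

end SubMarkovian

end SubMarkovian

section L2

variable {X : Type*} [MeasurableSpace X] {μ : Measure X}

theorem inner_toLp_toLp {f g : X → ℝ} (hf : MemLp f 2 μ) (hg : MemLp g 2 μ) :
    inner ℝ (hf.toLp f) (hg.toLp g) = ∫ x, f x * g x ∂μ := by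
  rw [L2.inner_def]
  refine integral_congr_ae ?_
  filter_upwards [hf.coeFn_toLp, hg.coeFn_toLp] with x hfx hgx
  rw [hfx, hgx, real_inner_eq_re_inner, RCLike.inner_apply]
  simp [mul_comm]

theorem inner_eq_integral (f g : Lp ℝ 2 μ) : inner ℝ f g = ∫ x, f x * g x ∂μ := by
  rw [← inner_toLp_toLp (Lp.memLp f) (Lp.memLp g)]
  simp

theorem norm_toLp_sq_eq_integral_norm_sq {E : Type*} [NormedAddCommGroup E]
    [InnerProductSpace ℝ E] {f : X → E} (hf : MemLp f 2 μ) :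
    ‖hf.toLp f‖ ^ 2 = ∫ x, ‖f x‖ ^ 2 ∂μ := by
  rw [← real_inner_self_eq_norm_sq, L2.inner_def]
  refine integral_congr_ae ?_
  filter_upwards [hf.coeFn_toLp] with x hx
  rw [hx, real_inner_self_eq_norm_sq]

theorem norm_toLp_sq {f : X → ℝ} (hf : MemLp f 2 μ) : ‖hf.toLp f‖ ^ 2 = ∫ x, f x ^ 2 ∂μ := by
  simpa using norm_toLp_sq_eq_integral_norm_sq hf

theorem abs_integral_mul_le {f g : X → ℝ} (hf : MemLp f 2 μ) (hg : MemLp g 2 μ) :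
    |∫ x, f x * g x ∂μ| ≤ ‖hf.toLp f‖ * ‖hg.toLp g‖ := by
  rw [← inner_toLp_toLp hf hg]
  exact abs_real_inner_le_norm _ _

theorem norm_le_of_forall_inner_le {H : Type*} [NormedAddCommGroup H] [InnerProductSpace ℝ H]
    {S : Set H} (hS : Dense S) {f : H} {C : ℝ} (hC : 0 ≤ C)
    (h : ∀ w ∈ S, inner ℝ w f ≤ C * ‖w‖) :
    ‖f‖ ≤ C := by
  have hclosed : IsClosed {w : H | inner ℝ w f ≤ C * ‖w‖} :=
    isClosed_le (by fun_prop) (by fun_prop)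
  have hself : inner ℝ f f ≤ C * ‖f‖ := hclosed.closure_subset_iff.2 h (hS f)
  rw [real_inner_self_eq_norm_sq, sq] at hself
  rcases eq_or_ne f 0 with hf | hf
  · rwa [hf, norm_zero]
  · exact le_of_mul_le_mul_right hself (norm_pos_iff.2 hf)

theorem tendsto_inner_of_dense {H ι : Type*} [NormedAddCommGroup H] [InnerProductSpace ℝ H]
    {S : Set H} (hS : Dense S) {l : Filter ι} {W : ι → H} {g : H} {M : ℝ}
    (hW : ∀ᶠ i in l, ‖W i‖ ≤ M)
    (h : ∀ w ∈ S, Tendsto (fun i => inner ℝ w (W i)) l (𝓝 (inner ℝ w g))) (w : H) :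
    Tendsto (fun i => inner ℝ w (W i)) l (𝓝 (inner ℝ w g)) := by
  rw [Metric.tendsto_nhds]
  intro ε hε
  set K := |M| + ‖g‖ + 1
  have hK : 0 < K := by positivity
  obtain ⟨v, hv, hvw⟩ := hS.exists_dist_lt w (ε := ε / 2 / K) (by positivity)
  rw [dist_eq_norm] at hvw
  filter_upwards [hW, Metric.tendsto_nhds.1 (h v hv) (ε / 2) (by positivity)] with i hWi hvi
  rw [Real.dist_eq] at hvi ⊢
  have hsplit : inner ℝ w (W i) - inner ℝ w g
      = inner ℝ (w - v) (W i - g) + (inner ℝ v (W i) - inner ℝ v g) := by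
    simp only [inner_sub_left, inner_sub_right]
    ring
  have hnorm : ‖W i - g‖ ≤ K := by
    linarith [norm_sub_le (W i) g, le_abs_self M, hWi]
  have hsmall : |inner ℝ (w - v) (W i - g)| ≤ ε / 2 := by
    calc |inner ℝ (w - v) (W i - g)| ≤ ‖w - v‖ * ‖W i - g‖ := abs_real_inner_le_norm _ _
      _ ≤ ε / 2 / K * K := by gcongr
      _ = ε / 2 := by field_simp
  rw [hsplit]
  exact (abs_add_le _ _).trans_lt (by linarith)

end L2

variable {N : ℕ} {Ω U : Set (Space N)}

section TestFunctions

theorem IsTestFunction.differentiable {φ : Space N → ℝ} (hφ : IsTestFunction Ω φ) :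
    Differentiable ℝ φ := hφ.contDiff.differentiable (by simp)

theorem IsTestFunction.mono {φ : Space N → ℝ} (hφ : IsTestFunction U φ) (h : U ⊆ Ω) :
    IsTestFunction Ω φ := ⟨hφ.contDiff, hφ.hasCompactSupport, hφ.tsupport_subset.trans h⟩

theorem IsTestFunction.eq_zero {φ : Space N → ℝ} (hφ : IsTestFunction Ω φ) {x : Space N}
    (hx : x ∉ Ω) : φ x = 0 :=
  image_eq_zero_of_notMem_tsupport fun h => hx (hφ.tsupport_subset h)

theorem IsTestFunction.memLp_volume {φ : Space N → ℝ} (hφ : IsTestFunction Ω φ) (p : ℝ≥0∞) :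
    MemLp φ p volume :=
  hφ.contDiff.continuous.memLp_of_hasCompactSupport hφ.hasCompactSupport

theorem IsTestFunction.fderiv_apply {φ : Space N → ℝ} (hφ : IsTestFunction Ω φ) (e : Space N) :
    IsTestFunction Ω (fun x => fderiv ℝ φ x e) where
  contDiff := (hφ.contDiff.fderiv_right (m := ((⊤ : ℕ∞) : WithTop ℕ∞)) (by simp)).clm_apply
    contDiff_const
  hasCompactSupport := hφ.hasCompactSupport.fderiv_apply (𝕜 := ℝ) e
  tsupport_subset := (tsupport_fderiv_apply_subset ℝ e).trans hφ.tsupport_subset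

theorem IsTestFunction.zero : IsTestFunction Ω (fun _ => 0) where
  contDiff := contDiff_const
  hasCompactSupport := HasCompactSupport.zero
  tsupport_subset := by simp [tsupport]

theorem IsTestFunction.smul {φ : Space N → ℝ} (hφ : IsTestFunction Ω φ) (c : ℝ) :
    IsTestFunction Ω (fun x => c * φ x) where
  contDiff := contDiff_const.mul hφ.contDiff
  hasCompactSupport := hφ.hasCompactSupport.mul_left
  tsupport_subset := (tsupport_mul_subset_right).trans hφ.tsupport_subset

theorem IsTestFunction.add {φ ψ : Space N → ℝ} (hφ : IsTestFunction Ω φ)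
    (hψ : IsTestFunction Ω ψ) : IsTestFunction Ω (fun x => φ x + ψ x) where
  contDiff := hφ.contDiff.add hψ.contDiff
  hasCompactSupport := hφ.hasCompactSupport.add hψ.hasCompactSupport
  tsupport_subset := (tsupport_add φ ψ).trans (union_subset hφ.tsupport_subset hψ.tsupport_subset)

theorem IsTestFunction.comp_sub {φ : Space N → ℝ} (hφ : IsTestFunction U φ) {z : Space N}
    (h : ∀ x ∈ U, x + z ∈ Ω) : IsTestFunction Ω (fun y => φ (y - z)) where
  contDiff := hφ.contDiff.comp (contDiff_id.sub contDiff_const)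
  hasCompactSupport := hφ.hasCompactSupport.comp_homeomorph (Homeomorph.subRight z)
  tsupport_subset := by
    have := tsupport_comp_eq_preimage φ (Homeomorph.subRight z)
    simp only [Function.comp_def, Homeomorph.coe_subRight] at this
    rw [this]
    intro y hy
    simpa using h _ (hφ.tsupport_subset hy)

theorem IsTestFunction.comp {φ : Space N → ℝ} (hφ : IsTestFunction Ω φ) {Φ : ℝ → ℝ}
    (hΦ : ContDiff ℝ (⊤ : ℕ∞) Φ) (h0 : Φ 0 = 0) : IsTestFunction Ω (fun x => Φ (φ x)) where
  contDiff := hΦ.comp hφ.contDiff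
  hasCompactSupport := hφ.hasCompactSupport.comp_left h0
  tsupport_subset := (closure_mono (Function.support_comp_subset h0 φ)).trans hφ.tsupport_subset

/-- The classes in `L^2(U)` of the test functions `C_c^∞(U)`. -/
def testSpace (U : Set (Space N)) : Submodule ℝ (L2 U) where
  carrier := {w | ∃ (ψ : Space N → ℝ) (hψ : IsTestFunction U ψ), w = hψ.memLp.toLp ψ}
  zero_mem' := ⟨_, IsTestFunction.zero, (MemLp.toLp_zero _).symm⟩
  add_mem' := by
    rintro _ _ ⟨φ, hφ, rfl⟩ ⟨ψ, hψ, rfl⟩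
    exact ⟨_, hφ.add hψ, (MemLp.toLp_add _ _).symm⟩
  smul_mem' := by
    rintro c _ ⟨φ, hφ, rfl⟩
    exact ⟨_, hφ.smul c, (MemLp.toLp_const_smul c _).symm⟩

theorem dense_testSpace (hU : IsOpen U) : Dense (testSpace U : Set (L2 U)) := by
  rw [Submodule.dense_iff_topologicalClosure_eq_top, Submodule.topologicalClosure_eq_top_iff,
    Submodule.eq_bot_iff]
  intro v hv
  rw [Submodule.mem_orthogonal] at hv
  have hloc : LocallyIntegrableOn v U volume :=
    locallyIntegrableOn_of_locallyIntegrable_restrict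
      ((Lp.memLp v).locallyIntegrable (by norm_num))
  refine Lp.eq_zero_iff_ae_eq_zero.2 ((ae_restrict_iff' hU.measurableSet).2 ?_)
  refine hU.ae_eq_zero_of_integral_contDiff_smul_eq_zero hloc fun ψ hsmooth hcpt hsupp => ?_
  have hψ : IsTestFunction U ψ := ⟨hsmooth, hcpt, hsupp⟩
  have horth := hv _ ⟨ψ, hψ, rfl⟩
  rw [← Lp.toLp_coeFn v (Lp.memLp v), inner_toLp_toLp] at horth
  rw [← horth]
  refine (setIntegral_eq_integral_of_forall_compl_eq_zero fun x hx => ?_).symm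
  rw [hψ.eq_zero hx, zero_smul]

end TestFunctions

section Sobolev

theorem IsTestFunction.inner_integral_smul_gradient {φ : Space N → ℝ} (hφ : IsTestFunction Ω φ)
    (u : L2 Ω) (e : Space N) :
    inner ℝ e (∫ x in Ω, u x • gradient φ x) = ∫ x in Ω, u x * fderiv ℝ φ x e := by
  have hint : Integrable (fun x => u x • gradient φ x) (volume.restrict Ω) :=
    memLp_one_iff_integrable.1 (hφ.memLp_gradient.smul (Lp.memLp u))
  rw [← integral_inner hint]
  refine integral_congr_ae (Eventually.of_forall fun x => ?_)
  exact (real_inner_smul_right _ _ _).trans (by rw [inner_gradient_right]; rfl)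

theorem IsTestFunction.inner_integral_smul {φ : Space N → ℝ} (hφ : IsTestFunction Ω φ)
    (G : L2Vec Ω) (e : Space N) :
    inner ℝ e (∫ x in Ω, φ x • G x) = ∫ x in Ω, φ x * inner ℝ (G x) e := by
  have hint : Integrable (fun x => φ x • G x) (volume.restrict Ω) :=
    memLp_one_iff_integrable.1 ((Lp.memLp G).smul hφ.memLp)
  rw [← integral_inner hint]
  refine integral_congr_ae (Eventually.of_forall fun x => ?_)
  exact (real_inner_smul_right _ _ _).trans (by rw [real_inner_comm])

theorem mem_sobolevH1_iff {z : L2 Ω × L2Vec Ω} : z ∈ sobolevH1 Ω ↔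
    ∀ φ : Space N → ℝ, IsTestFunction Ω φ → ∀ e : Space N,
      ∫ x in Ω, z.1 x * fderiv ℝ φ x e = - ∫ x in Ω, φ x * inner ℝ (z.2 x) e := by
  refine forall_congr' fun φ => forall_congr' fun hφ => ?_
  simp only [← hφ.inner_integral_smul_gradient, ← hφ.inner_integral_smul, ← inner_neg_right]
  exact ⟨fun h e => by rw [h], ext_inner_left ℝ⟩

theorem IsTestFunction.memLp_smul {φ : Space N → ℝ} (hφ : IsTestFunction Ω φ) (e : Space N) :
    MemLp (fun x => φ x • e) 2 (volume.restrict Ω) :=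
  ((hφ.contDiff.continuous.smul continuous_const).memLp_of_hasCompactSupport
    hφ.hasCompactSupport.smul_right).restrict Ω

theorem isClosed_sobolevH1 : IsClosed (sobolevH1 Ω : Set (L2 Ω × L2Vec Ω)) := by
  have : (sobolevH1 Ω : Set (L2 Ω × L2Vec Ω)) = ⋂ (φ : Space N → ℝ) (hφ : IsTestFunction Ω φ)
      (e : Space N), {z | inner ℝ z.1 ((hφ.fderiv_apply e).memLp.toLp _)
        = - inner ℝ ((hφ.memLp_smul e).toLp _) z.2} := by
    ext z
    simp only [SetLike.mem_coe, mem_sobolevH1_iff, mem_iInter, mem_ofPred_eq]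
    refine forall_congr' fun φ => forall_congr' fun hφ => forall_congr' fun e => ?_
    have hleft : inner ℝ z.1 ((hφ.fderiv_apply e).memLp.toLp _)
        = ∫ x in Ω, z.1 x * fderiv ℝ φ x e := by
      rw [← inner_toLp_toLp (Lp.memLp z.1) (hφ.fderiv_apply e).memLp, Lp.toLp_coeFn]
    have hright : inner ℝ ((hφ.memLp_smul e).toLp _) z.2 = ∫ x in Ω, φ x * inner ℝ (z.2 x) e := by
      rw [L2.inner_def]
      refine integral_congr_ae ?_
      filter_upwards [(hφ.memLp_smul e).coeFn_toLp] with x hx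
      rw [hx, real_inner_smul_left, real_inner_comm]
    rw [hleft, hright]
  rw [this]
  exact isClosed_iInter fun φ => isClosed_iInter fun hφ => isClosed_iInter fun e =>
    isClosed_eq (by fun_prop) (by fun_prop)

theorem IsTestFunction.setIntegral_eq {φ : Space N → ℝ} (hφ : IsTestFunction Ω φ)
    (f : Space N → ℝ) : ∫ x in Ω, f x * φ x = ∫ x, f x * φ x :=
  setIntegral_eq_integral_of_forall_compl_eq_zero fun x hx => by rw [hφ.eq_zero hx, mul_zero]

theorem IsTestFunction.integral_mul_fderiv {φ ψ : Space N → ℝ} (hφ : IsTestFunction Ω φ)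
    (hψ : IsTestFunction Ω ψ) (e : Space N) :
    ∫ x, φ x * fderiv ℝ ψ x e = - ∫ x, fderiv ℝ φ x e * ψ x := by
  refine integral_mul_fderiv_eq_neg_fderiv_mul_of_integrable ?_ ?_ ?_
    (fun x _ => hφ.differentiable x) (fun x _ => hψ.differentiable x)
  · exact ((hφ.fderiv_apply e).memLp_volume 2).integrable_mul (hψ.memLp_volume 2)
  · exact (hφ.memLp_volume 2).integrable_mul ((hψ.fderiv_apply e).memLp_volume 2)
  · exact (hφ.memLp_volume 2).integrable_mul (hψ.memLp_volume 2)

/-- The element `(φ, ∇φ)` of `H^1_0(Ω)`. -/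
def IsTestFunction.toSobolev {φ : Space N → ℝ} (hφ : IsTestFunction Ω φ) : L2 Ω × L2Vec Ω :=
  (hφ.memLp.toLp φ, hφ.memLp_gradient.toLp (gradient φ))

theorem IsTestFunction.toSobolev_mem_sobolevH1 {φ : Space N → ℝ} (hφ : IsTestFunction Ω φ) :
    hφ.toSobolev ∈ sobolevH1 Ω := by
  rw [mem_sobolevH1_iff]
  intro ψ hψ e
  have hleft : ∫ x in Ω, hφ.memLp.toLp φ x * fderiv ℝ ψ x e = ∫ x, φ x * fderiv ℝ ψ x e := by
    rw [← (hψ.fderiv_apply e).setIntegral_eq]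
    refine integral_congr_ae ?_
    filter_upwards [hφ.memLp.coeFn_toLp] with x hx
    rw [hx]
  have hright : ∫ x in Ω, ψ x * inner ℝ (hφ.memLp_gradient.toLp (gradient φ) x) e
      = ∫ x, fderiv ℝ φ x e * ψ x := by
    rw [← hψ.setIntegral_eq]
    refine integral_congr_ae ?_
    filter_upwards [hφ.memLp_gradient.coeFn_toLp] with x hx
    rw [hx, inner_gradient_left, mul_comm]
  simp only [IsTestFunction.toSobolev]
  rw [hleft, hright]
  exact hφ.integral_mul_fderiv hψ e

theorem sobolevH10_le_sobolevH1 : sobolevH10 Ω ≤ sobolevH1 Ω := by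
  refine Submodule.topologicalClosure_minimal _ ?_ isClosed_sobolevH1
  rw [Submodule.span_le]
  rintro _ ⟨φ, hφ, rfl⟩
  exact hφ.toSobolev_mem_sobolevH1

theorem formDomain_le_sobolevH1 (bc : BoundaryCondition) : formDomain Ω bc ≤ sobolevH1 Ω := by
  cases bc
  · exact sobolevH10_le_sobolevH1
  · exact le_rfl

theorem isClosed_formDomain (bc : BoundaryCondition) :
    IsClosed (formDomain Ω bc : Set (L2 Ω × L2Vec Ω)) := by
  cases bc
  · exact Submodule.isClosed_topologicalClosure _
  · exact isClosed_sobolevH1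

theorem IsTestFunction.toSobolev_mem_formDomain {φ : Space N → ℝ} (hφ : IsTestFunction Ω φ)
    (bc : BoundaryCondition) : hφ.toSobolev ∈ formDomain Ω bc := by
  cases bc
  · exact Submodule.le_topologicalClosure _ (Submodule.subset_span ⟨φ, hφ, rfl⟩)
  · exact hφ.toSobolev_mem_sobolevH1

end Sobolev

section Translation

theorem IsTestFunction.aestronglyMeasurable_comp_sub {ψ : Space N → ℝ} (hψ : IsTestFunction U ψ)
    (z : Space N) : AEStronglyMeasurable (fun y => ψ (y - z)) volume :=
  (hψ.contDiff.continuous.comp (by fun_prop)).aestronglyMeasurable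

theorem IsTestFunction.integrable_mul_comp_sub {ψ : Space N → ℝ} (hψ : IsTestFunction U ψ)
    {v : Space N → ℝ} (hv : Integrable v) (z : Space N) :
    Integrable (fun y => v y * ψ (y - z)) := by
  obtain ⟨C, hC⟩ := hψ.contDiff.continuous.bounded_above_of_compact_support hψ.hasCompactSupport
  exact hv.mul_bdd (hψ.aestronglyMeasurable_comp_sub z) (Eventually.of_forall fun y => hC _)

theorem IsTestFunction.hasDerivAt_integral_mul_comp_sub {ψ : Space N → ℝ}
    (hψ : IsTestFunction U ψ) {v : Space N → ℝ} (hv : Integrable v) (z : Space N) (τ : ℝ) :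
    HasDerivAt (fun τ : ℝ => ∫ y, v y * ψ (y - τ • z))
      (- ∫ y, v y * fderiv ℝ ψ (y - τ • z) z) τ := by
  obtain ⟨C, hC⟩ := (hψ.fderiv_apply z).contDiff.continuous.bounded_above_of_compact_support
    (hψ.fderiv_apply z).hasCompactSupport
  rw [← integral_neg]
  refine (hasDerivAt_integral_of_dominated_loc_of_deriv_le (s := univ)
    (bound := fun y => ‖v y‖ * C) (F' := fun τ y => -(v y * fderiv ℝ ψ (y - τ • z) z))
    univ_mem ?_ ?_ ?_ ?_ ?_ ?_).2
  · exact Eventually.of_forall fun τ =>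
      hv.aestronglyMeasurable.mul (hψ.aestronglyMeasurable_comp_sub _)
  · exact hψ.integrable_mul_comp_sub hv _
  · exact (hv.aestronglyMeasurable.mul ((hψ.fderiv_apply z).aestronglyMeasurable_comp_sub _)).neg
  · refine Eventually.of_forall fun y τ _ => ?_
    rw [norm_neg, norm_mul]
    exact mul_le_mul_of_nonneg_left (hC _) (norm_nonneg _)
  · exact hv.norm.mul_const C
  · refine Eventually.of_forall fun y τ _ => ?_
    have hshift : HasDerivAt (fun τ : ℝ => y - τ • z) (-z) τ := by
      simpa using ((hasDerivAt_id τ).smul_const z).const_sub y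
    simpa using
      ((hψ.differentiable (y - τ • z)).hasFDerivAt.comp_hasDerivAt τ hshift).const_mul (v y)

theorem IsTestFunction.norm_toLp_comp_sub {ψ : Space N → ℝ} {z : Space N}
    (hψ : IsTestFunction U ψ) (hψz : IsTestFunction Ω (fun y => ψ (y - z))) :
    ‖hψz.memLp.toLp _‖ = ‖hψ.memLp.toLp ψ‖ := by
  rw [← sq_eq_sq₀ (norm_nonneg _) (norm_nonneg _), norm_toLp_sq, norm_toLp_sq]
  simp only [sq]
  rw [hψ.setIntegral_eq, hψz.setIntegral_eq,
    integral_sub_right_eq_self (fun y => ψ y * ψ y)]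

theorem IsTestFunction.integral_translate_sub_mul {ψ : Space N → ℝ} (hψ : IsTestFunction U ψ)
    {v : Space N → ℝ} (hv : Integrable v) (e : Space N) :
    ∫ x, (v (x + e) - v x) * ψ x = (∫ y, v y * ψ (y - e)) - ∫ y, v y * ψ y := by
  have hint : Integrable (fun x => v (x + e) * ψ x) := by
    simpa using (hψ.integrable_mul_comp_sub hv e).comp_add_right e
  have hint₀ : Integrable (fun x => v x * ψ x) := by
    simpa using hψ.integrable_mul_comp_sub hv 0
  rw [← integral_add_right_eq_self (fun y => v y * ψ (y - e)) e]
  simp only [add_sub_cancel_right, sub_mul]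
  exact integral_sub hint hint₀

variable (hΩ : MeasurableSet Ω) (hfin : volume Ω ≠ ∞)

include hΩ in
theorem memLp_indicator (u : L2 Ω) : MemLp (Ω.indicator u) 2 volume :=
  (memLp_indicator_iff_restrict hΩ).2 (Lp.memLp u)

include hΩ hfin in
theorem integrable_indicator_of_memLp {u : Space N → ℝ} (hu : MemLp u 2 (volume.restrict Ω)) :
    Integrable (Ω.indicator u) volume := by
  rw [integrable_indicator_iff hΩ]
  have : IsFiniteMeasure (volume.restrict Ω) := ⟨by simpa using hfin.lt_top⟩
  exact hu.integrable (by norm_num)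

include hΩ in
theorem neg_integral_indicator_mul_fderiv {z : L2 Ω × L2Vec Ω} (hz : z ∈ sobolevH1 Ω)
    {φ : Space N → ℝ} (hφ : IsTestFunction Ω φ) (e : Space N) :
    - ∫ x, Ω.indicator z.1 x * fderiv ℝ φ x e = ∫ x in Ω, φ x * inner ℝ (z.2 x) e := by
  rw [← neg_eq_iff_eq_neg.2 (mem_sobolevH1_iff.1 hz φ hφ e), ← integral_indicator hΩ]
  congr 2
  ext x
  by_cases hx : x ∈ Ω <;> simp [hx]

theorem norm_toLp_inner_const_le (G : L2Vec Ω) (e : Space N) :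
    ‖((Lp.memLp G).inner_const (𝕜 := ℝ) e).toLp _‖ ≤ ‖G‖ * ‖e‖ := by
  rw [mul_comm]
  refine Lp.norm_le_mul_norm_of_ae_le_mul ?_
  filter_upwards [((Lp.memLp G).inner_const (𝕜 := ℝ) e).coeFn_toLp] with x hx
  rw [hx, mul_comm]
  exact norm_inner_le_norm _ _

include hΩ hfin in
theorem abs_integral_translate_sub_le {z : L2 Ω × L2Vec Ω} (hz : z ∈ sobolevH1 Ω)
    {e : Space N} (hU : ∀ x ∈ U, ∀ τ ∈ Icc (0 : ℝ) 1, x + τ • e ∈ Ω)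
    {ψ : Space N → ℝ} (hψ : IsTestFunction U ψ) :
    |∫ x, (Ω.indicator z.1 (x + e) - Ω.indicator z.1 x) * ψ x|
      ≤ ‖z.2‖ * ‖e‖ * ‖hψ.memLp.toLp ψ‖ := by
  have hv := integrable_indicator_of_memLp hΩ hfin (Lp.memLp z.1)
  have hderiv : ∀ τ ∈ Ico (0 : ℝ) 1,
      ‖-∫ y, Ω.indicator z.1 y * fderiv ℝ ψ (y - τ • e) e‖
        ≤ ‖z.2‖ * ‖e‖ * ‖hψ.memLp.toLp ψ‖ := fun τ hτ => by
    have hψτ : IsTestFunction Ω (fun y => ψ (y - τ • e)) :=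
      hψ.comp_sub fun x hx => hU x hx τ (Ico_subset_Icc_self hτ)
    have hweak := neg_integral_indicator_mul_fderiv hΩ hz hψτ e
    simp only [fderiv_comp_sub] at hweak
    rw [hweak, ← hψ.norm_toLp_comp_sub hψτ, Real.norm_eq_abs, mul_comm]
    refine (abs_integral_mul_le hψτ.memLp ((Lp.memLp z.2).inner_const (𝕜 := ℝ) e)).trans ?_
    gcongr
    exact norm_toLp_inner_const_le _ _
  have hmean := norm_image_sub_le_of_norm_deriv_le_segment_01'
    (fun τ _ => (hψ.hasDerivAt_integral_mul_comp_sub hv e τ).hasDerivWithinAt) hderiv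
  simpa only [one_smul, zero_smul, sub_zero, ← hψ.integral_translate_sub_mul hv,
    Real.norm_eq_abs] using hmean

include hΩ in
theorem memLp_translate_sub (u : L2 Ω) (e : Space N) :
    MemLp (fun x => Ω.indicator u (x + e) - Ω.indicator u x) 2 (volume.restrict U) := by
  have hind := memLp_indicator hΩ u
  exact ((hind.comp_measurePreserving (measurePreserving_add_right volume e)).sub hind).restrict U

include hΩ hfin in
theorem norm_translate_sub_le {z : L2 Ω × L2Vec Ω} (hz : z ∈ sobolevH1 Ω) (hUo : IsOpen U)
    {e : Space N} (hU : ∀ x ∈ U, ∀ τ ∈ Icc (0 : ℝ) 1, x + τ • e ∈ Ω) :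
    ‖(memLp_translate_sub (U := U) hΩ z.1 e).toLp _‖ ≤ ‖z.2‖ * ‖e‖ := by
  refine norm_le_of_forall_inner_le (dense_testSpace hUo) (by positivity) ?_
  rintro _ ⟨ψ, hψ, rfl⟩
  refine (le_abs_self _).trans ?_
  rw [real_inner_comm, inner_toLp_toLp, hψ.setIntegral_eq]
  exact abs_integral_translate_sub_le hΩ hfin hz hU hψ

end Translation

section ChainRule

/-- The smooth nondecreasing functions `Φ` with `Φ(0) = 0` and with bounded first and second
derivatives. They act on `H^1(Ω)` and on `H^1_0(Ω)` by composition. -/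
structure IsSmoothCutoff (Φ : ℝ → ℝ) : Prop where
  contDiff : ContDiff ℝ (⊤ : ℕ∞) Φ
  map_zero : Φ 0 = 0
  deriv_nonneg : ∀ x, 0 ≤ deriv Φ x
  exists_nnnorm_deriv_le : ∃ B : ℝ≥0, ∀ x, ‖deriv Φ x‖₊ ≤ B
  exists_lipschitzWith_deriv : ∃ K : ℝ≥0, LipschitzWith K (deriv Φ)

namespace IsSmoothCutoff

variable {Φ : ℝ → ℝ} (hΦ : IsSmoothCutoff Φ)

include hΦ

theorem continuous_deriv : Continuous (deriv Φ) := hΦ.contDiff.continuous_deriv (by simp)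

theorem differentiable : Differentiable ℝ Φ := hΦ.contDiff.differentiable (by simp)

theorem exists_abs_sub_sub_deriv_mul_le :
    ∃ K : ℝ, 0 ≤ K ∧ ∀ a b, |Φ b - Φ a - deriv Φ a * (b - a)| ≤ K * (b - a) ^ 2 := by
  obtain ⟨K, hK⟩ := hΦ.exists_lipschitzWith_deriv
  refine ⟨K, K.2, fun a b => ?_⟩
  have hderiv : ∀ x ∈ uIcc a b, HasDerivWithinAt (fun x => Φ x - deriv Φ a * x)
      (deriv Φ x - deriv Φ a) (uIcc a b) x := fun x _ => by
    have hlin : HasDerivAt (fun x => deriv Φ a * x) (deriv Φ a) x := by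
      simpa using (hasDerivAt_id x).const_mul (deriv Φ a)
    exact ((hΦ.differentiable x).hasDerivAt.sub hlin).hasDerivWithinAt
  have hbound : ∀ x ∈ uIcc a b, ‖deriv Φ x - deriv Φ a‖ ≤ K * |b - a| := fun x hx => by
    have hdist := hK.dist_le_mul x a
    rw [dist_eq_norm, Real.dist_eq] at hdist
    exact hdist.trans (mul_le_mul_of_nonneg_left (abs_sub_left_of_mem_uIcc hx) K.2)
  have hmean := (convex_uIcc a b).norm_image_sub_le_of_norm_hasDerivWithin_le hderiv hbound
    left_mem_uIcc right_mem_uIcc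
  rw [Real.norm_eq_abs, Real.norm_eq_abs, mul_assoc, abs_mul_abs_self, ← sq] at hmean
  convert hmean using 2
  ring

theorem memLp (u : L2 Ω) : MemLp (fun x => Φ (u x)) 2 (volume.restrict Ω) := by
  obtain ⟨B, hB⟩ := hΦ.exists_nnnorm_deriv_le
  exact (lipschitzWith_of_nnnorm_deriv_le hΦ.differentiable hB).comp_memLp hΦ.map_zero
    (Lp.memLp u)

theorem memLp_deriv_smul (u : L2 Ω) (G : L2Vec Ω) :
    MemLp (fun x => deriv Φ (u x) • G x) 2 (volume.restrict Ω) := by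
  obtain ⟨B, hB⟩ := hΦ.exists_nnnorm_deriv_le
  refine (Lp.memLp G).of_le_mul (c := B) ?_ (Eventually.of_forall fun x => ?_)
  · exact (hΦ.continuous_deriv.comp_aestronglyMeasurable (Lp.aestronglyMeasurable u)).smul
      (Lp.aestronglyMeasurable G)
  · rw [norm_smul]
    exact mul_le_mul_of_nonneg_right (hB _) (norm_nonneg _)

/-- The action of `Φ` on Sobolev functions, `(u, ∇u) ↦ (Φ(u), Φ'(u) ∇u)`. -/
def comp (z : L2 Ω × L2Vec Ω) : L2 Ω × L2Vec Ω :=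
  ((hΦ.memLp z.1).toLp _, (hΦ.memLp_deriv_smul z.1 z.2).toLp _)

end IsSmoothCutoff

theorem isSmoothCutoff_of_deriv_eq_zero {Φ : ℝ → ℝ} (hsmooth : ContDiff ℝ (⊤ : ℕ∞) Φ)
    (hmono : Monotone Φ) (h0 : Φ 0 = 0) {K : Set ℝ} (hK : IsCompact K)
    (hderiv : ∀ x ∉ K, deriv Φ x = 0) : IsSmoothCutoff Φ := by
  have hsupp : HasCompactSupport (deriv Φ) := HasCompactSupport.intro hK hderiv
  have hC1 : ContDiff ℝ 1 (deriv Φ) := by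
    have hC2 : ContDiff ℝ (1 + 1) Φ := hsmooth.of_le (WithTop.coe_le_coe.2 le_top)
    exact (contDiff_succ_iff_deriv.1 hC2).2.2
  obtain ⟨B, hB⟩ := hC1.continuous.bounded_above_of_compact_support hsupp
  exact ⟨hsmooth, h0, fun _ => hmono.deriv_nonneg,
    ⟨B.toNNReal, fun x => NNReal.coe_le_coe.1 ((hB x).trans (Real.le_coe_toNNReal B))⟩,
    hC1.lipschitzWith_of_hasCompactSupport hsupp (by simp)⟩

theorem isSmoothCutoff_smoothTransition {c : ℝ} (hc : 0 ≤ c) :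
    IsSmoothCutoff (fun x => Real.smoothTransition (x - c)) := by
  refine isSmoothCutoff_of_deriv_eq_zero
    (Real.smoothTransition.contDiff.comp (contDiff_id.sub contDiff_const))
    (fun x y hxy => Real.smoothTransition.monotone (by linarith))
    (Real.smoothTransition.zero_of_nonpos (by linarith)) (isCompact_Icc (a := c) (b := c + 1))
    fun x hx => ?_
  rw [mem_Icc, not_and_or, not_le, not_le] at hx
  rcases hx with hx | hx
  · have hzero : (fun x => Real.smoothTransition (x - c)) =ᶠ[𝓝 x] fun _ => 0 := by
      filter_upwards [Iio_mem_nhds hx] with y hy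
      exact Real.smoothTransition.zero_of_nonpos (by linarith [mem_Iio.1 hy])
    rw [hzero.deriv_eq, deriv_const]
  · have hone : (fun x => Real.smoothTransition (x - c)) =ᶠ[𝓝 x] fun _ => 1 := by
      filter_upwards [Ioi_mem_nhds hx] with y hy
      exact Real.smoothTransition.one_of_one_le (by linarith [mem_Ioi.1 hy])
    rw [hone.deriv_eq, deriv_const]

theorem IsTestFunction.tendsto_slope_integral {ψ : Space N → ℝ} (hψ : IsTestFunction U ψ)
    {v : Space N → ℝ} (hv : Integrable v) (e : Space N) :
    Tendsto (fun h : ℝ => h⁻¹ * ∫ x, (v (x + h • e) - v x) * ψ x) (𝓝[>] 0)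
      (𝓝 (- ∫ y, v y * fderiv ℝ ψ y e)) := by
  have hslope := (hasDerivAt_iff_tendsto_slope.1
    (hψ.hasDerivAt_integral_mul_comp_sub hv e 0)).mono_left (nhdsGT_le_nhdsNE 0)
  simp only [zero_smul, sub_zero] at hslope
  refine hslope.congr fun h => ?_
  simp only [slope_def_field, zero_smul, sub_zero, hψ.integral_translate_sub_mul hv,
    div_eq_inv_mul]

theorem norm_translate_sub_smul_le (hΩ : MeasurableSet Ω) (hfin : volume Ω ≠ ∞)
    {z : L2 Ω × L2Vec Ω} (hz : z ∈ sobolevH1 Ω) (hUo : IsOpen U) {e : Space N} {h : ℝ}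
    (hh : 0 ≤ h) (hU : ∀ x ∈ U, ∀ τ ∈ Icc (0 : ℝ) 1, x + τ • h • e ∈ Ω) :
    ‖(memLp_translate_sub (U := U) hΩ z.1 (h • e)).toLp _‖ ≤ h * (‖z.2‖ * ‖e‖) := by
  refine (norm_translate_sub_le hΩ hfin hz hUo hU).trans_eq ?_
  rw [norm_smul, Real.norm_of_nonneg hh]
  ring

theorem tendsto_integral_differenceQuotient (hΩ : MeasurableSet Ω) (hfin : volume Ω ≠ ∞)
    {z : L2 Ω × L2Vec Ω} (hz : z ∈ sobolevH1 Ω) (hUo : IsOpen U) (hUΩ : U ⊆ Ω) {e : Space N}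
    (hU : ∀ᶠ h : ℝ in 𝓝[>] 0, ∀ x ∈ U, ∀ τ ∈ Icc (0 : ℝ) 1, x + τ • h • e ∈ Ω)
    {w : Space N → ℝ} (hw : MemLp w 2 (volume.restrict U)) :
    Tendsto (fun h : ℝ => h⁻¹ * ∫ x in U, w x *
        (Ω.indicator z.1 (x + h • e) - Ω.indicator z.1 x)) (𝓝[>] 0)
      (𝓝 (∫ x in U, w x * inner ℝ (z.2 x) e)) := by
  have hG : MemLp (fun x => inner ℝ (z.2 x) e) 2 (volume.restrict U) :=
    ((Lp.memLp z.2).inner_const (𝕜 := ℝ) e).mono_measure (Measure.restrict_mono hUΩ le_rfl)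
  let quotient : ℝ → L2 U := fun h =>
    h⁻¹ • (memLp_translate_sub (U := U) hΩ z.1 (h • e)).toLp _
  have hbounded : ∀ᶠ h in 𝓝[>] 0, ‖quotient h‖ ≤ ‖z.2‖ * ‖e‖ := by
    filter_upwards [hU, self_mem_nhdsWithin] with h hh hpos
    rw [norm_smul, norm_inv, Real.norm_of_nonneg (le_of_lt hpos), inv_mul_le_iff₀ hpos]
    exact norm_translate_sub_smul_le hΩ hfin hz hUo (le_of_lt hpos) hh
  have htest : ∀ v ∈ testSpace U, Tendsto (fun h => inner ℝ v (quotient h)) (𝓝[>] 0)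
      (𝓝 (inner ℝ v (hG.toLp _))) := by
    rintro _ ⟨ψ, hψ, rfl⟩
    have hslope := hψ.tendsto_slope_integral
      (integrable_indicator_of_memLp hΩ hfin (Lp.memLp z.1)) e
    rw [neg_integral_indicator_mul_fderiv hΩ hz (hψ.mono hUΩ) e] at hslope
    have hlimit : ∫ x in Ω, ψ x * inner ℝ (z.2 x) e = inner ℝ (hψ.memLp.toLp ψ) (hG.toLp _) := by
      rw [real_inner_comm, inner_toLp_toLp, hψ.setIntegral_eq,
        ← (hψ.mono hUΩ).setIntegral_eq]
      simp only [mul_comm]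
    rw [← hlimit]
    refine hslope.congr fun h => ?_
    rw [inner_smul_right, real_inner_comm, inner_toLp_toLp, hψ.setIntegral_eq]
  have hweak := tendsto_inner_of_dense (dense_testSpace hUo) hbounded htest (hw.toLp _)
  rw [inner_toLp_toLp] at hweak
  refine hweak.congr fun h => ?_
  rw [inner_smul_right, inner_toLp_toLp]

theorem exists_isOpen_forall_add_smul_mem {E : Type*} [NormedAddCommGroup E] [NormedSpace ℝ E]
    {K O : Set E} (hK : IsCompact K) (hO : IsOpen O) (hKO : K ⊆ O) (e : E) :
    ∃ V, IsOpen V ∧ K ⊆ V ∧ V ⊆ O ∧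
      ∀ᶠ h : ℝ in 𝓝[>] 0, ∀ x ∈ V, ∀ τ ∈ Icc (0 : ℝ) 1, x + τ • h • e ∈ O := by
  obtain ⟨δ, hδ, hδO⟩ := hK.exists_thickening_subset_open hO hKO
  refine ⟨Metric.thickening (δ / 2) K, Metric.isOpen_thickening,
    Metric.self_subset_thickening (by positivity) _,
    (Metric.thickening_mono (by linarith) _).trans hδO, ?_⟩
  have hsmall : ∀ᶠ h : ℝ in 𝓝[>] 0, ‖h • e‖ < δ / 2 := by
    have hcont : Tendsto (fun h : ℝ => ‖h • e‖) (𝓝[>] 0) (𝓝 0) :=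
      Tendsto.mono_left
        (by simpa using (show Continuous fun h : ℝ => ‖h • e‖ by fun_prop).tendsto 0)
        nhdsWithin_le_nhds
    exact hcont.eventually_lt_const (by positivity)
  filter_upwards [hsmall] with h hh x hx τ hτ
  refine hδO ?_
  rw [Metric.mem_thickening_iff] at hx ⊢
  obtain ⟨y, hy, hxy⟩ := hx
  refine ⟨y, hy, ?_⟩
  have hshift : dist (x + τ • h • e) x < δ / 2 := by
    rw [dist_self_add_left, norm_smul, Real.norm_of_nonneg hτ.1]
    exact (mul_le_of_le_one_left (norm_nonneg _) hτ.2).trans_lt hh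
  linarith [dist_triangle (x + τ • h • e) x y]

theorem abs_integral_sub_integral_le_of_taylor {X : Type*} [MeasurableSpace X] {μ : Measure X}
    {Φ : ℝ → ℝ} {K A : ℝ} {φ u v : X → ℝ} (hA : 0 ≤ A) (hφ : ∀ x, |φ x| ≤ A)
    (htaylor : ∀ a b, |Φ b - Φ a - deriv Φ a * (b - a)| ≤ K * (b - a) ^ 2)
    (hD : MemLp (fun x => v x - u x) 2 μ)
    (hincr : Integrable (fun x => (Φ (v x) - Φ (u x)) * φ x) μ)
    (hlin : Integrable (fun x => φ x * deriv Φ (u x) * (v x - u x)) μ) :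
    |∫ x, (Φ (v x) - Φ (u x)) * φ x ∂μ - ∫ x, φ x * deriv Φ (u x) * (v x - u x) ∂μ|
      ≤ A * K * ‖hD.toLp _‖ ^ 2 := by
  rw [norm_toLp_sq, ← integral_const_mul, ← integral_sub hincr hlin, ← Real.norm_eq_abs]
  refine norm_integral_le_of_norm_le (hD.integrable_sq.const_mul (A * K))
    (Eventually.of_forall fun x => ?_)
  have hfactor : (Φ (v x) - Φ (u x)) * φ x - φ x * deriv Φ (u x) * (v x - u x)
      = φ x * (Φ (v x) - Φ (u x) - deriv Φ (u x) * (v x - u x)) := by ring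
  rw [hfactor, norm_mul, mul_assoc]
  exact mul_le_mul (hφ x) (htaylor _ _) (norm_nonneg _) hA

namespace IsSmoothCutoff

variable {Φ : ℝ → ℝ} (hΦ : IsSmoothCutoff Φ)

include hΦ

theorem integrable_comp_indicator (hΩ : MeasurableSet Ω) (hfin : volume Ω ≠ ∞) (u : L2 Ω) :
    Integrable (fun x => Φ (Ω.indicator u x)) := by
  refine (integrable_indicator_of_memLp hΩ hfin (hΦ.memLp u)).congr
    (Eventually.of_forall fun x => ?_)
  by_cases hx : x ∈ Ω <;> simp [hx, hΦ.map_zero]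

theorem memLp_testFunction_mul_deriv {φ : Space N → ℝ} (hφ : IsTestFunction U φ)
    {u : Space N → ℝ} (hu : AEStronglyMeasurable u) :
    MemLp (fun x => φ x * deriv Φ (u x)) 2 := by
  obtain ⟨B, hB⟩ := hΦ.exists_nnnorm_deriv_le
  refine (hφ.memLp_volume 2).of_le_mul (c := B) ?_ (Eventually.of_forall fun x => ?_)
  · exact hφ.contDiff.continuous.aestronglyMeasurable.mul
      (hΦ.continuous_deriv.comp_aestronglyMeasurable hu)
  · rw [norm_mul, mul_comm]
    exact mul_le_mul_of_nonneg_right (hB _) (norm_nonneg _)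

theorem tendsto_integral_differenceQuotient (hΩ : MeasurableSet Ω) (hfin : volume Ω ≠ ∞)
    {z : L2 Ω × L2Vec Ω} (hz : z ∈ sobolevH1 Ω) (hUo : IsOpen U) (hUΩ : U ⊆ Ω) {e : Space N}
    (hU : ∀ᶠ h : ℝ in 𝓝[>] 0, ∀ x ∈ U, ∀ τ ∈ Icc (0 : ℝ) 1, x + τ • h • e ∈ Ω)
    {φ : Space N → ℝ} (hφ : IsTestFunction U φ) :
    Tendsto (fun h : ℝ => h⁻¹ * ∫ x,
        (Φ (Ω.indicator z.1 (x + h • e)) - Φ (Ω.indicator z.1 x)) * φ x) (𝓝[>] 0)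
      (𝓝 (∫ x in U, φ x * deriv Φ (Ω.indicator z.1 x) * inner ℝ (z.2 x) e)) := by
  obtain ⟨K, hK, htaylor⟩ := hΦ.exists_abs_sub_sub_deriv_mul_le
  obtain ⟨A, hA⟩ := hφ.contDiff.continuous.bounded_above_of_compact_support hφ.hasCompactSupport
  have hA0 : 0 ≤ A := (norm_nonneg _).trans (hA 0)
  have hw := (hΦ.memLp_testFunction_mul_deriv hφ (memLp_indicator hΩ z.1).1).restrict U
  refine tendsto_of_tendsto_of_dist
    (SpectralFractional.tendsto_integral_differenceQuotient hΩ hfin hz hUo hUΩ hU hw) ?_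
  have herror : Tendsto (fun h : ℝ => h * (A * K * (‖z.2‖ * ‖e‖) ^ 2)) (𝓝[>] 0) (𝓝 0) := by
    have hid : Tendsto (fun h : ℝ => h) (𝓝[>] 0) (𝓝 0) := nhdsWithin_le_nhds
    simpa using hid.mul_const (A * K * (‖z.2‖ * ‖e‖) ^ 2)
  refine squeeze_zero' (Eventually.of_forall fun _ => dist_nonneg) ?_ herror
  filter_upwards [hU, self_mem_nhdsWithin] with h hh hpos
  have hh0 : 0 < h := hpos
  have hv := hΦ.integrable_comp_indicator hΩ hfin z.1
  have hD := memLp_translate_sub (U := U) hΩ z.1 (h • e)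
  have hincr : Integrable (fun x =>
      (Φ (Ω.indicator z.1 (x + h • e)) - Φ (Ω.indicator z.1 x)) * φ x) (volume.restrict U) :=
    ((hv.comp_add_right (h • e)).sub hv).restrict.mul_bdd
      hφ.contDiff.continuous.aestronglyMeasurable (Eventually.of_forall hA)
  rw [dist_comm, Real.dist_eq, ← hφ.setIntegral_eq, ← mul_sub, abs_mul, abs_inv, abs_of_pos hh0,
    inv_mul_le_iff₀ hh0]
  calc _ ≤ A * K * ‖hD.toLp _‖ ^ 2 :=
        abs_integral_sub_integral_le_of_taylor hA0 hA htaylor hD hincr (hw.integrable_mul hD)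
    _ ≤ A * K * (h * (‖z.2‖ * ‖e‖)) ^ 2 := by
        gcongr
        exact norm_translate_sub_smul_le hΩ hfin hz hUo hh0.le hh
    _ = h * (h * (A * K * (‖z.2‖ * ‖e‖) ^ 2)) := by ring

theorem comp_mem_sobolevH1 (hΩ : IsOpen Ω) (hfin : volume Ω ≠ ∞) {z : L2 Ω × L2Vec Ω}
    (hz : z ∈ sobolevH1 Ω) : hΦ.comp z ∈ sobolevH1 Ω := by
  rw [mem_sobolevH1_iff]
  intro φ hφ e
  have hm := hΩ.measurableSet
  obtain ⟨V, hVo, hφV, hVΩ, hV⟩ :=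
    exists_isOpen_forall_add_smul_mem hφ.hasCompactSupport.isCompact hΩ hφ.tsupport_subset e
  have hφV : IsTestFunction V φ := ⟨hφ.contDiff, hφ.hasCompactSupport, hφV⟩
  have hlim := tendsto_nhds_unique
    (hφV.tendsto_slope_integral (hΦ.integrable_comp_indicator hm hfin z.1) e)
    (hΦ.tendsto_integral_differenceQuotient hm hfin hz hVo hVΩ hV hφV)
  have hleft : ∫ x in Ω, (hΦ.comp z).1 x * fderiv ℝ φ x e
      = ∫ x, Φ (Ω.indicator z.1 x) * fderiv ℝ φ x e := by
    rw [← (hφ.fderiv_apply e).setIntegral_eq]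
    refine setIntegral_congr_ae hm ?_
    filter_upwards [(ae_restrict_iff' hm).1 (hΦ.memLp z.1).coeFn_toLp] with x hx hxΩ
    rw [comp, hx hxΩ, indicator_of_mem hxΩ]
  have hright : ∫ x in Ω, φ x * inner ℝ ((hΦ.comp z).2 x) e
      = ∫ x in V, φ x * deriv Φ (Ω.indicator z.1 x) * inner ℝ (z.2 x) e := by
    rw [← setIntegral_eq_of_subset_of_forall_sdiff_eq_zero hm hVΩ fun x hx => by
      rw [hφV.eq_zero hx.2, zero_mul, zero_mul]]
    refine setIntegral_congr_ae hm ?_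
    filter_upwards [(ae_restrict_iff' hm).1 (hΦ.memLp_deriv_smul z.1 z.2).coeFn_toLp]
      with x hx hxΩ
    rw [comp, hx hxΩ, indicator_of_mem hxΩ, real_inner_smul_left]
    ring
  rw [hleft, hright, ← hlim, neg_neg]

theorem norm_comp_fst_sub_le {B : ℝ≥0} (hB : ∀ x, ‖deriv Φ x‖₊ ≤ B) (y z : L2 Ω × L2Vec Ω) :
    ‖(hΦ.comp y).1 - (hΦ.comp z).1‖ ≤ B * ‖y.1 - z.1‖ := by
  refine Lp.norm_le_mul_norm_of_ae_le_mul ?_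
  filter_upwards [(hΦ.memLp y.1).coeFn_toLp, (hΦ.memLp z.1).coeFn_toLp,
    Lp.coeFn_sub (hΦ.comp y).1 (hΦ.comp z).1, Lp.coeFn_sub y.1 z.1] with x hy hz hcomp hsub
  rw [hcomp, hsub, Pi.sub_apply, Pi.sub_apply, comp, comp, hy, hz]
  simpa [Real.dist_eq] using
    (lipschitzWith_of_nnnorm_deriv_le hΦ.differentiable hB).dist_le_mul (y.1 x) (z.1 x)

theorem norm_comp_snd_sub_le {B : ℝ≥0} (hB : ∀ x, ‖deriv Φ x‖₊ ≤ B) (u : L2 Ω)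
    (G G' : L2Vec Ω) : ‖(hΦ.comp (u, G)).2 - (hΦ.comp (u, G')).2‖ ≤ B * ‖G - G'‖ := by
  refine Lp.norm_le_mul_norm_of_ae_le_mul ?_
  filter_upwards [(hΦ.memLp_deriv_smul u G).coeFn_toLp, (hΦ.memLp_deriv_smul u G').coeFn_toLp,
    Lp.coeFn_sub (hΦ.comp (u, G)).2 (hΦ.comp (u, G')).2, Lp.coeFn_sub G G']
    with x hG hG' hcomp hsub
  rw [hcomp, hsub, Pi.sub_apply, Pi.sub_apply, comp, comp, hG, hG', ← smul_sub, norm_smul]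
  exact mul_le_mul_of_nonneg_right (hB _) (norm_nonneg _)

theorem norm_comp_snd_sub_sq (u v : L2 Ω) (G : L2Vec Ω) :
    ‖(hΦ.comp (u, G)).2 - (hΦ.comp (v, G)).2‖ ^ 2
      = ∫ x in Ω, ‖(deriv Φ (u x) - deriv Φ (v x)) • G x‖ ^ 2 := by
  simp only [comp, ← MemLp.toLp_sub, norm_toLp_sq_eq_integral_norm_sq, sub_smul, Pi.sub_apply]

theorem tendsto_comp_snd_of_ae {u : ℕ → L2 Ω} {v : L2 Ω} (G : L2Vec Ω)
    (huv : ∀ᵐ x ∂volume.restrict Ω, Tendsto (fun n => u n x) atTop (𝓝 (v x))) :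
    Tendsto (fun n => (hΦ.comp (u n, G)).2) atTop (𝓝 (hΦ.comp (v, G)).2) := by
  obtain ⟨B, hB⟩ := hΦ.exists_nnnorm_deriv_le
  have hsq : Tendsto (fun n => ‖(hΦ.comp (u n, G)).2 - (hΦ.comp (v, G)).2‖ ^ 2) atTop (𝓝 0) := by
    simp only [hΦ.norm_comp_snd_sub_sq]
    rw [show (0 : ℝ) = ∫ _ in Ω, (0 : ℝ) by simp]
    refine tendsto_integral_of_dominated_convergence (fun x => (2 * B * ‖G x‖) ^ 2)
      (fun n => ?_) ((Lp.memLp G).norm.const_mul (2 * B : ℝ)).integrable_sq (fun n => ?_) ?_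
    · simp only [sub_smul]
      exact ((hΦ.memLp_deriv_smul (u n) G).sub (hΦ.memLp_deriv_smul v G)).1.norm.pow 2
    · refine Eventually.of_forall fun x => ?_
      have hdiff : ‖deriv Φ (u n x) - deriv Φ (v x)‖ ≤ 2 * B := by
        have hu : ‖deriv Φ (u n x)‖ ≤ B := hB _
        have hv : ‖deriv Φ (v x)‖ ≤ B := hB _
        linarith [norm_sub_le (deriv Φ (u n x)) (deriv Φ (v x))]
      rw [norm_pow, norm_norm, norm_smul]
      gcongr
    · filter_upwards [huv] with x hx
      have hcont := (((((hΦ.continuous_deriv.tendsto _).comp hx).sub_const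
        (deriv Φ (v x))).smul_const (G x)).norm).pow 2
      simpa using hcont
  rw [tendsto_iff_norm_sub_tendsto_zero]
  simpa [Real.sqrt_sq (norm_nonneg _)] using hsq.sqrt

theorem continuous_comp : Continuous (hΦ.comp (Ω := Ω)) := by
  obtain ⟨B, hB⟩ := hΦ.exists_nnnorm_deriv_le
  refine continuous_iff_continuousAt.2 fun z => tendsto_of_subseq_tendsto fun Z hZ => ?_
  have hfst : Tendsto (fun n => (Z n).1) atTop (𝓝 z.1) := (continuous_fst.tendsto _).comp hZ
  have hsnd : Tendsto (fun n => (Z n).2) atTop (𝓝 z.2) := (continuous_snd.tendsto _).comp hZ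
  obtain ⟨ns, hns, hae⟩ := (tendstoInMeasure_of_tendsto_Lp hfst).exists_seq_tendsto_ae
  refine ⟨ns, Tendsto.prodMk_nhds ?_ ?_⟩
  · rw [tendsto_iff_norm_sub_tendsto_zero]
    refine squeeze_zero (fun _ => norm_nonneg _) (fun n => hΦ.norm_comp_fst_sub_le hB _ _) ?_
    simpa using (tendsto_iff_norm_sub_tendsto_zero.1
      (hfst.comp hns.tendsto_atTop)).const_mul (B : ℝ)
  · refine tendsto_of_tendsto_of_dist (hΦ.tendsto_comp_snd_of_ae z.2 hae) ?_
    refine squeeze_zero (fun _ => dist_nonneg)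
      (fun n => (dist_comm _ _).trans_le ((dist_eq_norm _ _).trans_le
        (hΦ.norm_comp_snd_sub_le hB _ _ _))) ?_
    simpa using (tendsto_iff_norm_sub_tendsto_zero.1
      (hsnd.comp hns.tendsto_atTop)).const_mul (B : ℝ)

theorem comp_toSobolev {φ : Space N → ℝ} (hφ : IsTestFunction Ω φ) :
    hΦ.comp hφ.toSobolev = (hφ.comp hΦ.contDiff hΦ.map_zero).toSobolev := by
  have hφΦ := hφ.comp hΦ.contDiff hΦ.map_zero
  refine Prod.ext ((MemLp.toLp_eq_toLp_iff (hΦ.memLp _) hφΦ.memLp).2 ?_)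
    ((MemLp.toLp_eq_toLp_iff (hΦ.memLp_deriv_smul _ _) hφΦ.memLp_gradient).2 ?_)
  · filter_upwards [hφ.memLp.coeFn_toLp] with x hx
    rw [IsTestFunction.toSobolev, hx]
  · filter_upwards [hφ.memLp.coeFn_toLp, hφ.memLp_gradient.coeFn_toLp] with x hx hx'
    rw [IsTestFunction.toSobolev, hx, hx']
    refine (HasGradientAt.gradient ?_).symm
    rw [hasGradientAt_iff_hasFDerivAt, map_smul, toDual_gradient]
    exact (hΦ.differentiable (φ x)).hasDerivAt.comp_hasFDerivAt x
      (hφ.differentiable x).hasFDerivAt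

end IsSmoothCutoff

theorem IsTestFunction.toSobolev_zero : (IsTestFunction.zero (Ω := Ω)).toSobolev = 0 := by
  refine Prod.ext (MemLp.toLp_zero IsTestFunction.zero.memLp) (Lp.eq_zero_iff_ae_eq_zero.2 ?_)
  filter_upwards [IsTestFunction.zero.memLp_gradient.coeFn_toLp] with x hx
  rw [toSobolev, hx, gradient_fun_const, Pi.zero_apply]

theorem IsTestFunction.toSobolev_add {φ ψ : Space N → ℝ} (hφ : IsTestFunction Ω φ)
    (hψ : IsTestFunction Ω ψ) : (hφ.add hψ).toSobolev = hφ.toSobolev + hψ.toSobolev := by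
  refine Prod.ext (MemLp.toLp_add hφ.memLp hψ.memLp) ?_
  simp only [toSobolev, Prod.snd_add]
  rw [← MemLp.toLp_add, MemLp.toLp_eq_toLp_iff]
  refine Eventually.of_forall fun x => HasGradientAt.gradient ?_
  rw [hasGradientAt_iff_hasFDerivAt, Pi.add_apply, map_add, toDual_gradient, toDual_gradient]
  exact (hφ.differentiable x).hasFDerivAt.add (hψ.differentiable x).hasFDerivAt

theorem IsTestFunction.toSobolev_smul {φ : Space N → ℝ} (hφ : IsTestFunction Ω φ) (c : ℝ) :
    (hφ.smul c).toSobolev = c • hφ.toSobolev := by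
  refine Prod.ext (MemLp.toLp_const_smul c hφ.memLp) ?_
  simp only [toSobolev, Prod.smul_snd]
  rw [← MemLp.toLp_const_smul, MemLp.toLp_eq_toLp_iff]
  refine Eventually.of_forall fun x => HasGradientAt.gradient ?_
  rw [hasGradientAt_iff_hasFDerivAt, Pi.smul_apply, map_smul, toDual_gradient]
  exact (hφ.differentiable x).hasFDerivAt.const_mul c

theorem sobolevH10_subset_closure :
    (sobolevH10 Ω : Set (L2 Ω × L2Vec Ω)) ⊆
      closure {z | ∃ φ : Space N → ℝ, ∃ hφ : IsTestFunction Ω φ, z = hφ.toSobolev} := by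
  refine closure_mono fun z hz => ?_
  induction hz using Submodule.span_induction with
  | mem _ hz => exact hz
  | zero => exact ⟨_, IsTestFunction.zero, IsTestFunction.toSobolev_zero.symm⟩
  | add y z _ _ hy hz =>
    obtain ⟨φ, hφ, rfl⟩ := hy
    obtain ⟨ψ, hψ, rfl⟩ := hz
    exact ⟨_, hφ.add hψ, (hφ.toSobolev_add hψ).symm⟩
  | smul c z _ hz =>
    obtain ⟨φ, hφ, rfl⟩ := hz
    exact ⟨_, hφ.smul c, (hφ.toSobolev_smul c).symm⟩

theorem IsSmoothCutoff.comp_mem_formDomain {Φ : ℝ → ℝ} (hΦ : IsSmoothCutoff Φ) (hΩ : IsOpen Ω)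
    (hfin : volume Ω ≠ ∞) (bc : BoundaryCondition) {z : L2 Ω × L2Vec Ω}
    (hz : z ∈ formDomain Ω bc) : hΦ.comp z ∈ formDomain Ω bc := by
  cases bc with
  | neumann => exact hΦ.comp_mem_sobolevH1 hΩ hfin hz
  | dirichlet =>
    refine (isClosed_formDomain .dirichlet).closure_subset
      (map_mem_closure hΦ.continuous_comp (sobolevH10_subset_closure hz) ?_)
    rintro _ ⟨φ, hφ, rfl⟩
    rw [hΦ.comp_toSobolev hφ]
    exact (hφ.comp hΦ.contDiff hΦ.map_zero).toSobolev_mem_formDomain .dirichlet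

end ChainRule

section Average

variable {D : Set (Space N)} {f : Space N → ℝ}

/-- The mean of `f` over `x + D`, the smoothing operator that yields the compact approximations of
the embedding of the form domain into `L^2`. -/
def shiftAverage (D : Set (Space N)) (f : Space N → ℝ) (x : Space N) : ℝ :=
  (volume.real D)⁻¹ * ∫ z in D, f (x + z)

theorem sq_integral_le {X : Type*} [MeasurableSpace X] {μ : Measure X} [IsFiniteMeasure μ]
    {f : X → ℝ} (hf : MemLp f 2 μ) : (∫ x, f x ∂μ) ^ 2 ≤ μ.real univ * ∫ x, f x ^ 2 ∂μ := by
  have hcauchy := pow_le_pow_left₀ (abs_nonneg _) (abs_integral_mul_le hf (memLp_const (1 : ℝ))) 2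
  rw [mul_pow, norm_toLp_sq, norm_toLp_sq, sq_abs] at hcauchy
  simpa [mul_comm] using hcauchy

theorem measurable_shiftAverage (hf : Measurable f) : Measurable (shiftAverage D f) := by
  have : StronglyMeasurable (fun p : Space N × Space N => f (p.1 + p.2)) :=
    (hf.comp (measurable_fst.add measurable_snd)).stronglyMeasurable
  exact (this.integral_prod_right (ν := volume.restrict D)).measurable.const_mul _

theorem memLp_comp_add {p : ℝ≥0∞} (hf : MemLp f p volume) (x : Space N) :
    MemLp (fun z => f (x + z)) p volume :=
  hf.comp_measurePreserving (measurePreserving_add_left volume x)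

theorem setIntegral_abs_comp_add_right_le (hf : Integrable f volume) (z : Space N) :
    ∫ x in U, |f (x + z)| ≤ ∫ y, |f y| :=
  (setIntegral_le_integral (hf.comp_add_right z).abs
    (Eventually.of_forall fun _ => abs_nonneg _)).trans_eq
    (integral_add_right_eq_self (fun y => |f y|) z)

theorem abs_shiftAverage_le (x : Space N) :
    |shiftAverage D f x| ≤ (volume.real D)⁻¹ * ∫ z in D, |f (x + z)| := by
  rw [shiftAverage, abs_mul, abs_of_nonneg (by positivity : 0 ≤ (volume.real D)⁻¹)]
  exact mul_le_mul_of_nonneg_left abs_integral_le_integral_abs (by positivity)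

theorem abs_shiftAverage_le_integral (hf : Integrable f volume) (x : Space N) :
    |shiftAverage D f x| ≤ (volume.real D)⁻¹ * ∫ y, |f y| := by
  refine (abs_shiftAverage_le x).trans (mul_le_mul_of_nonneg_left ?_ (by positivity))
  simpa only [add_comm x] using setIntegral_abs_comp_add_right_le hf x

theorem integrable_abs_comp_add (hfm : Measurable f) (hf : Integrable f volume)
    (hDf : volume D ≠ ∞) : Integrable (fun p : Space N × Space N => |f (p.1 + p.2)|)
      ((volume.restrict U).prod (volume.restrict D)) := by
  have : IsFiniteMeasure (volume.restrict D) := ⟨by simpa using hDf.lt_top⟩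
  have hm : Measurable fun p : Space N × Space N => |f (p.1 + p.2)| :=
    (hfm.comp (measurable_fst.add measurable_snd)).abs
  refine (integrable_prod_iff' hm.aestronglyMeasurable).2
    ⟨Eventually.of_forall fun z => (hf.comp_add_right z).abs.restrict, ?_⟩
  refine Integrable.of_bound (C := ∫ y, |f y|)
    hm.norm.stronglyMeasurable.integral_prod_left'.aestronglyMeasurable
    (Eventually.of_forall fun z => ?_)
  rw [Real.norm_of_nonneg (integral_nonneg fun _ => norm_nonneg _)]
  simpa only [Real.norm_eq_abs, abs_abs] using setIntegral_abs_comp_add_right_le hf z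

theorem integral_integral_abs_comp_add_le (hfm : Measurable f) (hf : Integrable f volume)
    (hDf : volume D ≠ ∞) :
    ∫ x in U, ∫ z in D, |f (x + z)| ≤ volume.real D * ∫ y, |f y| := by
  have : IsFiniteMeasure (volume.restrict D) := ⟨by simpa using hDf.lt_top⟩
  rw [integral_integral_swap (integrable_abs_comp_add hfm hf hDf)]
  calc ∫ z in D, ∫ x in U, |f (x + z)| ≤ ∫ z in D, ∫ y, |f y| :=
        integral_mono_of_nonneg (Eventually.of_forall fun z => integral_nonneg fun _ =>
          abs_nonneg _) (integrable_const _)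
          (Eventually.of_forall (setIntegral_abs_comp_add_right_le hf))
    _ = volume.real D * ∫ y, |f y| := by simp

theorem integral_sq_shiftAverage_le (hfm : Measurable f) (hf : Integrable f volume)
    (hDf : volume D ≠ ∞) :
    ∫ x in U, shiftAverage D f x ^ 2 ≤ (volume.real D)⁻¹ * (∫ y, |f y|) ^ 2 := by
  rcases eq_or_ne (volume.real D) 0 with hD0 | hD0
  · simp [shiftAverage, hD0]
  have hnonneg : 0 ≤ ∫ y, |f y| := integral_nonneg fun _ => abs_nonneg _
  calc ∫ x in U, shiftAverage D f x ^ 2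
      ≤ ∫ x in U, ((volume.real D)⁻¹ * ∫ y, |f y|) *
          ((volume.real D)⁻¹ * ∫ z in D, |f (x + z)|) := by
        refine integral_mono_of_nonneg (Eventually.of_forall fun _ => sq_nonneg _)
          (((integrable_abs_comp_add hfm hf hDf).integral_prod_left.const_mul _).const_mul _)
          (Eventually.of_forall fun x => ?_)
        simp only
        rw [← sq_abs, sq]
        exact mul_le_mul (abs_shiftAverage_le_integral hf x) (abs_shiftAverage_le x)
          (abs_nonneg _) (by positivity)
    _ = ((volume.real D)⁻¹ * ∫ y, |f y|) * ((volume.real D)⁻¹ *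
          ∫ x in U, ∫ z in D, |f (x + z)|) := by
        rw [integral_const_mul, integral_const_mul]
    _ ≤ ((volume.real D)⁻¹ * ∫ y, |f y|) * ((volume.real D)⁻¹ *
          (volume.real D * ∫ y, |f y|)) := by
        gcongr
        exact integral_integral_abs_comp_add_le hfm hf hDf
    _ = (volume.real D)⁻¹ * (∫ y, |f y|) ^ 2 := by
        field_simp

theorem sq_shiftAverage_sub_le (hf : MemLp f 2 volume) (hD0 : volume.real D ≠ 0)
    (hDf : volume D ≠ ∞) (x : Space N) :
    (shiftAverage D f x - f x) ^ 2 ≤ (volume.real D)⁻¹ * ∫ z in D, (f (x + z) - f x) ^ 2 := by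
  have : IsFiniteMeasure (volume.restrict D) := ⟨by simpa using hDf.lt_top⟩
  have hshift : MemLp (fun z => f (x + z)) 2 (volume.restrict D) :=
    (memLp_comp_add hf x).restrict D
  have hmean : shiftAverage D f x - f x = (volume.real D)⁻¹ * ∫ z in D, (f (x + z) - f x) := by
    rw [integral_sub (hshift.integrable (by norm_num)) (integrable_const _), shiftAverage, mul_sub]
    simp [hD0]
  rw [hmean, mul_pow, sq (volume.real D)⁻¹, mul_assoc]
  refine mul_le_mul_of_nonneg_left ?_ (by positivity)
  rw [inv_mul_le_iff₀ (by positivity)]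
  simpa using sq_integral_le (hshift.sub (memLp_const (f x)))

variable {B : ℝ}

theorem integrable_sq_comp_add_sub (hfm : Measurable f) (hf : MemLp f 2 volume)
    (hD : MeasurableSet D) (hDf : volume D ≠ ∞)
    (hB : ∀ z ∈ D, ∫ x in U, (f (x + z) - f x) ^ 2 ≤ B) :
    Integrable (fun p : Space N × Space N => (f (p.1 + p.2) - f p.1) ^ 2)
      ((volume.restrict U).prod (volume.restrict D)) := by
  have : IsFiniteMeasure (volume.restrict D) := ⟨by simpa using hDf.lt_top⟩
  have hm : Measurable (fun p : Space N × Space N => (f (p.1 + p.2) - f p.1) ^ 2) :=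
    ((hfm.comp (measurable_fst.add measurable_snd)).sub (hfm.comp measurable_fst)).pow_const 2
  refine (integrable_prod_iff' hm.aestronglyMeasurable).2 ⟨Eventually.of_forall fun z =>
    (((hf.comp_measurePreserving (measurePreserving_add_right volume z)).sub hf).restrict
      U).integrable_sq, ?_⟩
  refine Integrable.of_bound (C := B)
    hm.norm.stronglyMeasurable.integral_prod_left'.aestronglyMeasurable
    ((ae_restrict_iff' hD).2 (Eventually.of_forall fun z hzD => ?_))
  rw [Real.norm_of_nonneg (integral_nonneg fun _ => norm_nonneg _)]
  simpa [Real.norm_of_nonneg (sq_nonneg _)] using hB z hzD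

theorem integrableOn_sq_shiftAverage_sub (hfm : Measurable f) (hf : MemLp f 2 volume)
    (hD : MeasurableSet D) (hD0 : volume.real D ≠ 0) (hDf : volume D ≠ ∞)
    (hB : ∀ z ∈ D, ∫ x in U, (f (x + z) - f x) ^ 2 ≤ B) :
    IntegrableOn (fun x => (shiftAverage D f x - f x) ^ 2) U := by
  refine ((integrable_sq_comp_add_sub hfm hf hD hDf hB).integral_prod_left.const_mul
    (volume.real D)⁻¹).mono' ?_ (Eventually.of_forall fun x => ?_)
  · exact (((measurable_shiftAverage hfm).sub hfm).pow_const 2).aestronglyMeasurable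
  · rw [Real.norm_of_nonneg (sq_nonneg _)]
    exact sq_shiftAverage_sub_le hf hD0 hDf x

theorem integral_sq_shiftAverage_sub_le (hfm : Measurable f) (hf : MemLp f 2 volume)
    (hD : MeasurableSet D) (hD0 : volume.real D ≠ 0) (hDf : volume D ≠ ∞)
    (hB : ∀ z ∈ D, ∫ x in U, (f (x + z) - f x) ^ 2 ≤ B) :
    ∫ x in U, (shiftAverage D f x - f x) ^ 2 ≤ B := by
  have : IsFiniteMeasure (volume.restrict D) := ⟨by simpa using hDf.lt_top⟩
  have hint := integrable_sq_comp_add_sub hfm hf hD hDf hB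
  calc ∫ x in U, (shiftAverage D f x - f x) ^ 2
      ≤ ∫ x in U, (volume.real D)⁻¹ * ∫ z in D, (f (x + z) - f x) ^ 2 :=
        integral_mono_of_nonneg (Eventually.of_forall fun _ => sq_nonneg _)
          (hint.integral_prod_left.const_mul _)
          (Eventually.of_forall (sq_shiftAverage_sub_le hf hD0 hDf))
    _ = (volume.real D)⁻¹ * ∫ z in D, ∫ x in U, (f (x + z) - f x) ^ 2 := by
        rw [integral_const_mul, integral_integral_swap hint]
    _ ≤ (volume.real D)⁻¹ * ∫ _ in D, B := by
        refine mul_le_mul_of_nonneg_left ?_ (by positivity)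
        exact setIntegral_mono_on hint.integral_prod_right (integrable_const _) hD hB
    _ = B := by simp [hD0]

end Average

section ConeCover

theorem exists_ball_forall_add_smul_mem {E : Type*} [NormedAddCommGroup E] [NormedSpace ℝ E]
    {O : Set E} (hO : IsOpen O) {x₀ : E} (hx₀ : x₀ ∈ O) : ∃ r : ℝ, 0 < r ∧
      ∀ x ∈ Metric.ball x₀ r, ∀ z ∈ Metric.ball (0 : E) r, ∀ τ ∈ Icc (0 : ℝ) 1,
        x + τ • z ∈ O := by
  obtain ⟨ε, hε, hball⟩ := Metric.isOpen_iff.1 hO x₀ hx₀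
  refine ⟨ε / 2, by positivity, fun x hx z hz τ hτ => hball ?_⟩
  rw [mem_ball_iff_norm] at hx ⊢
  rw [mem_ball_zero_iff] at hz
  have hτz : ‖τ • z‖ ≤ ‖z‖ := by
    rw [norm_smul, Real.norm_of_nonneg hτ.1]
    exact mul_le_of_le_one_left (norm_nonneg _) hτ.2
  calc ‖x + τ • z - x₀‖ = ‖(x - x₀) + τ • z‖ := by congr 1; abel
    _ ≤ ‖x - x₀‖ + ‖τ • z‖ := norm_add_le _ _
    _ < ε := by linarith

/-- The strict epigraph of a `K`-Lipschitz function is stable under translation by every vector of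
the open cone about `ν` spanned by the ball `B(a ν, b)` with `2 K b + b ≤ a`. -/
theorem lt_inner_add_smul_of_lt_inner {E : Type*} [NormedAddCommGroup E] [InnerProductSpace ℝ E]
    {ν : E} (hν : ‖ν‖ = 1) {K : ℝ≥0} {g : E → ℝ} (hg : LipschitzWith K g) {a b : ℝ}
    (hab : 2 * K * b + b ≤ a) {x z : E} (hx : g (x - inner ℝ ν x • ν) < inner ℝ ν x)
    (hz : z ∈ Metric.ball (a • ν) b) {τ : ℝ} (hτ : 0 ≤ τ) :
    g (x + τ • z - inner ℝ ν (x + τ • z) • ν) < inner ℝ ν (x + τ • z) := by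
  obtain ⟨ζ, rfl⟩ : ∃ ζ, z = a • ν + ζ := ⟨z - a • ν, by abel⟩
  have hζ : ‖ζ‖ < b := by simpa [dist_eq_norm] using hz
  have hνζ : |inner ℝ ν ζ| ≤ ‖ζ‖ := by simpa [hν] using abs_real_inner_le_norm ν ζ
  have hνν : inner ℝ ν ν = (1 : ℝ) := by rw [real_inner_self_eq_norm_sq, hν]; norm_num
  have hheight : inner ℝ ν (x + τ • (a • ν + ζ)) = inner ℝ ν x + τ * (a + inner ℝ ν ζ) := by
    rw [inner_add_right, real_inner_smul_right, inner_add_right, real_inner_smul_right, hνν,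
      mul_one]
  have hproj : (x + τ • (a • ν + ζ)) - inner ℝ ν (x + τ • (a • ν + ζ)) • ν
      = (x - inner ℝ ν x • ν) + τ • (ζ - inner ℝ ν ζ • ν) := by
    rw [hheight]
    module
  have hprojζ : ‖ζ - inner ℝ ν ζ • ν‖ ≤ 2 * b := by
    refine (norm_sub_le _ _).trans ?_
    rw [norm_smul, hν, mul_one, Real.norm_eq_abs]
    linarith
  have hlip : g ((x - inner ℝ ν x • ν) + τ • (ζ - inner ℝ ν ζ • ν)) - g (x - inner ℝ ν x • ν)
      ≤ τ * (2 * K * b) :=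
    calc _ ≤ K * ‖τ • (ζ - inner ℝ ν ζ • ν)‖ := by
          simpa [dist_eq_norm] using (le_abs_self _).trans (hg.dist_le_mul
            ((x - inner ℝ ν x • ν) + τ • (ζ - inner ℝ ν ζ • ν)) (x - inner ℝ ν x • ν))
      _ ≤ K * (τ * (2 * b)) := by
          rw [norm_smul, Real.norm_of_nonneg hτ]
          gcongr
      _ = τ * (2 * K * b) := by ring
  have hcone : τ * (2 * K * b) ≤ τ * (a + inner ℝ ν ζ) := by
    refine mul_le_mul_of_nonneg_left ?_ hτ
    linarith [neg_abs_le (inner ℝ ν ζ)]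
  rw [hproj, hheight]
  linarith

theorem IsBoundedRegularOpen.exists_local_cone_of_mem_frontier (hΩ : IsBoundedRegularOpen Ω)
    {x₀ : Space N} (hx₀ : x₀ ∈ frontier Ω) : ∃ r : ℝ, 0 < r ∧ ∃ (a : Space N) (b : ℝ), 0 < b ∧
      ∀ x ∈ Ω ∩ Metric.ball x₀ r, ∀ z ∈ Metric.ball a b, ∀ τ ∈ Icc (0 : ℝ) 1, x + τ • z ∈ Ω := by
  obtain ⟨ν, hν, r, hr, K, g, hg, hgr⟩ := hΩ.boundary x₀ hx₀
  let a : ℝ := r / 4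
  let b : ℝ := a / (2 * K + 2)
  have ha : 0 < a := by positivity
  have hb : 0 < b := by positivity
  have hab : 2 * K * b + 2 * b = a := by simp only [b]; field_simp
  have hba : b ≤ a := by nlinarith [K.2]
  refine ⟨r / 2, by positivity, a • ν, b, hb, fun x hx z hz τ hτ => ?_⟩
  have hxr : ‖x - x₀‖ < r / 2 := mem_ball_iff_norm.1 hx.2
  have hx' := (hgr x (Metric.ball_subset_ball (by linarith) hx.2)).1 hx.1
  have hz' : ‖z‖ ≤ 2 * a := by
    have hzν : ‖z - a • ν‖ < b := mem_ball_iff_norm.1 hz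
    have hν' : ‖a • ν‖ = a := by rw [norm_smul, hν, mul_one, Real.norm_of_nonneg ha.le]
    linarith [norm_le_norm_add_norm_sub (a • ν) z, norm_sub_rev (a • ν) z]
  have hy : x + τ • z ∈ Metric.ball x₀ r := by
    rw [mem_ball_iff_norm]
    calc ‖x + τ • z - x₀‖ = ‖(x - x₀) + τ • z‖ := by congr 1; abel
      _ ≤ ‖x - x₀‖ + ‖τ • z‖ := norm_add_le _ _
      _ ≤ ‖x - x₀‖ + ‖z‖ := by
        gcongr
        rw [norm_smul, Real.norm_of_nonneg hτ.1]
        exact mul_le_of_le_one_left (norm_nonneg _) hτ.2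
      _ < r := by linarith [show a = r / 4 from rfl]
  exact (hgr _ hy).2 (lt_inner_add_smul_of_lt_inner hν hg (by linarith) hx' hz hτ.1)

theorem IsBoundedRegularOpen.exists_local_cone (hΩ : IsBoundedRegularOpen Ω) {x₀ : Space N}
    (hx₀ : x₀ ∈ closure Ω) : ∃ r : ℝ, 0 < r ∧ ∃ (a : Space N) (b : ℝ), 0 < b ∧
      ∀ x ∈ Ω ∩ Metric.ball x₀ r, ∀ z ∈ Metric.ball a b, ∀ τ ∈ Icc (0 : ℝ) 1, x + τ • z ∈ Ω := by
  by_cases hx : x₀ ∈ Ω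
  · obtain ⟨r, hr, h⟩ := exists_ball_forall_add_smul_mem hΩ.isOpen hx
    exact ⟨r, hr, 0, r, hr, fun x hx => h x hx.2⟩
  · exact hΩ.exists_local_cone_of_mem_frontier
      (by rw [frontier, hΩ.isOpen.interior_eq]; exact ⟨hx₀, hx⟩)

/-- A finite cover of `Ω` by open subsets `U i` of `Ω`, each of which carries a cone of directions,
spanned by the ball `B(a i, b i)`, along which its points can be moved inside `Ω`. This uniform
interior cone condition is all that the Sobolev estimates need to know about the boundary. -/
structure IsConeCover {ι : Type*} (Ω : Set (Space N)) (F : Finset ι) (U : ι → Set (Space N))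
    (a : ι → Space N) (b : ι → ℝ) : Prop where
  isOpen : ∀ i, IsOpen (U i)
  subset : ∀ i, U i ⊆ Ω
  exists_mem : ∀ x ∈ Ω, ∃ i ∈ F, x ∈ U i
  pos : ∀ i ∈ F, 0 < b i
  add_smul_mem : ∀ i ∈ F, ∀ x ∈ U i, ∀ z ∈ Metric.ball (a i) (b i), ∀ τ ∈ Icc (0 : ℝ) 1,
    x + τ • z ∈ Ω

theorem IsBoundedRegularOpen.exists_isConeCover (hΩ : IsBoundedRegularOpen Ω) :
    ∃ (F : Finset (Space N)) (U : Space N → Set (Space N)) (a : Space N → Space N)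
      (b : Space N → ℝ), IsConeCover Ω F U a b := by
  have hloc : ∀ x₀ : Space N, ∃ (r : ℝ) (a : Space N) (b : ℝ), x₀ ∈ closure Ω → 0 < r ∧ 0 < b ∧
      ∀ x ∈ Ω ∩ Metric.ball x₀ r, ∀ z ∈ Metric.ball a b, ∀ τ ∈ Icc (0 : ℝ) 1,
        x + τ • z ∈ Ω := fun x₀ => by
    by_cases hx : x₀ ∈ closure Ω
    · obtain ⟨r, hr, a, b, hb, h⟩ := hΩ.exists_local_cone hx
      exact ⟨r, a, b, fun _ => ⟨hr, hb, h⟩⟩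
    · exact ⟨0, 0, 0, fun h => absurd h hx⟩
  choose r a b h using hloc
  obtain ⟨F, hF, hcov⟩ := hΩ.isBounded.isCompact_closure.elim_nhds_subcover
    (fun x => Metric.ball x (r x)) (fun x hx => Metric.ball_mem_nhds x (h x hx).1)
  refine ⟨F, fun i => Ω ∩ Metric.ball i (r i), a, b, fun i => hΩ.isOpen.inter Metric.isOpen_ball,
    fun i => inter_subset_left, fun x hx => ?_, fun i hi => (h i (hF i hi)).2.1,
    fun i hi => (h i (hF i hi)).2.2⟩
  obtain ⟨i, hi, hxi⟩ := mem_iUnion₂.1 (hcov (subset_closure hx))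
  exact ⟨i, hi, hx, hxi⟩

end ConeCover

section HilbertSchmidt

variable {H F ι : Type*} [NormedAddCommGroup H] [InnerProductSpace ℝ H]
  [NormedAddCommGroup F] [NormedSpace ℝ F]

theorem norm_sum_inner_smul_le {b : ι → H} (hb : Orthonormal ℝ b) (c : ι → F) (s : Finset ι)
    (v : H) : ‖∑ i ∈ s, inner ℝ (b i) v • c i‖ ≤ √(∑ i ∈ s, ‖c i‖ ^ 2) * ‖v‖ := by
  have hbessel : ∑ i ∈ s, |inner ℝ (b i) v| ^ 2 ≤ ‖v‖ ^ 2 := by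
    simpa using hb.sum_inner_products_le (x := v) (s := s)
  calc ‖∑ i ∈ s, inner ℝ (b i) v • c i‖ ≤ ∑ i ∈ s, ‖c i‖ * |inner ℝ (b i) v| := by
        refine (norm_sum_le _ _).trans_eq (Finset.sum_congr rfl fun i _ => ?_)
        rw [norm_smul, Real.norm_eq_abs, mul_comm]
    _ ≤ √(∑ i ∈ s, ‖c i‖ ^ 2) * √(∑ i ∈ s, |inner ℝ (b i) v| ^ 2) :=
        Real.sum_mul_le_sqrt_mul_sqrt _ _ _
    _ ≤ √(∑ i ∈ s, ‖c i‖ ^ 2) * ‖v‖ := by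
        gcongr
        exact Real.sqrt_le_left (norm_nonneg v) |>.2 hbessel

theorem isCompactOperator_sum_smulRight (φ : ι → H →L[ℝ] ℝ) (c : ι → F) (s : Finset ι) :
    IsCompactOperator (∑ i ∈ s, (φ i).smulRight (c i) : H →L[ℝ] F) := by
  classical
  induction s using Finset.induction_on with
  | empty => simpa using isCompactOperator_zero
  | insert i s hi ih =>
    have hline : IsCompactOperator ((1 : ℝ →L[ℝ] ℝ).smulRight (c i)) :=
      isCompactOperator_of_locallyCompactSpace_rng _
    rw [Finset.sum_insert hi]
    exact (hline.comp_clm (φ i)).add ih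

theorem norm_sub_sum_smulRight_le (b : HilbertBasis ι ℝ H) (T : H →L[ℝ] F) {s : Finset ι} {ε : ℝ}
    (hε : 0 ≤ ε) (hs : ∀ s', Disjoint s' s → ∑ i ∈ s', ‖T (b i)‖ ^ 2 ≤ ε ^ 2) :
    ‖∑ i ∈ s, (innerSL ℝ (b i)).smulRight (T (b i)) - T‖ ≤ ε := by
  classical
  refine ContinuousLinearMap.opNorm_le_bound _ hε fun v => ?_
  have hexpand : HasSum (fun i => inner ℝ (b i) v • T (b i)) (T v) := by
    simpa [b.repr_apply_apply] using (b.hasSum_repr v).mapL T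
  have hpartial : (∑ i ∈ s, (innerSL ℝ (b i)).smulRight (T (b i))) v
      = ∑ i ∈ s, inner ℝ (b i) v • T (b i) := by simp
  rw [sub_apply, hpartial]
  refine le_of_tendsto (tendsto_const_nhds.sub hexpand).norm ?_
  filter_upwards [eventually_ge_atTop s] with s' hs'
  rw [norm_sub_rev, ← Finset.sum_sdiff hs', add_sub_cancel_right]
  refine (norm_sum_inner_smul_le b.orthonormal _ _ v).trans ?_
  gcongr
  exact (Real.sqrt_le_left hε).2 (hs _ Finset.sdiff_disjoint)

theorem isCompactOperator_of_summable_norm_sq [CompleteSpace F] (b : HilbertBasis ι ℝ H)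
    (T : H →L[ℝ] F) (hT : Summable fun i => ‖T (b i)‖ ^ 2) : IsCompactOperator T := by
  refine isCompactOperator_of_tendsto (l := atTop) ?_ (Eventually.of_forall fun s =>
    isCompactOperator_sum_smulRight (fun i => innerSL ℝ (b i)) (fun i => T (b i)) s)
  rw [tendsto_iff_norm_sub_tendsto_zero, Metric.tendsto_nhds]
  intro ε hε
  obtain ⟨s₀, hs₀⟩ := summable_iff_vanishing_norm.1 hT ((ε / 2) ^ 2) (by positivity)
  filter_upwards [eventually_ge_atTop s₀] with s hs
  rw [dist_zero_right, norm_norm]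
  refine (norm_sub_sum_smulRight_le b T (by positivity) fun s' hs' => ?_).trans_lt
    (half_lt_self hε)
  exact ((le_abs_self _).trans_lt (hs₀ s' (Finset.disjoint_of_subset_right hs hs'))).le

end HilbertSchmidt

section KernelOperator

variable {X : Type*} [MeasurableSpace X] {μ : Measure X} [IsFiniteMeasure μ]
  {k : X → X → ℝ} (hk : Measurable (Function.uncurry k)) {M : ℝ} (hM : ∀ x y, |k x y| ≤ M)

include hk hM

theorem memLp_kernel (x : X) : MemLp (k x) 2 μ :=
  MemLp.of_bound (hk.comp measurable_prodMk_left).aestronglyMeasurable M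
    (Eventually.of_forall fun y => hM x y)

theorem norm_toLp_kernel_sq_le (x : X) :
    ‖(memLp_kernel (μ := μ) hk hM x).toLp (k x)‖ ^ 2 ≤ μ.real univ * M ^ 2 := by
  rw [norm_toLp_sq]
  calc ∫ y, k x y ^ 2 ∂μ ≤ ∫ _, M ^ 2 ∂μ :=
        integral_mono_of_nonneg (Eventually.of_forall fun _ => sq_nonneg _) (integrable_const _)
          (Eventually.of_forall fun y => sq_le_sq' (abs_le.1 (hM x y)).1 (abs_le.1 (hM x y)).2)
    _ = μ.real univ * M ^ 2 := by simp

theorem integral_kernel_mul_eq_inner (x : X) (u : Lp ℝ 2 μ) :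
    ∫ y, k x y * u y ∂μ = inner ℝ ((memLp_kernel hk hM x).toLp (k x)) u := by
  rw [← inner_toLp_toLp (memLp_kernel hk hM x) (Lp.memLp u), Lp.toLp_coeFn]

theorem abs_integral_kernel_mul_le (x : X) (u : Lp ℝ 2 μ) :
    |∫ y, k x y * u y ∂μ| ≤ √(μ.real univ * M ^ 2) * ‖u‖ := by
  rw [integral_kernel_mul_eq_inner hk hM]
  refine (abs_real_inner_le_norm _ _).trans ?_
  gcongr
  exact Real.le_sqrt_of_sq_le (norm_toLp_kernel_sq_le hk hM x)

theorem memLp_integral_kernel_mul (u : Lp ℝ 2 μ) : MemLp (fun x => ∫ y, k x y * u y ∂μ) 2 μ := by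
  have hmeas : StronglyMeasurable (fun p : X × X => k p.1 p.2 * u p.2) :=
    (hk.mul ((Lp.stronglyMeasurable u).measurable.comp measurable_snd)).stronglyMeasurable
  exact MemLp.of_bound (hmeas.integral_prod_right (ν := μ)).aestronglyMeasurable _
    (Eventually.of_forall fun x => abs_integral_kernel_mul_le hk hM x u)

theorem norm_toLp_integral_kernel_mul_le (u : Lp ℝ 2 μ) :
    ‖(memLp_integral_kernel_mul hk hM u).toLp _‖
      ≤ √(μ.real univ) * √(μ.real univ * M ^ 2) * ‖u‖ := by
  refine abs_le_of_sq_le_sq' ?_ (by positivity) |>.2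
  rw [norm_toLp_sq, mul_assoc, mul_pow, Real.sq_sqrt measureReal_nonneg]
  calc ∫ x, (∫ y, k x y * u y ∂μ) ^ 2 ∂μ ≤ ∫ _, (√(μ.real univ * M ^ 2) * ‖u‖) ^ 2 ∂μ :=
        integral_mono_of_nonneg (Eventually.of_forall fun _ => sq_nonneg _) (integrable_const _)
          (Eventually.of_forall fun x => sq_le_sq.2
            ((abs_integral_kernel_mul_le hk hM x u).trans (le_abs_self _)))
    _ = μ.real univ * (√(μ.real univ * M ^ 2) * ‖u‖) ^ 2 := by simp

theorem exists_kernelOperator :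
    ∃ K : Lp ℝ 2 μ →L[ℝ] Lp ℝ 2 μ, ∀ u, K u = (memLp_integral_kernel_mul hk hM u).toLp _ := by
  let L : Lp ℝ 2 μ →ₗ[ℝ] Lp ℝ 2 μ :=
    { toFun := fun u => (memLp_integral_kernel_mul hk hM u).toLp _
      map_add' := fun u v => by
        rw [← MemLp.toLp_add, MemLp.toLp_eq_toLp_iff]
        refine Eventually.of_forall fun x => ?_
        simp only [integral_kernel_mul_eq_inner hk hM, inner_add_right, Pi.add_apply]
      map_smul' := fun c u => by
        rw [RingHom.id_apply, ← MemLp.toLp_const_smul, MemLp.toLp_eq_toLp_iff]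
        refine Eventually.of_forall fun x => ?_
        simp only [integral_kernel_mul_eq_inner hk hM, inner_smul_right, Pi.smul_apply,
          smul_eq_mul] }
  exact ⟨L.mkContinuous _ (norm_toLp_integral_kernel_mul_le hk hM), fun _ => rfl⟩

theorem sum_norm_toLp_integral_kernel_mul_sq_le {ι : Type*} {b : ι → Lp ℝ 2 μ}
    (hb : Orthonormal ℝ b) (s : Finset ι) :
    ∑ i ∈ s, ‖(memLp_integral_kernel_mul hk hM (b i)).toLp _‖ ^ 2
      ≤ μ.real univ * (μ.real univ * M ^ 2) := by
  simp only [norm_toLp_sq]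
  rw [← integral_finsetSum _ fun i _ => (memLp_integral_kernel_mul hk hM (b i)).integrable_sq]
  calc ∫ x, ∑ i ∈ s, (∫ y, k x y * b i y ∂μ) ^ 2 ∂μ ≤ ∫ _, μ.real univ * M ^ 2 ∂μ := by
        refine integral_mono_of_nonneg (Eventually.of_forall fun _ =>
          Finset.sum_nonneg fun _ _ => sq_nonneg _) (integrable_const _)
          (Eventually.of_forall fun x => le_trans ?_ (norm_toLp_kernel_sq_le hk hM x))
        simpa [integral_kernel_mul_eq_inner hk hM, real_inner_comm] using
          hb.sum_inner_products_le (x := (memLp_kernel hk hM x).toLp (k x)) (s := s)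
    _ = μ.real univ * (μ.real univ * M ^ 2) := by simp

theorem exists_isCompactOperator_kernel :
    ∃ K : Lp ℝ 2 μ →L[ℝ] Lp ℝ 2 μ, IsCompactOperator K ∧
      ∀ u : Lp ℝ 2 μ, K u =ᵐ[μ] fun x => ∫ y, k x y * u y ∂μ := by
  obtain ⟨K, hK⟩ := exists_kernelOperator (μ := μ) hk hM
  obtain ⟨w, b, -⟩ := exists_hilbertBasis ℝ (Lp ℝ 2 μ)
  refine ⟨K, isCompactOperator_of_summable_norm_sq b K ?_, fun u => ?_⟩
  · simp only [hK]
    exact summable_of_sum_le (fun i => by positivity)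
      (sum_norm_toLp_integral_kernel_mul_sq_le hk hM b.orthonormal)
  · rw [hK]
    exact MemLp.coeFn_toLp _

end KernelOperator

section Nash

theorem real_volume_ball (c : Space N) {r : ℝ} (hr : 0 < r) :
    volume.real (Metric.ball c r) = r ^ N * volume.real (Metric.ball (0 : Space N) 1) := by
  rw [Measure.real, Measure.addHaar_ball_of_pos _ _ hr, ENNReal.toReal_mul,
    ENNReal.toReal_ofReal (by positivity), finrank_euclideanSpace_fin, Measure.real]

theorem real_volume_ball_pos (c : Space N) {r : ℝ} (hr : 0 < r) :
    0 < volume.real (Metric.ball c r) :=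
  ENNReal.toReal_pos (Metric.measure_ball_pos volume c hr).ne' measure_ball_lt_top.ne

theorem measurable_indicator (hΩ : MeasurableSet Ω) (u : L2 Ω) : Measurable (Ω.indicator u) :=
  (Lp.stronglyMeasurable u).measurable.indicator hΩ

theorem integral_abs_indicator (hΩ : MeasurableSet Ω) (f : Space N → ℝ) :
    ∫ y, |Ω.indicator f y| = ∫ x in Ω, |f x| := by
  rw [← integral_indicator hΩ]
  congr 1
  ext x
  by_cases hx : x ∈ Ω <;> simp [hx]

theorem integral_sq_le_add {X : Type*} [MeasurableSpace X] {μ : Measure X} {f g : X → ℝ}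
    (hf : MemLp f 2 μ) (hg : MemLp g 2 μ) :
    ∫ x, f x ^ 2 ∂μ ≤ 2 * (∫ x, (g x - f x) ^ 2 ∂μ) + 2 * ∫ x, g x ^ 2 ∂μ := by
  have hgf := (hg.sub hf).integrable_sq.const_mul 2
  have hg' := hg.integrable_sq.const_mul 2
  simp only [Pi.sub_apply] at hgf
  rw [← integral_const_mul, ← integral_const_mul, ← integral_add hgf hg']
  refine integral_mono hf.integrable_sq (hgf.add hg') fun x => ?_
  nlinarith [sq_nonneg (f x - 2 * g x)]

theorem setIntegral_sum_indicator {X ι : Type*} [MeasurableSpace X] {μ : Measure X} {S : Set X}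
    {F : Finset ι} {U : ι → Set X} {g : ι → X → ℝ} (hU : ∀ i ∈ F, MeasurableSet (U i))
    (hUS : ∀ i ∈ F, U i ⊆ S) (hg : ∀ i ∈ F, IntegrableOn (g i) (U i) μ) :
    ∫ x in S, ∑ i ∈ F, (U i).indicator (g i) x ∂μ = ∑ i ∈ F, ∫ x in U i, g i x ∂μ := by
  rw [integral_finsetSum _ fun i hi => ((integrable_indicator_iff (hU i hi)).2 (hg i hi)).restrict]
  refine Finset.sum_congr rfl fun i hi => ?_
  rw [integral_indicator (hU i hi), Measure.restrict_restrict (hU i hi),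
    inter_eq_left.2 (hUS i hi)]

theorem IsConeCover.setIntegral_le_sum {ι : Type*} {F : Finset ι} {V : ι → Set (Space N)}
    {a : ι → Space N} {b : ι → ℝ} (hV : IsConeCover Ω F V a b) (hΩ : MeasurableSet Ω)
    {f : Space N → ℝ} (hf : IntegrableOn f Ω) (hf0 : ∀ x, 0 ≤ f x) :
    ∫ x in Ω, f x ≤ ∑ i ∈ F, ∫ x in V i, f x := by
  have hm : ∀ i ∈ F, MeasurableSet (V i) := fun i _ => (hV.isOpen i).measurableSet
  have hint : ∀ i ∈ F, IntegrableOn f (V i) := fun i _ => hf.mono_set (hV.subset i)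
  rw [← setIntegral_sum_indicator hm (fun i _ => hV.subset i) hint]
  refine setIntegral_mono_on hf (integrable_finsetSum _ fun i hi =>
    ((integrable_indicator_iff (hm i hi)).2 (hint i hi)).restrict) hΩ fun x hx => ?_
  obtain ⟨i, hi, hxi⟩ := hV.exists_mem x hx
  calc f x = (V i).indicator f x := (indicator_of_mem hxi f).symm
    _ ≤ ∑ j ∈ F, (V j).indicator f x :=
        Finset.single_le_sum (f := fun j => (V j).indicator f x)
          (fun j _ => indicator_nonneg (fun x _ => hf0 x) x) hi

variable (hΩ : MeasurableSet Ω) (hfin : volume Ω ≠ ∞) {z : L2 Ω × L2Vec Ω}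
  (hz : z ∈ sobolevH1 Ω) (hUo : IsOpen U) {a : Space N} {b : ℝ} (hb : 0 < b)
  (hcone : ∀ x ∈ U, ∀ y ∈ Metric.ball a b, ∀ τ ∈ Icc (0 : ℝ) 1, x + τ • y ∈ Ω)
  {t : ℝ} (ht0 : 0 < t) (ht1 : t ≤ 1)

include hΩ hfin hz hUo hcone ht0 ht1

theorem setIntegral_sq_translate_sub_le {y : Space N} (hy : y ∈ Metric.ball (t • a) (t * b)) :
    ∫ x in U, (Ω.indicator z.1 (x + y) - Ω.indicator z.1 x) ^ 2
      ≤ (t * (‖a‖ + b) * ‖z.2‖) ^ 2 := by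
  rw [mem_ball_iff_norm] at hy
  have hty : t⁻¹ • y ∈ Metric.ball a b := by
    have : t⁻¹ • y - a = t⁻¹ • (y - t • a) := by
      rw [smul_sub, smul_smul, inv_mul_cancel₀ ht0.ne', one_smul]
    rwa [mem_ball_iff_norm, this, norm_smul, norm_inv, Real.norm_of_nonneg ht0.le,
      inv_mul_lt_iff₀ ht0]
  have hnorm : ‖y‖ ≤ t * (‖a‖ + b) := by
    have htri : ‖y‖ ≤ ‖y - t • a‖ + ‖t • a‖ := by simpa using norm_add_le (y - t • a) (t • a)
    rw [norm_smul, Real.norm_of_nonneg ht0.le] at htri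
    linarith
  have hU : ∀ x ∈ U, ∀ τ ∈ Icc (0 : ℝ) 1, x + τ • y ∈ Ω := fun x hx τ hτ => by
    have := hcone x hx _ hty (τ * t) ⟨mul_nonneg hτ.1 ht0.le, mul_le_one₀ hτ.2 ht0.le ht1⟩
    rwa [smul_smul, mul_assoc, mul_inv_cancel₀ ht0.ne', mul_one] at this
  rw [← norm_toLp_sq (memLp_translate_sub (U := U) hΩ z.1 y)]
  refine pow_le_pow_left₀ (norm_nonneg _)
    ((norm_translate_sub_le hΩ hfin hz hUo hU).trans ?_) 2
  rw [mul_comm]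
  gcongr

include hb

theorem integrableOn_sq_shiftAverage_ball_sub :
    IntegrableOn (fun x => (shiftAverage (Metric.ball (t • a) (t * b)) (Ω.indicator z.1) x
      - Ω.indicator z.1 x) ^ 2) U :=
  integrableOn_sq_shiftAverage_sub (measurable_indicator hΩ z.1) (memLp_indicator hΩ z.1)
    measurableSet_ball (real_volume_ball_pos _ (by positivity)).ne' measure_ball_lt_top.ne
    fun _ => setIntegral_sq_translate_sub_le hΩ hfin hz hUo hcone ht0 ht1

theorem setIntegral_sq_shiftAverage_ball_sub_le :
    ∫ x in U, (shiftAverage (Metric.ball (t • a) (t * b)) (Ω.indicator z.1) x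
      - Ω.indicator z.1 x) ^ 2 ≤ (t * (‖a‖ + b) * ‖z.2‖) ^ 2 :=
  integral_sq_shiftAverage_sub_le (measurable_indicator hΩ z.1) (memLp_indicator hΩ z.1)
    measurableSet_ball (real_volume_ball_pos _ (by positivity)).ne' measure_ball_lt_top.ne
    fun _ => setIntegral_sq_translate_sub_le hΩ hfin hz hUo hcone ht0 ht1

theorem setIntegral_sq_le_of_cone :
    ∫ x in U, Ω.indicator z.1 x ^ 2
      ≤ (2 * (volume.real (Metric.ball (0 : Space N) b))⁻¹ + 2 * (‖a‖ + b) ^ 2) *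
        ((t ^ N)⁻¹ * (∫ x in Ω, |z.1 x|) ^ 2 + t ^ 2 * ‖z.2‖ ^ 2) := by
  set u := Ω.indicator z.1
  set A := shiftAverage (Metric.ball (t • a) (t * b)) u with hA
  set β := volume.real (Metric.ball (0 : Space N) b)
  set I := ∫ x in Ω, |z.1 x|
  have hum : Measurable u := measurable_indicator hΩ z.1
  have hu2 : MemLp u 2 (volume.restrict U) := (memLp_indicator hΩ z.1).restrict U
  have hdiff : MemLp (fun x => A x - u x) 2 (volume.restrict U) :=
    (memLp_two_iff_integrable_sq
      ((measurable_shiftAverage hum).sub hum).aestronglyMeasurable).2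
      (integrableOn_sq_shiftAverage_ball_sub hΩ hfin hz hUo hb hcone ht0 ht1)
  have hA2 : MemLp A 2 (volume.restrict U) := by
    simpa only [Pi.add_def, sub_add_cancel] using hdiff.add hu2
  have hsmooth : ∫ x in U, A x ^ 2 ≤ (t ^ N)⁻¹ * β⁻¹ * I ^ 2 := by
    have h := integral_sq_shiftAverage_le (U := U) (D := Metric.ball (t • a) (t * b)) hum
      (integrable_indicator_of_memLp hΩ hfin (Lp.memLp z.1)) measure_ball_lt_top.ne
    rwa [← hA, integral_abs_indicator hΩ, real_volume_ball _ (mul_pos ht0 hb), mul_pow, mul_assoc,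
      ← real_volume_ball (0 : Space N) hb, mul_inv] at h
  have hrough := setIntegral_sq_shiftAverage_ball_sub_le hΩ hfin hz hUo hb hcone ht0 ht1
  calc ∫ x in U, u x ^ 2 ≤ 2 * (∫ x in U, (A x - u x) ^ 2) + 2 * ∫ x in U, A x ^ 2 :=
        integral_sq_le_add hu2 hA2
    _ ≤ 2 * (t * (‖a‖ + b) * ‖z.2‖) ^ 2 + 2 * ((t ^ N)⁻¹ * β⁻¹ * I ^ 2) := by gcongr
    _ ≤ (2 * β⁻¹ + 2 * (‖a‖ + b) ^ 2) * ((t ^ N)⁻¹ * I ^ 2 + t ^ 2 * ‖z.2‖ ^ 2) := by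
        have hcross : 0 ≤ β⁻¹ * (t ^ 2 * ‖z.2‖ ^ 2) := by positivity
        have hcross' : 0 ≤ (‖a‖ + b) ^ 2 * ((t ^ N)⁻¹ * I ^ 2) := by positivity
        nlinarith

omit hΩ hfin hz hUo hb hcone ht0 ht1

theorem IsBoundedRegularOpen.exists_nash (hΩ : IsBoundedRegularOpen Ω) :
    ∃ C : ℝ, 0 < C ∧ ∀ t : ℝ, 0 < t → t ≤ 1 → ∀ z ∈ sobolevH1 Ω,
      ‖z.1‖ ^ 2 ≤ C * ((t ^ N)⁻¹ * (∫ x in Ω, |z.1 x|) ^ 2 + t ^ 2 * ‖z.2‖ ^ 2) := by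
  obtain ⟨F, V, a, b, hV⟩ := hΩ.exists_isConeCover
  have hm := hΩ.isOpen.measurableSet
  have hfin : volume Ω ≠ ∞ := hΩ.isBounded.measure_lt_top.ne
  let c : Space N → ℝ := fun i =>
    2 * (volume.real (Metric.ball (0 : Space N) (b i)))⁻¹ + 2 * (‖a i‖ + b i) ^ 2
  have hc : 0 ≤ ∑ i ∈ F, c i := Finset.sum_nonneg fun i _ => by positivity
  refine ⟨1 + ∑ i ∈ F, c i, by positivity, fun t ht0 ht1 z hz => ?_⟩
  calc ‖z.1‖ ^ 2 = ∫ x in Ω, Ω.indicator z.1 x ^ 2 := by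
        rw [← Lp.toLp_coeFn z.1 (Lp.memLp z.1), norm_toLp_sq]
        refine setIntegral_congr_fun hm fun x hx => ?_
        simp [hx]
    _ ≤ ∑ i ∈ F, ∫ x in V i, Ω.indicator z.1 x ^ 2 :=
        hV.setIntegral_le_sum hm ((memLp_indicator hm z.1).restrict Ω).integrable_sq
          fun _ => sq_nonneg _
    _ ≤ ∑ i ∈ F, c i * ((t ^ N)⁻¹ * (∫ x in Ω, |z.1 x|) ^ 2 + t ^ 2 * ‖z.2‖ ^ 2) :=
        Finset.sum_le_sum fun i hi => setIntegral_sq_le_of_cone hm hfin hz (hV.isOpen i)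
          (hV.pos i hi) (hV.add_smul_mem i hi) ht0 ht1
    _ ≤ _ := by
        rw [← Finset.sum_mul]
        gcongr
        linarith

end Nash

section CompactApproximation

variable {ι : Type*} {F : Finset ι} {V : ι → Set (Space N)} {a : ι → Space N} {b : ι → ℝ}

/-- The weight of `V i` in the partition of unity given by the indicator functions of the sets
`V j`, `j ∈ F`, divided by their sum. It need not be smooth, as it is never differentiated. -/
def coverWeight {X : Type*} (F : Finset ι) (V : ι → Set X) (i : ι) (x : X) : ℝ :=
  (V i).indicator (fun _ => 1) x / ∑ j ∈ F, (V j).indicator (fun _ => 1) x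

theorem coverWeight_nonneg {X : Type*} {V : ι → Set X} (i : ι) (x : X) : 0 ≤ coverWeight F V i x :=
  div_nonneg (indicator_nonneg (fun _ _ => zero_le_one) x)
    (Finset.sum_nonneg fun _ _ => indicator_nonneg (fun _ _ => zero_le_one) x)

theorem coverWeight_le_indicator {X : Type*} {V : ι → Set X} {i : ι} (hi : i ∈ F) (x : X) :
    coverWeight F V i x ≤ (V i).indicator (fun _ => 1) x := by
  by_cases hx : x ∈ V i
  · rw [coverWeight, indicator_of_mem hx]
    have hle := Finset.single_le_sum (f := fun j => (V j).indicator (fun _ => (1 : ℝ)) x)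
      (fun j _ => indicator_nonneg (fun _ _ => zero_le_one) x) hi
    simp only [indicator_of_mem hx] at hle
    exact div_le_one_of_le₀ hle (zero_le_one.trans hle)
  · simp [coverWeight, hx]

theorem coverWeight_le_one {X : Type*} {V : ι → Set X} {i : ι} (hi : i ∈ F) (x : X) :
    coverWeight F V i x ≤ 1 :=
  (coverWeight_le_indicator hi x).trans (indicator_le_self' (fun _ _ => zero_le_one) x)

theorem sum_coverWeight {X : Type*} {V : ι → Set X} {i : ι} (hi : i ∈ F) {x : X} (hx : x ∈ V i) :
    ∑ j ∈ F, coverWeight F V j x = 1 := by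
  have hpos : 0 < ∑ j ∈ F, (V j).indicator (fun _ => (1 : ℝ)) x :=
    Finset.sum_pos' (fun _ _ => indicator_nonneg (fun _ _ => zero_le_one) x) ⟨i, hi, by simp [hx]⟩
  simp only [coverWeight, ← Finset.sum_div, div_self hpos.ne']

theorem measurable_coverWeight {X : Type*} [MeasurableSpace X] {V : ι → Set X}
    (hV : ∀ i, MeasurableSet (V i)) (i : ι) : Measurable (coverWeight F V i) :=
  (measurable_const.indicator (hV i)).div
    (Finset.measurable_sum _ fun j _ => measurable_const.indicator (hV j))

/-- The kernel of the operator averaging over `x + D i` with the weight `coverWeight F V i x`. -/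
def averagingKernel (F : Finset ι) (V D : ι → Set (Space N)) (x y : Space N) : ℝ :=
  ∑ i ∈ F, coverWeight F V i x *
    ((volume.real (D i))⁻¹ * (D i).indicator (fun _ => 1) (y - x))

variable {D : ι → Set (Space N)}

theorem measurable_averagingKernel (hV : ∀ i, MeasurableSet (V i))
    (hD : ∀ i, MeasurableSet (D i)) : Measurable (Function.uncurry (averagingKernel F V D)) :=
  Finset.measurable_sum _ fun i _ => ((measurable_coverWeight hV i).comp measurable_fst).mul
    (((measurable_const.indicator (hD i)).comp (measurable_snd.sub measurable_fst)).const_mul _)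

theorem abs_averagingKernel_le (x y : Space N) :
    |averagingKernel F V D x y| ≤ ∑ i ∈ F, (volume.real (D i))⁻¹ := by
  refine (Finset.abs_sum_le_sum_abs _ _).trans (Finset.sum_le_sum fun i hi => ?_)
  have hind : 0 ≤ (D i).indicator (fun _ => (1 : ℝ)) (y - x) :=
    indicator_nonneg (fun _ _ => zero_le_one) _
  have hle : (D i).indicator (fun _ => (1 : ℝ)) (y - x) ≤ 1 :=
    indicator_le_self' (fun _ _ => zero_le_one) _
  rw [abs_of_nonneg (mul_nonneg (coverWeight_nonneg i x) (by positivity))]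
  calc coverWeight F V i x * ((volume.real (D i))⁻¹ * (D i).indicator (fun _ => 1) (y - x))
      ≤ 1 * ((volume.real (D i))⁻¹ * 1) := by
        gcongr
        exact coverWeight_le_one hi x
    _ = _ := by ring

theorem integral_averagingKernel_mul (hD : ∀ i, MeasurableSet (D i)) {f : Space N → ℝ}
    (hf : Integrable f volume) (x : Space N) :
    ∫ y, averagingKernel F V D x y * f y
      = ∑ i ∈ F, coverWeight F V i x * shiftAverage (D i) f x := by
  have hint : ∀ i, Integrable (fun y => (D i).indicator (fun _ => (1 : ℝ)) (y - x) * f y)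
      volume := fun i => by
    refine hf.bdd_mul (c := 1) ((measurable_const.indicator (hD i)).comp
      (measurable_id.sub_const x)).aestronglyMeasurable (Eventually.of_forall fun y => ?_)
    rw [Real.norm_of_nonneg (indicator_nonneg (fun _ _ => zero_le_one) _)]
    exact indicator_le_self' (fun _ _ => zero_le_one) _
  have hshift : ∀ i, ∫ y, (D i).indicator (fun _ => (1 : ℝ)) (y - x) * f y
      = ∫ z in D i, f (x + z) := fun i => by
    rw [← integral_add_left_eq_self _ x, ← integral_indicator (hD i)]
    congr 1
    ext z
    by_cases hz : z ∈ D i <;> simp [hz]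
  simp only [averagingKernel, Finset.sum_mul, mul_assoc]
  rw [integral_finsetSum _ fun i _ => ((hint i).const_mul _).const_mul _]
  simp only [integral_const_mul, hshift, shiftAverage]

theorem sq_sum_coverWeight_mul_le {X : Type*} {V : ι → Set X} {i : ι} (hi : i ∈ F) {x : X}
    (hx : x ∈ V i) (c : ι → X → ℝ) :
    (∑ j ∈ F, coverWeight F V j x * c j x) ^ 2
      ≤ ∑ j ∈ F, (V j).indicator (fun x => c j x ^ 2) x := by
  refine (Real.pow_arith_mean_le_arith_mean_pow_of_even F (fun j => coverWeight F V j x)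
    (fun j => c j x) (fun j _ => coverWeight_nonneg j x) (sum_coverWeight hi hx) even_two).trans
    (Finset.sum_le_sum fun j hj => ?_)
  calc coverWeight F V j x * c j x ^ 2
      ≤ (V j).indicator (fun _ => 1) x * c j x ^ 2 :=
        mul_le_mul_of_nonneg_right (coverWeight_le_indicator hj x) (sq_nonneg _)
    _ = (V j).indicator (fun x => c j x ^ 2) x := by
        by_cases hxj : x ∈ V j <;> simp [hxj]

theorem IsConeCover.norm_sub_averaging_sq_le (hV : IsConeCover Ω F V a b) (hΩ : MeasurableSet Ω)
    (hfin : volume Ω ≠ ∞) (hD : ∀ i, MeasurableSet (D i)) {u v : L2 Ω}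
    (hv : v =ᵐ[volume.restrict Ω] fun x => ∫ y in Ω, averagingKernel F V D x y * u y)
    (hint : ∀ i ∈ F, IntegrableOn
      (fun x => (shiftAverage (D i) (Ω.indicator u) x - Ω.indicator u x) ^ 2) (V i)) :
    ‖u - v‖ ^ 2 ≤ ∑ i ∈ F, ∫ x in V i,
      (shiftAverage (D i) (Ω.indicator u) x - Ω.indicator u x) ^ 2 := by
  have hVm : ∀ i ∈ F, MeasurableSet (V i) := fun i _ => (hV.isOpen i).measurableSet
  have haverage : ∀ x, ∫ y in Ω, averagingKernel F V D x y * u y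
      = ∑ i ∈ F, coverWeight F V i x * shiftAverage (D i) (Ω.indicator u) x := fun x => by
    rw [← integral_averagingKernel_mul hD (integrable_indicator_of_memLp hΩ hfin (Lp.memLp u)),
      ← integral_indicator hΩ]
    congr 1
    ext y
    by_cases hy : y ∈ Ω <;> simp [hy]
  calc ‖u - v‖ ^ 2 = ∫ x in Ω, (∑ i ∈ F, coverWeight F V i x *
        (shiftAverage (D i) (Ω.indicator u) x - Ω.indicator u x)) ^ 2 := by
        rw [← Lp.toLp_coeFn (u - v) (Lp.memLp _), norm_toLp_sq]
        refine setIntegral_congr_ae hΩ ?_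
        filter_upwards [(ae_restrict_iff' hΩ).1 (Lp.coeFn_sub u v),
          (ae_restrict_iff' hΩ).1 hv] with x hsub hvx hx
        obtain ⟨i, hi, hxi⟩ := hV.exists_mem x hx
        simp only [hsub hx, Pi.sub_apply, hvx hx, haverage, mul_sub, Finset.sum_sub_distrib,
          ← Finset.sum_mul, sum_coverWeight hi hxi, one_mul, indicator_of_mem hx]
        ring
    _ ≤ ∫ x in Ω, ∑ i ∈ F, (V i).indicator
          (fun x => (shiftAverage (D i) (Ω.indicator u) x - Ω.indicator u x) ^ 2) x := by
        refine integral_mono_of_nonneg (Eventually.of_forall fun _ => sq_nonneg _)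
          (integrable_finsetSum _ fun i hi =>
            ((integrable_indicator_iff (hVm i hi)).2 (hint i hi)).restrict)
          ((ae_restrict_iff' hΩ).2 (Eventually.of_forall fun x hx => ?_))
        obtain ⟨i, hi, hxi⟩ := hV.exists_mem x hx
        exact sq_sum_coverWeight_mul_le hi hxi
          fun j x => shiftAverage (D j) (Ω.indicator u) x - Ω.indicator u x
    _ = _ := setIntegral_sum_indicator hVm (fun i _ => hV.subset i) hint

theorem IsConeCover.exists_compact_approx (hV : IsConeCover Ω F V a b) (hΩ : MeasurableSet Ω)
    (hfin : volume Ω ≠ ∞) {t : ℝ} (ht0 : 0 < t) (ht1 : t ≤ 1) :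
    ∃ K : L2 Ω →L[ℝ] L2 Ω, IsCompactOperator K ∧ ∀ z ∈ sobolevH1 Ω,
      ‖z.1 - K z.1‖ ^ 2 ≤ t ^ 2 * (∑ i ∈ F, (‖a i‖ + b i) ^ 2) * ‖z.2‖ ^ 2 := by
  have : IsFiniteMeasure (volume.restrict Ω) := ⟨by simpa using hfin.lt_top⟩
  let D : ι → Set (Space N) := fun i => Metric.ball (t • a i) (t * b i)
  have hD : ∀ i, MeasurableSet (D i) := fun i => measurableSet_ball
  obtain ⟨K, hKc, hK⟩ := exists_isCompactOperator_kernel (μ := volume.restrict Ω)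
    (measurable_averagingKernel (F := F) (fun i => (hV.isOpen i).measurableSet) hD)
    abs_averagingKernel_le
  refine ⟨K, hKc, fun z hz => ?_⟩
  calc ‖z.1 - K z.1‖ ^ 2
      ≤ ∑ i ∈ F, ∫ x in V i, (shiftAverage (D i) (Ω.indicator z.1) x - Ω.indicator z.1 x) ^ 2 :=
        hV.norm_sub_averaging_sq_le hΩ hfin hD (hK z.1) fun i hi =>
          integrableOn_sq_shiftAverage_ball_sub hΩ hfin hz (hV.isOpen i) (hV.pos i hi)
            (hV.add_smul_mem i hi) ht0 ht1
    _ ≤ ∑ i ∈ F, (t * (‖a i‖ + b i) * ‖z.2‖) ^ 2 := Finset.sum_le_sum fun i hi =>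
        setIntegral_sq_shiftAverage_ball_sub_le hΩ hfin hz (hV.isOpen i) (hV.pos i hi)
          (hV.add_smul_mem i hi) ht0 ht1
    _ = _ := by simp only [mul_pow, Finset.mul_sum, Finset.sum_mul]

theorem IsBoundedRegularOpen.exists_compact_approx (hΩ : IsBoundedRegularOpen Ω) {ε : ℝ}
    (hε : 0 < ε) : ∃ K : L2 Ω →L[ℝ] L2 Ω, IsCompactOperator K ∧
      ∀ z ∈ sobolevH1 Ω, ‖z.1 - K z.1‖ ≤ ε * ‖z.2‖ := by
  obtain ⟨F, V, a, b, hV⟩ := hΩ.exists_isConeCover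
  set S : ℝ := ∑ i ∈ F, (‖a i‖ + b i) ^ 2
  have hS : 0 ≤ S := Finset.sum_nonneg fun _ _ => sq_nonneg _
  set t : ℝ := min 1 (ε / (S + 1))
  have ht0 : 0 < t := lt_min one_pos (by positivity)
  have htε : t * (S + 1) ≤ ε := (le_div_iff₀ (by positivity)).1 (min_le_right _ _)
  obtain ⟨K, hKc, hK⟩ := hV.exists_compact_approx hΩ.isOpen.measurableSet
    hΩ.isBounded.measure_lt_top.ne ht0 (min_le_left _ _)
  refine ⟨K, hKc, fun z hz => abs_le_of_sq_le_sq' ?_ (by positivity) |>.2⟩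
  calc ‖z.1 - K z.1‖ ^ 2 ≤ t ^ 2 * S * ‖z.2‖ ^ 2 := hK z hz
    _ ≤ (t * (S + 1)) ^ 2 * ‖z.2‖ ^ 2 := by
        rw [mul_pow]
        gcongr
        nlinarith
    _ ≤ (ε * ‖z.2‖) ^ 2 := by
        rw [← mul_pow]
        gcongr

end CompactApproximation

section Resolvent

variable {H K : Type*} [NormedAddCommGroup H] [InnerProductSpace ℝ H]
  [NormedAddCommGroup K] [InnerProductSpace ℝ K]

/-- `S` maps `f` to the pair `(u, ∇u)`, where `u` is the variational solution of `r u + L u = r f`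
for the operator `L` of the quadratic form `(u, ∇u) ↦ ‖∇u‖²` with domain `V`. -/
structure IsResolventPair (V : Submodule ℝ (H × K)) (r : ℝ) (S : H →L[ℝ] H × K) : Prop where
  mem : ∀ f, S f ∈ V
  inner_add : ∀ f, ∀ v ∈ V, r * inner ℝ (S f).1 v.1 + inner ℝ (S f).2 v.2 = r * inner ℝ f v.1

/-- For the norm `r ‖u‖² + ‖∇u‖²`, the pair is the orthogonal projection of `(f, 0)` to `V`. The
factor `√r` turns this norm into the standard one of the Hilbert sum. -/
theorem exists_isResolventPair [CompleteSpace H] [CompleteSpace K] {V : Submodule ℝ (H × K)}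
    (hV : IsClosed (V : Set (H × K))) {r : ℝ} (hr : 0 < r) :
    ∃ S : H →L[ℝ] H × K, IsResolventPair V r S := by
  let c : ℝ := √r
  have hc : 0 < c := Real.sqrt_pos.2 hr
  have hcc : c * c = r := Real.mul_self_sqrt hr.le
  let L : WithLp 2 (H × K) →L[ℝ] H × K :=
    (c⁻¹ • WithLp.fstL 2 ℝ H K).prod (WithLp.sndL 2 ℝ H K)
  let W : Submodule ℝ (WithLp 2 (H × K)) := V.comap L.toLinearMap
  have hW : IsClosed (W : Set (WithLp 2 (H × K))) := hV.preimage L.continuous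
  have : CompleteSpace W := hW.completeSpace_coe
  let ι : H →L[ℝ] WithLp 2 (H × K) :=
    (WithLp.prodContinuousLinearEquiv 2 ℝ H K).symm.toContinuousLinearMap.comp
      ((c • ContinuousLinearMap.id ℝ H).prod 0)
  refine ⟨L.comp (W.starProjection.comp ι), fun f => W.starProjection_apply_mem (ι f),
    fun f v hv => ?_⟩
  let v' : WithLp 2 (H × K) := WithLp.toLp 2 (c • v.1, v.2)
  have hv' : v' ∈ W := by
    change L v' ∈ V
    have hLv' : L v' = v := Prod.ext (inv_smul_smul₀ hc.ne' v.1) rfl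
    rwa [hLv']
  have horth := W.starProjection_inner_eq_zero (ι f) v' hv'
  rw [inner_sub_left, sub_eq_zero, WithLp.prod_inner_apply, WithLp.prod_inner_apply] at horth
  change inner ℝ (c • f) (c • v.1) + inner ℝ (0 : K) v.2
    = inner ℝ (W.starProjection (ι f)).fst (c • v.1)
      + inner ℝ (W.starProjection (ι f)).snd v.2 at horth
  change r * inner ℝ (c⁻¹ • (W.starProjection (ι f)).fst) v.1
    + inner ℝ (W.starProjection (ι f)).snd v.2 = _
  rw [real_inner_smul_left, real_inner_smul_right, inner_zero_left, real_inner_smul_right] at horth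
  rw [real_inner_smul_left, ← hcc]
  field_simp
  linarith

namespace IsResolventPair

variable {V : Submodule ℝ (H × K)} {r : ℝ} {S : H →L[ℝ] H × K} (hS : IsResolventPair V r S)

include hS

theorem inner_fst_left (hr : r ≠ 0) (f g : H) : inner ℝ (S f).1 g = inner ℝ f (S g).1 := by
  have hfg := hS.inner_add f _ (hS.mem g)
  have hgf := hS.inner_add g _ (hS.mem f)
  rw [real_inner_comm (S f).1 (S g).1, real_inner_comm (S f).2 (S g).2] at hgf
  rw [real_inner_comm]
  exact mul_left_cancel₀ hr (hgf.symm.trans hfg)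

theorem eq_zero_of_fst_eq_zero (hr : r ≠ 0) (hV : Dense (Prod.fst '' (V : Set (H × K)))) {f : H}
    (hf : (S f).1 = 0) : f = 0 := by
  have hgrad : (S f).2 = 0 := by
    have h := hS.inner_add f _ (hS.mem f)
    rwa [hf, inner_zero_left, inner_zero_right, mul_zero, zero_add, inner_self_eq_zero] at h
  refine hV.eq_zero_of_inner_left (𝕜 := ℝ) ?_
  rintro _ ⟨v, hv, rfl⟩
  have h := hS.inner_add f v hv
  rw [hf, hgrad, inner_zero_left, inner_zero_left, mul_zero, zero_add] at h
  exact (mul_eq_zero.1 h.symm).resolve_left hr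

end IsResolventPair

end Resolvent

section Eigenspaces

theorem isSpectralFamily_starProjection {H : Type*} [NormedAddCommGroup H]
    [InnerProductSpace ℝ H] [CompleteSpace H] (E : ℝ → Submodule ℝ H)
    [∀ a, CompleteSpace (E a)]
    (horth : ∀ a b, a ≠ b → ∀ u ∈ E a, ∀ v ∈ E b, inner ℝ u v = (0 : ℝ))
    (htot : (⨆ a, E a)ᗮ = ⊥) (hneg : ∀ a < 0, ∀ u ∈ E a, u = 0) :
    IsSpectralFamily (fun a => (E a).starProjection) := by
  have hmem : ∀ a u, (E a).starProjection u ∈ E a := fun a u => (E a).starProjection_apply_mem u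
  have hself : ∀ a, ∀ u ∈ E a, (E a).starProjection u = u := fun a u hu =>
    (E a).starProjection_eq_self_iff.2 hu
  have hzero : ∀ a b, a ≠ b → ∀ u ∈ E b, (E a).starProjection u = 0 := fun a b hab u hu => by
    rw [Submodule.starProjection_apply_eq_zero_iff, Submodule.mem_orthogonal]
    exact fun w hw => horth a b hab w hw u hu
  have hE : OrthogonalFamily ℝ (fun a => E a) fun a => (E a).subtypeₗᵢ := by
    rintro a b hab ⟨u, hu⟩ ⟨v, hv⟩
    exact horth a b hab u hu v hv
  have hsum : IsHilbertSum ℝ (fun a => E a) fun a => (E a).subtypeₗᵢ :=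
    IsHilbertSum.mkInternal E hE (by rw [(Submodule.topologicalClosure_eq_top_iff).2 htot])
  refine ⟨fun a u v => Submodule.inner_starProjection_left_eq_right _ u v,
    fun a u => hself a _ (hmem a u), fun a b u hab => hzero a b hab _ (hmem b u), fun u => ?_,
    fun a u ha => hneg a ha _ (hmem a u)⟩
  set c := hsum.linearIsometryEquiv u
  have hc : HasSum (fun a => (c a : H)) u := by
    have h := hsum.hasSum_linearIsometryEquiv_symm c
    rwa [LinearIsometryEquiv.symm_apply_apply] at h
  have hcomponent : ∀ a, (E a).starProjection u = c a := fun a => by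
    refine (hc.mapL (E a).starProjection).unique ?_
    rw [← hself a _ (c a).2]
    simpa only [hself a _ (c a).2] using
      hasSum_single (f := fun b => (E a).starProjection (c b)) a fun b hba =>
        hzero a b hba.symm _ (c b).2
  simpa only [hcomponent] using hc

theorem IsBoundedRegularOpen.measure_ne_top (hΩ : IsBoundedRegularOpen Ω) : volume Ω ≠ ∞ :=
  hΩ.isBounded.measure_lt_top.ne

theorem IsBoundedRegularOpen.isFiniteMeasure (hΩ : IsBoundedRegularOpen Ω) :
    IsFiniteMeasure (volume.restrict Ω) := ⟨by simpa using hΩ.measure_ne_top.lt_top⟩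

theorem IsBoundedRegularOpen.isCompactOperator_fst (hΩ : IsBoundedRegularOpen Ω)
    {E : Type*} [NormedAddCommGroup E] [NormedSpace ℝ E] {S : E →L[ℝ] L2 Ω × L2Vec Ω}
    (hS : ∀ f, S f ∈ sobolevH1 Ω) :
    IsCompactOperator ((ContinuousLinearMap.fst ℝ (L2 Ω) (L2Vec Ω)).comp S) := by
  choose! T hTc hT using fun n : ℕ =>
    hΩ.exists_compact_approx (ε := 1 / ((n : ℝ) + 1)) (by positivity)
  refine isCompactOperator_of_tendsto (l := atTop)
    (F := fun n => (T n).comp ((ContinuousLinearMap.fst ℝ _ _).comp S)) ?_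
    (Eventually.of_forall fun n => (hTc n).comp_clm _)
  rw [tendsto_iff_norm_sub_tendsto_zero]
  refine squeeze_zero (fun _ => norm_nonneg _) (fun n => ?_)
    (by simpa only [zero_mul] using tendsto_one_div_add_atTop_nhds_zero_nat.mul_const ‖S‖)
  refine ContinuousLinearMap.opNorm_le_bound _ (by positivity) fun f => ?_
  have happrox := hT n (S f) (hS f)
  rw [norm_sub_rev] at happrox
  refine happrox.trans ?_
  rw [mul_assoc]
  gcongr
  exact (norm_snd_le _).trans (S.le_opNorm f)

variable {bc : BoundaryCondition} {a : ℝ}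

theorem inner_eq_zero_of_mem_eigenspace {b : ℝ} (hab : a ≠ b) {u v : L2 Ω}
    (hu : u ∈ eigenspace Ω bc a) (hv : v ∈ eigenspace Ω bc b) : inner ℝ u v = (0 : ℝ) := by
  obtain ⟨G, hG, hu⟩ := hu
  obtain ⟨G', hG', hv⟩ := hv
  have huv := hu _ hG'
  have hvu := hv _ hG
  simp only at huv hvu
  rw [real_inner_comm, huv, real_inner_comm u v] at hvu
  have hmul : (a - b) * inner ℝ u v = 0 := by linarith
  exact (mul_eq_zero.1 hmul).resolve_left (sub_ne_zero.2 hab)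

theorem eq_zero_of_mem_eigenspace_of_neg (ha : a < 0) {u : L2 Ω} (hu : u ∈ eigenspace Ω bc a) :
    u = 0 := by
  obtain ⟨G, hG, hu⟩ := hu
  have henergy := hu _ hG
  simp only [real_inner_self_eq_norm_sq] at henergy
  by_contra hne
  have hpos : 0 < ‖u‖ := norm_pos_iff.2 hne
  nlinarith [sq_nonneg ‖G‖, pow_pos hpos 2]

theorem IsResolventPair.mem_eigenspace_iff {r : ℝ} (hr : r ≠ 0)
    {S : L2 Ω →L[ℝ] L2 Ω × L2Vec Ω} (hS : IsResolventPair (formDomain Ω bc) r S) {e : L2 Ω} :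
    e ∈ eigenspace Ω bc a ↔ (r + a) • (S e).1 = r • e := by
  constructor
  · rintro ⟨G, hG, he⟩
    refine ext_inner_right ℝ fun f => ?_
    have hresolvent := hS.inner_add f _ hG
    have heigen := he _ (hS.mem f)
    simp only at hresolvent heigen
    rw [real_inner_comm e, real_inner_comm G, heigen, real_inner_comm e f] at hresolvent
    rw [real_inner_smul_left, real_inner_smul_left, hS.inner_fst_left hr]
    linarith
  · intro h
    have he : e = (r⁻¹ * (r + a)) • (S e).1 := by rw [mul_smul, h, inv_smul_smul₀ hr]
    refine ⟨(r⁻¹ * (r + a)) • (S e).2, ?_, fun z hz => ?_⟩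
    · have hmem := (formDomain Ω bc).smul_mem (r⁻¹ * (r + a)) (hS.mem e)
      rwa [← Prod.mk.eta (p := S e), Prod.smul_mk, ← he] at hmem
    · have hresolvent := hS.inner_add e z hz
      have hinner : inner ℝ e z.1 = r⁻¹ * (r + a) * inner ℝ (S e).1 z.1 := by
        rw [← real_inner_smul_left, ← he]
      rw [real_inner_smul_left]
      field_simp at hinner ⊢
      linear_combination (r + a) * hresolvent + r * hinner

theorem isClosed_eigenspace (bc : BoundaryCondition) (a : ℝ) :
    IsClosed (eigenspace Ω bc a : Set (L2 Ω)) := by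
  obtain ⟨S, hS⟩ := exists_isResolventPair (isClosed_formDomain (Ω := Ω) bc) one_pos
  have hset : (eigenspace Ω bc a : Set (L2 Ω)) = {e | (1 + a) • (S e).1 = (1 : ℝ) • e} := by
    ext e
    exact hS.mem_eigenspace_iff one_ne_zero
  rw [hset]
  exact isClosed_eq (by fun_prop) (by fun_prop)

theorem topologicalClosure_eigenspace (bc : BoundaryCondition) (a : ℝ) :
    (eigenspace Ω bc a).topologicalClosure = eigenspace Ω bc a :=
  (isClosed_eigenspace bc a).submodule_topologicalClosure_eq

theorem dense_image_fst_formDomain (hΩ : IsOpen Ω) (bc : BoundaryCondition) :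
    Dense (Prod.fst '' (formDomain Ω bc : Set (L2 Ω × L2Vec Ω))) := by
  refine (dense_testSpace hΩ).mono ?_
  rintro _ ⟨φ, hφ, rfl⟩
  exact ⟨_, hφ.toSobolev_mem_formDomain bc, rfl⟩

/-- The spectral theorem for compact operators, applied to the resolvent. -/
theorem orthogonal_iSup_eigenspace (hΩ : IsBoundedRegularOpen Ω) (bc : BoundaryCondition) :
    (⨆ a, eigenspace Ω bc a)ᗮ = ⊥ := by
  obtain ⟨S, hS⟩ := exists_isResolventPair (isClosed_formDomain (Ω := Ω) bc) one_pos
  let R : L2 Ω →L[ℝ] L2 Ω := (ContinuousLinearMap.fst ℝ _ _).comp S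
  have hcompact : IsCompactOperator R :=
    hΩ.isCompactOperator_fst fun f => formDomain_le_sobolevH1 bc (hS.mem f)
  have hsymm : (R : L2 Ω →ₗ[ℝ] L2 Ω).IsSymmetric := hS.inner_fst_left one_ne_zero
  rw [eq_bot_iff, ← ContinuousLinearMap.orthogonalComplement_iSup_eigenspaces_eq_bot hcompact hsymm]
  refine Submodule.orthogonal_le (iSup_le fun ν e he => ?_)
  have he : (S e).1 = ν • e := Module.End.mem_eigenspace_iff.1 he
  rcases eq_or_ne ν 0 with rfl | hν
  · rw [zero_smul] at he
    rw [hS.eq_zero_of_fst_eq_zero one_ne_zero (dense_image_fst_formDomain hΩ.isOpen bc) he]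
    exact Submodule.zero_mem _
  · refine Submodule.mem_iSup_of_mem (ν⁻¹ - 1) ((hS.mem_eigenspace_iff one_ne_zero).2 ?_)
    rw [he, smul_smul, add_sub_cancel, inv_mul_cancel₀ hν]

theorem isSpectralFamily_eigenprojection (hΩ : IsBoundedRegularOpen Ω) (bc : BoundaryCondition) :
    IsSpectralFamily (eigenprojection Ω bc) := by
  refine isSpectralFamily_starProjection
    (fun a => (eigenspace Ω bc a).topologicalClosure) ?_ ?_ ?_ <;>
    simp only [topologicalClosure_eigenspace]
  · exact fun a b hab u hu v hv => inner_eq_zero_of_mem_eigenspace hab hu hv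
  · exact orthogonal_iSup_eigenspace hΩ bc
  · exact fun a ha u hu => eq_zero_of_mem_eigenspace_of_neg ha hu

theorem eigenprojection_mem (bc : BoundaryCondition) (a : ℝ) (u : L2 Ω) :
    eigenprojection Ω bc a u ∈ eigenspace Ω bc a := by
  rw [← topologicalClosure_eigenspace]
  exact Submodule.starProjection_apply_mem _ _

end Eigenspaces

section MaximumPrinciple

theorem abs_div_add_le_one {r a : ℝ} (hr : 0 < r) (ha : 0 ≤ a) : |r / (r + a)| ≤ 1 := by
  rw [abs_of_nonneg (by positivity), div_le_one (by positivity)]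
  linarith

theorem IsResolventPair.calculus_eq_fst {bc : BoundaryCondition} (hΩ : IsBoundedRegularOpen Ω)
    {r : ℝ} (hr : 0 < r) {S : L2 Ω →L[ℝ] L2 Ω × L2Vec Ω}
    (hS : IsResolventPair (formDomain Ω bc) r S) (g : L2 Ω) :
    spectralCalculus (eigenprojection Ω bc) (fun a => r / (r + a)) g = (S g).1 := by
  have hP := isSpectralFamily_eigenprojection hΩ bc
  refine hP.calculus_eq (fun a ha => abs_div_add_le_one hr ha) fun a ha => ?_
  refine ext_inner_right ℝ fun w => ?_
  have heigen : (r + a) • (S (eigenprojection Ω bc a w)).1 = r • eigenprojection Ω bc a w :=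
    (hS.mem_eigenspace_iff hr.ne').1 (eigenprojection_mem bc a w)
  have hscale : (S (eigenprojection Ω bc a w)).1 = (r / (r + a)) • eigenprojection Ω bc a w := by
    have hra : r + a ≠ 0 := by positivity
    rw [div_eq_inv_mul, mul_smul, ← heigen, inv_smul_smul₀ hra]
  rw [real_inner_smul_left, hP.symm, hP.symm, hS.inner_fst_left hr.ne', hscale,
    real_inner_smul_right]

theorem ae_le_of_integral_sub_mul_smoothTransition_le {X : Type*} [MeasurableSpace X]
    {μ : Measure X} {u : X → ℝ} {c : ℝ}
    (hint : Integrable (fun x => (u x - c) * Real.smoothTransition (u x - c)) μ)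
    (hle : ∫ x, (u x - c) * Real.smoothTransition (u x - c) ∂μ ≤ 0) : ∀ᵐ x ∂μ, u x ≤ c := by
  have hnonneg : ∀ x, 0 ≤ (u x - c) * Real.smoothTransition (u x - c) := fun x => by
    rcases le_total (u x) c with h | h
    · rw [Real.smoothTransition.zero_of_nonpos (sub_nonpos.2 h), mul_zero]
    · exact mul_nonneg (sub_nonneg.2 h) (Real.smoothTransition.nonneg _)
  have hzero := (integral_eq_zero_iff_of_nonneg hnonneg hint).1
    (hle.antisymm (integral_nonneg hnonneg))
  filter_upwards [hzero] with x hx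
  by_contra! hlt
  have hpos : 0 < u x - c := sub_pos.2 hlt
  exact (mul_pos hpos (Real.smoothTransition.pos_of_pos hpos)).ne' hx

theorem IsSmoothCutoff.inner_snd_comp_nonneg {Φ : ℝ → ℝ} (hΦ : IsSmoothCutoff Φ)
    (z : L2 Ω × L2Vec Ω) : 0 ≤ inner ℝ z.2 (hΦ.comp z).2 := by
  rw [L2.inner_def]
  refine integral_nonneg_of_ae ?_
  filter_upwards [(hΦ.memLp_deriv_smul z.1 z.2).coeFn_toLp] with x hx
  simp only [IsSmoothCutoff.comp, Pi.zero_apply]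
  rw [hx, real_inner_smul_right, real_inner_self_eq_norm_sq]
  exact mul_nonneg (hΦ.deriv_nonneg _) (sq_nonneg _)

theorem IsSmoothCutoff.inner_fst_comp {Φ : ℝ → ℝ} (hΦ : IsSmoothCutoff Φ) (f : L2 Ω)
    (z : L2 Ω × L2Vec Ω) : inner ℝ f (hΦ.comp z).1 = ∫ x in Ω, f x * Φ (z.1 x) := by
  rw [← inner_toLp_toLp (Lp.memLp f) (hΦ.memLp z.1), Lp.toLp_coeFn]
  rfl

/-- The equation is tested with a smooth version of the positive part of `u - c`. -/
theorem IsResolventPair.ae_fst_le {bc : BoundaryCondition} (hΩ : IsBoundedRegularOpen Ω) {r : ℝ}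
    (hr : 0 < r) {S : L2 Ω →L[ℝ] L2 Ω × L2Vec Ω} (hS : IsResolventPair (formDomain Ω bc) r S)
    {g : L2 Ω} {c : ℝ} (hc : 0 ≤ c) (hg : ∀ᵐ x ∂volume.restrict Ω, g x ≤ c) :
    ∀ᵐ x ∂volume.restrict Ω, (S g).1 x ≤ c := by
  have := hΩ.isFiniteMeasure
  have hΦ := isSmoothCutoff_smoothTransition hc
  set Φ : ℝ → ℝ := fun x => Real.smoothTransition (x - c)
  set u := (S g).1
  have hint : ∀ f : L2 Ω, Integrable (fun x => f x * Φ (u x)) (volume.restrict Ω) := fun f =>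
    (Lp.memLp f).integrable_mul (hΦ.memLp u)
  have hintc : Integrable (fun x => c * Φ (u x)) (volume.restrict Ω) :=
    ((hΦ.memLp u).integrable (by norm_num)).const_mul c
  have henergy : ∫ x in Ω, u x * Φ (u x) ≤ ∫ x in Ω, g x * Φ (u x) := by
    have heq := hS.inner_add g _
      (hΦ.comp_mem_formDomain hΩ.isOpen hΩ.measure_ne_top bc (hS.mem g))
    rw [hΦ.inner_fst_comp, hΦ.inner_fst_comp] at heq
    refine le_of_mul_le_mul_left ?_ hr
    linarith [hΦ.inner_snd_comp_nonneg (S g)]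
  have hsource : ∫ x in Ω, g x * Φ (u x) ≤ ∫ x in Ω, c * Φ (u x) := by
    refine integral_mono_ae (hint g) hintc ?_
    filter_upwards [hg] with x hx
    exact mul_le_mul_of_nonneg_right hx (Real.smoothTransition.nonneg _)
  refine ae_le_of_integral_sub_mul_smoothTransition_le ?_ ?_ <;> simp only [sub_mul]
  · exact (hint u).sub hintc
  · rw [integral_sub (hint u) hintc]
    linarith

theorem subMarkovian_resolvent (hΩ : IsBoundedRegularOpen Ω) (bc : BoundaryCondition) {r : ℝ}
    (hr : 0 < r) : SubMarkovian (eigenprojection Ω bc) 1 (fun a => r / (r + a)) where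
  nonneg a ha := by positivity
  le a ha := (le_abs_self _).trans (abs_div_add_le_one hr ha)
  ae_le g c hc hg := by
    obtain ⟨S, hS⟩ := exists_isResolventPair (isClosed_formDomain (Ω := Ω) bc) hr
    rw [hS.calculus_eq_fst hΩ hr, one_mul]
    exact hS.ae_fst_le hΩ hr hc hg

end MaximumPrinciple

section IntegralBounds

variable {X : Type*} [MeasurableSpace X] {μ : Measure X}

theorem continuous_integral_abs [IsFiniteMeasure μ] :
    Continuous fun v : Lp ℝ 2 μ => ∫ x, |v x| ∂μ := by
  let one : Lp ℝ 2 μ := (memLp_const (1 : ℝ)).toLp _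
  have habs : Continuous fun v : Lp ℝ 2 μ => |v| := continuous_id.sup continuous_neg
  refine (habs.inner (continuous_const (y := one))).congr fun v => ?_
  rw [inner_eq_integral]
  refine integral_congr_ae ?_
  filter_upwards [Lp.coeFn_abs v, (memLp_const (μ := μ) (p := 2) (1 : ℝ)).coeFn_toLp] with x hv hone
  rw [hv, hone, mul_one]

theorem ae_le_of_forall_inner_le [IsFiniteMeasure μ] {v : Lp ℝ 2 μ} {c : ℝ}
    (h : ∀ φ : Lp ℝ 2 μ, inner ℝ v φ ≤ c * ∫ x, |φ x| ∂μ) : ∀ᵐ x ∂μ, v x ≤ c := by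
  refine ae_le_of_forall_setIntegral_le ((Lp.memLp v).integrable (by norm_num))
    (integrable_const _) fun A hA _ => ?_
  have hφ : MemLp (A.indicator fun _ => (1 : ℝ)) 2 μ := (memLp_const 1).indicator hA
  have hinner : inner ℝ v (hφ.toLp _) = ∫ x in A, v x ∂μ := by
    rw [inner_eq_integral, ← integral_indicator hA]
    refine integral_congr_ae ?_
    filter_upwards [hφ.coeFn_toLp] with x hx
    simp [hx, ← indicator_mul_right]
  have hnorm : ∫ x, |hφ.toLp _ x| ∂μ = ∫ _ in A, (1 : ℝ) ∂μ := by
    rw [← integral_indicator hA]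
    refine integral_congr_ae ?_
    filter_upwards [hφ.coeFn_toLp] with x hx
    rw [hx, abs_of_nonneg (indicator_nonneg (fun _ _ => zero_le_one) _)]
  have hA' := h (hφ.toLp _)
  rwa [hinner, hnorm, ← integral_const_mul, mul_one] at hA'

theorem ae_abs_le_of_forall_inner_le [IsFiniteMeasure μ] {v : Lp ℝ 2 μ} {c : ℝ}
    (h : ∀ φ : Lp ℝ 2 μ, inner ℝ v φ ≤ c * ∫ x, |φ x| ∂μ) : ∀ᵐ x ∂μ, |v x| ≤ c := by
  have hneg : ∀ φ : Lp ℝ 2 μ, inner ℝ (-v) φ ≤ c * ∫ x, |φ x| ∂μ := fun φ => by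
    have habs : ∫ x, |(-φ : Lp ℝ 2 μ) x| ∂μ = ∫ x, |φ x| ∂μ := by
      refine integral_congr_ae ?_
      filter_upwards [Lp.coeFn_neg φ] with x hx
      rw [hx, Pi.neg_apply, abs_neg]
    rw [inner_neg_left, ← inner_neg_right, ← habs]
    exact h (-φ)
  filter_upwards [ae_le_of_forall_inner_le h, ae_le_of_forall_inner_le hneg, Lp.coeFn_neg v]
    with x hle hnegle hx
  rw [hx, Pi.neg_apply] at hnegle
  exact abs_le'.2 ⟨hle, hnegle⟩

theorem integral_abs_compl_indicator_le {g : X → ℝ} {a p : ℝ} (ha : 0 < a) (hp : 1 ≤ p)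
    (hg : Integrable (fun x => |g x| ^ p) μ) :
    ∫ x, |{x | |g x| ≤ a}ᶜ.indicator g x| ∂μ ≤ a ^ (1 - p) * ∫ x, |g x| ^ p ∂μ := by
  rw [← integral_const_mul]
  refine integral_mono_of_nonneg (Eventually.of_forall fun x => abs_nonneg _) (hg.const_mul _)
    (Eventually.of_forall fun x => ?_)
  change |{x | |g x| ≤ a}ᶜ.indicator g x| ≤ a ^ (1 - p) * |g x| ^ p
  rcases le_or_gt (|g x|) a with hle | hlt
  · rw [indicator_of_notMem (by simpa using hle), abs_zero]
    positivity
  · rw [indicator_of_mem (by simpa using hlt)]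
    calc |g x| = |g x| ^ (1 - p) * |g x| ^ p := by
          rw [← Real.rpow_add (ha.trans hlt), sub_add_cancel, Real.rpow_one]
      _ ≤ a ^ (1 - p) * |g x| ^ p := mul_le_mul_of_nonneg_right
          (Real.rpow_le_rpow_of_nonpos ha hlt.le (by linarith)) (by positivity)

/-- A function `g ∈ L^p` is cut at height `a` into a part bounded by `a` and a part in `L^1`. -/
theorem ae_abs_le_add_of_ae_abs_le_integral {S : Lp ℝ 2 μ → Lp ℝ 2 μ} {k p a : ℝ}
    (hadd : ∀ u v, S (u + v) = S u + S v)
    (hsup : ∀ (u : Lp ℝ 2 μ) (c : ℝ), 0 ≤ c → (∀ᵐ x ∂μ, |u x| ≤ c) → ∀ᵐ x ∂μ, |S u x| ≤ c)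
    (hk : 0 ≤ k) (hint : ∀ u : Lp ℝ 2 μ, ∀ᵐ x ∂μ, |S u x| ≤ k * ∫ y, |u y| ∂μ)
    (ha : 0 < a) (hp : 1 ≤ p) {g : Lp ℝ 2 μ} (hg : Integrable (fun x => |g x| ^ p) μ) :
    ∀ᵐ x ∂μ, |S g x| ≤ a + k * (a ^ (1 - p) * ∫ y, |g y| ^ p ∂μ) := by
  let A : Set X := {x | |g x| ≤ a}
  have hA : MeasurableSet A :=
    measurableSet_le (Lp.stronglyMeasurable g).measurable.abs measurable_const
  have hlow : MemLp (A.indicator g) 2 μ := (Lp.memLp g).indicator hA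
  have hhigh : MemLp (Aᶜ.indicator g) 2 μ := (Lp.memLp g).indicator hA.compl
  have hsplit : S g = S (hlow.toLp _) + S (hhigh.toLp _) := by
    rw [← hadd, ← MemLp.toLp_add]
    simp only [indicator_self_add_compl, Lp.toLp_coeFn]
  have hlow_le : ∀ᵐ x ∂μ, |S (hlow.toLp _) x| ≤ a := by
    refine hsup _ a ha.le ?_
    filter_upwards [hlow.coeFn_toLp] with x hx
    rw [hx]
    by_cases hxA : x ∈ A
    · rwa [indicator_of_mem hxA]
    · rw [indicator_of_notMem hxA, abs_zero]
      exact ha.le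
  have hhigh_le : ∫ y, |hhigh.toLp _ y| ∂μ ≤ a ^ (1 - p) * ∫ y, |g y| ^ p ∂μ := by
    refine le_trans (integral_congr_ae ?_).le (integral_abs_compl_indicator_le ha hp hg)
    filter_upwards [hhigh.coeFn_toLp] with x hx
    rw [hx]
  filter_upwards [hlow_le, hint (hhigh.toLp _),
    Lp.coeFn_add (S (hlow.toLp _)) (S (hhigh.toLp _))] with x hxlow hxhigh hx
  rw [hsplit, hx, Pi.add_apply]
  refine (abs_add_le _ _).trans (add_le_add hxlow (hxhigh.trans ?_))
  gcongr

theorem ae_abs_le_of_ae_abs_le_integral {S : Lp ℝ 2 μ → Lp ℝ 2 μ} {k p : ℝ}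
    (hadd : ∀ u v, S (u + v) = S u + S v)
    (hsup : ∀ (u : Lp ℝ 2 μ) (c : ℝ), 0 ≤ c → (∀ᵐ x ∂μ, |u x| ≤ c) → ∀ᵐ x ∂μ, |S u x| ≤ c)
    (hk : 0 < k) (hint : ∀ u : Lp ℝ 2 μ, ∀ᵐ x ∂μ, |S u x| ≤ k * ∫ y, |u y| ∂μ)
    (hp : 1 ≤ p) {g : Lp ℝ 2 μ} (hg : Integrable (fun x => |g x| ^ p) μ) :
    ∀ᵐ x ∂μ, |S g x| ≤ 2 * (k * ∫ y, |g y| ^ p ∂μ) ^ p⁻¹ := by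
  have hp0 : 0 < p := by linarith
  set m := ∫ y, |g y| ^ p ∂μ
  have hm : 0 ≤ m := integral_nonneg fun _ => by positivity
  rcases hm.eq_or_lt with hm0 | hmpos
  · rw [← hm0, mul_zero, Real.zero_rpow (inv_ne_zero hp0.ne'), mul_zero]
    have hg0 : (fun x => |g x| ^ p) =ᵐ[μ] 0 :=
      (integral_eq_zero_iff_of_nonneg (fun _ => by positivity) hg).1 hm0.symm
    refine hsup g 0 le_rfl ?_
    filter_upwards [hg0] with x hx
    exact ((Real.rpow_eq_zero (abs_nonneg _) hp0.ne').1 hx).le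
  set a := (k * m) ^ p⁻¹
  have ha : 0 < a := by positivity
  have hkm : k * (a ^ (1 - p) * m) = a := by
    calc k * (a ^ (1 - p) * m) = a ^ (1 - p) * (k * m) := by ring
      _ = a ^ (1 - p) * a ^ p := by rw [Real.rpow_inv_rpow (by positivity) hp0.ne']
      _ = a := by rw [← Real.rpow_add ha, sub_add_cancel, Real.rpow_one]
  have hle := ae_abs_le_add_of_ae_abs_le_integral hadd hsup hk.le hint ha hp hg
  rwa [hkm, ← two_mul] at hle

end IntegralBounds

section SubMarkovianContraction

variable {X : Type*} [MeasurableSpace X] {μ : Measure X} {P : ℝ → Lp ℝ 2 μ →L[ℝ] Lp ℝ 2 μ}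
  {m : ℝ} {f : ℝ → ℝ}

theorem SubMarkovian.ae_abs_le (hf : SubMarkovian P m f) (hP : IsSpectralFamily P) {u : Lp ℝ 2 μ}
    {c : ℝ} (hc : 0 ≤ c) (hu : ∀ᵐ x ∂μ, |u x| ≤ c) :
    ∀ᵐ x ∂μ, |spectralCalculus P f u x| ≤ m * c := by
  have hneg : spectralCalculus P f (-u) = -spectralCalculus P f u := by
    simpa only [neg_one_smul] using hP.calculus_smul_right hf.abs_le (-1) u
  have hle := hf.ae_le u c hc (hu.mono fun x hx => (le_abs_self _).trans hx)
  have hnegle := hf.ae_le (-u) c hc (by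
    filter_upwards [hu, Lp.coeFn_neg u] with x hx hnx
    rw [hnx, Pi.neg_apply]
    exact (neg_le_abs _).trans hx)
  rw [hneg] at hnegle
  filter_upwards [hle, hnegle, Lp.coeFn_neg (spectralCalculus P f u)] with x hx hnx hcoe
  rw [hcoe, Pi.neg_apply] at hnx
  exact abs_le'.2 ⟨hx, hnx⟩

/-- This is the dual of `SubMarkovian.ae_abs_le`, tested with the sign of `f(L) u`. -/
theorem SubMarkovian.integral_abs_le [IsFiniteMeasure μ] (hf : SubMarkovian P m f)
    (hP : IsSpectralFamily P) (u : Lp ℝ 2 μ) :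
    ∫ x, |spectralCalculus P f u x| ∂μ ≤ m * ∫ x, |u x| ∂μ := by
  set v := spectralCalculus P f u
  let φ : X → ℝ := fun x => if 0 ≤ v x then 1 else -1
  have hφ_meas : Measurable φ :=
    Measurable.ite (measurableSet_le measurable_const (Lp.stronglyMeasurable v).measurable)
      measurable_const measurable_const
  have hφ_le : ∀ x, |φ x| ≤ 1 := fun x => by
    simp only [φ]
    split_ifs <;> simp
  have hφ : MemLp φ 2 μ :=
    MemLp.of_bound hφ_meas.aestronglyMeasurable 1 (Eventually.of_forall hφ_le)
  have hφ_sup : ∀ᵐ x ∂μ, |spectralCalculus P f (hφ.toLp _) x| ≤ m * 1 :=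
    hf.ae_abs_le hP zero_le_one (hφ.coeFn_toLp.mono fun x hx => hx ▸ hφ_le x)
  have hinner : ∫ x, |v x| ∂μ = inner ℝ v (hφ.toLp _) := by
    rw [inner_eq_integral]
    refine integral_congr_ae ?_
    filter_upwards [hφ.coeFn_toLp] with x hx
    rw [hx]
    simp only [φ]
    split_ifs with h
    · rw [abs_of_nonneg h, mul_one]
    · rw [abs_of_neg (not_le.1 h), mul_neg_one]
  rw [hinner, hP.inner_calculus_left hf.abs_le, inner_eq_integral, ← integral_const_mul]
  refine integral_mono_ae ((Lp.memLp u).integrable_mul (Lp.memLp _))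
    (((Lp.memLp u).integrable (by norm_num)).abs.const_mul m) ?_
  filter_upwards [hφ_sup] with x hx
  calc u x * spectralCalculus P f (hφ.toLp _) x
      ≤ |u x| * |spectralCalculus P f (hφ.toLp _) x| := (le_abs_self _).trans_eq (abs_mul _ _)
    _ ≤ |u x| * m := mul_le_mul_of_nonneg_left (hx.trans_eq (mul_one m)) (abs_nonneg _)
    _ = m * |u x| := mul_comm _ _

end SubMarkovianContraction

theorem le_two_mul_of_le_add_half {z : ℝ → ℝ} {T M b : ℝ} (hb : 0 ≤ b)
    (hM : ∀ t, 0 < t → t ≤ T → z t ≤ M)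
    (h : ∀ t, 0 < t → t ≤ T → z t ≤ b + z (t / 2) / 2) {t : ℝ} (ht : 0 < t) (htT : t ≤ T) :
    z t ≤ 2 * b := by
  have hiter : ∀ n : ℕ, ∀ t, 0 < t → t ≤ T → z t ≤ 2 * b + M * (1 / 2) ^ n := by
    intro n
    induction n with
    | zero =>
      intro t ht htT
      rw [pow_zero, mul_one]
      linarith [hM t ht htT]
    | succ n ih =>
      intro t ht htT
      rw [pow_succ]
      linarith [h t ht htT, ih (t / 2) (by linarith) (by linarith)]
  have hlim : Tendsto (fun n : ℕ => 2 * b + M * (1 / 2 : ℝ) ^ n) atTop (𝓝 (2 * b + M * 0)) :=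
    ((tendsto_pow_atTop_nhds_zero_of_lt_one (by norm_num) (by norm_num)).const_mul M).const_add _
  rw [mul_zero, add_zero] at hlim
  exact ge_of_tendsto' hlim fun n => hiter n t ht htT

theorem le_rpow_mul_exp {s c a : ℝ} (hs : 0 < s) (hc : 0 < c) (ha : 0 ≤ a) :
    a ≤ (s * c) ^ (-s⁻¹) * Real.exp (c * a ^ s) := by
  have hsc : 0 < s * c := by positivity
  have hexp : s * c * a ^ s ≤ Real.exp (s * c * a ^ s) := by
    linarith [Real.add_one_le_exp (s * c * a ^ s)]
  have hroot := Real.rpow_le_rpow (by positivity) hexp (inv_nonneg.2 hs.le)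
  rw [Real.mul_rpow hsc.le (by positivity), Real.rpow_rpow_inv ha hs.ne', ← Real.exp_mul] at hroot
  rw [Real.rpow_neg hsc.le, inv_mul_eq_div, le_div_iff₀ (by positivity), mul_comm]
  refine hroot.trans_eq ?_
  congr 1
  field_simp

theorem exists_pos_mul_le_one_and_sq_mul_le_half (a b : ℝ) :
    ∃ δ : ℝ, 0 < δ ∧ δ * a ≤ 1 ∧ δ ^ 2 * b ≤ 1 / 2 := by
  have hlin : Tendsto (fun δ : ℝ => δ * a) (𝓝[>] 0) (𝓝 0) := by
    simpa using ((by fun_prop : Continuous fun δ : ℝ => δ * a).tendsto 0).mono_left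
      nhdsWithin_le_nhds
  have hsq : Tendsto (fun δ : ℝ => δ ^ 2 * b) (𝓝[>] 0) (𝓝 0) := by
    simpa using ((by fun_prop : Continuous fun δ : ℝ => δ ^ 2 * b).tendsto 0).mono_left
      nhdsWithin_le_nhds
  obtain ⟨δ, hδlin, hδsq, hδ⟩ := ((hlin.eventually_le_const one_pos).and
    ((hsq.eventually_le_const one_half_pos).and self_mem_nhdsWithin)).exists
  exact ⟨δ, hδ, hδlin, hδsq⟩

section Semigroup

variable {bc : BoundaryCondition} {s d : ℝ}

theorem exists_gradient_sum (hΩ : IsBoundedRegularOpen Ω) (g : L2 Ω) (f : ℝ → ℝ) (F : Finset ℝ) :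
    ∃ G : L2Vec Ω, (∑ a ∈ F, f a • eigenprojection Ω bc a g, G) ∈ formDomain Ω bc ∧
      ‖G‖ ^ 2 = ∑ a ∈ F, f a ^ 2 * a * ‖eigenprojection Ω bc a g‖ ^ 2 := by
  have hP := isSpectralFamily_eigenprojection hΩ bc
  choose G hG hinner using fun a => eigenprojection_mem (Ω := Ω) bc a g
  have hmem : (∑ a ∈ F, f a • eigenprojection Ω bc a g, ∑ a ∈ F, f a • G a)
      ∈ formDomain Ω bc := by
    have hsum : ∑ a ∈ F, f a • (eigenprojection Ω bc a g, G a) ∈ formDomain Ω bc :=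
      Submodule.sum_mem _ fun a _ => Submodule.smul_mem _ _ (hG a)
    have hpair : ∑ a ∈ F, f a • (eigenprojection Ω bc a g, G a)
        = (∑ a ∈ F, f a • eigenprojection Ω bc a g, ∑ a ∈ F, f a • G a) :=
      Prod.ext Prod.fst_sum Prod.snd_sum
    rwa [hpair] at hsum
  refine ⟨_, hmem, ?_⟩
  rw [← real_inner_self_eq_norm_sq, sum_inner]
  refine Finset.sum_congr rfl fun a ha => ?_
  rw [real_inner_smul_left, hinner a _ hmem, inner_sum, Finset.sum_eq_single a]
  · rw [real_inner_smul_right, real_inner_self_eq_norm_sq]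
    ring
  · intro b _ hba
    rw [real_inner_smul_right, hP.symm, hP.orth a b g hba.symm, inner_zero_right, mul_zero]
  · exact fun h => absurd ha h

theorem sum_sq_mul_le_norm_calculus_sq (hΩ : IsBoundedRegularOpen Ω) {f h : ℝ → ℝ} {M q : ℝ}
    (hh : ∀ a, 0 ≤ a → |h a| ≤ M) (hq : 0 ≤ q)
    (hfh : ∀ a, 0 ≤ a → f a ^ 2 * a ≤ q * h a ^ 2) (g : L2 Ω) (F : Finset ℝ) :
    ∑ a ∈ F, f a ^ 2 * a * ‖eigenprojection Ω bc a g‖ ^ 2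
      ≤ q * ‖spectralCalculus (eigenprojection Ω bc) h g‖ ^ 2 := by
  have hP := isSpectralFamily_eigenprojection hΩ bc
  calc ∑ a ∈ F, f a ^ 2 * a * ‖eigenprojection Ω bc a g‖ ^ 2
      ≤ ∑ a ∈ F, q * (h a ^ 2 * ‖eigenprojection Ω bc a g‖ ^ 2) := by
        refine Finset.sum_le_sum fun a _ => ?_
        rcases lt_or_ge a 0 with ha | ha
        · simp [hP.neg a g ha]
        · rw [← mul_assoc]
          exact mul_le_mul_of_nonneg_right (hfh a ha) (sq_nonneg _)
    _ = q * ∑ a ∈ F, h a ^ 2 * ‖eigenprojection Ω bc a g‖ ^ 2 := (Finset.mul_sum _ _ _).symm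
    _ ≤ _ := mul_le_mul_of_nonneg_left
        (sum_le_hasSum F (fun a _ => by positivity) (hP.hasSum_norm_sq_calculus hh g)) hq

theorem exists_calculus_nash (hΩ : IsBoundedRegularOpen Ω) (bc : BoundaryCondition) :
    ∃ C : ℝ, 0 < C ∧ ∀ τ : ℝ, 0 < τ → τ ≤ 1 → ∀ (f h : ℝ → ℝ) (M M' q : ℝ),
      (∀ a, 0 ≤ a → |f a| ≤ M) → (∀ a, 0 ≤ a → |h a| ≤ M') → 0 ≤ q →
      (∀ a, 0 ≤ a → f a ^ 2 * a ≤ q * h a ^ 2) → ∀ g : L2 Ω,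
      ‖spectralCalculus (eigenprojection Ω bc) f g‖ ^ 2 ≤
        C * ((τ ^ N)⁻¹ * (∫ x in Ω, |spectralCalculus (eigenprojection Ω bc) f g x|) ^ 2
          + τ ^ 2 * (q * ‖spectralCalculus (eigenprojection Ω bc) h g‖ ^ 2)) := by
  have := hΩ.isFiniteMeasure
  obtain ⟨C, hC, hnash⟩ := hΩ.exists_nash
  refine ⟨C, hC, fun τ hτ hτ1 f h M M' q hf hh hq hfh g => ?_⟩
  have hpartial : ∀ F : Finset ℝ, ‖∑ a ∈ F, f a • eigenprojection Ω bc a g‖ ^ 2 ≤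
      C * ((τ ^ N)⁻¹ *
        (∫ x in Ω, |(∑ a ∈ F, f a • eigenprojection Ω bc a g : L2 Ω) x|) ^ 2
          + τ ^ 2 * (q * ‖spectralCalculus (eigenprojection Ω bc) h g‖ ^ 2)) := fun F => by
    obtain ⟨G, hG, hnorm⟩ := exists_gradient_sum (bc := bc) hΩ g f F
    have hG_le := hnorm.trans_le (sum_sq_mul_le_norm_calculus_sq hΩ hh hq hfh g F)
    refine (hnash τ hτ hτ1 _ (formDomain_le_sobolevH1 bc hG)).trans ?_
    gcongr
  have hsum := (isSpectralFamily_eigenprojection hΩ bc).hasSum_calculus hf g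
  have hint := (continuous_integral_abs.tendsto _).comp hsum
  exact le_of_tendsto_of_tendsto' (hsum.norm.pow 2)
    ((((hint.pow 2).const_mul _).add_const _).const_mul C) hpartial

theorem subMarkovian_semigroup (hΩ : IsBoundedRegularOpen Ω) (bc : BoundaryCondition)
    (hs0 : 0 < s) (hs1 : s ≤ 1) (hd : 0 ≤ d) {t : ℝ} (ht : 0 ≤ t) :
    SubMarkovian (eigenprojection Ω bc) 1 (fun a => Real.exp (-(t * (d * a ^ s)))) := by
  simpa only [mul_assoc] using
    SubMarkovian.exp_neg_rpow (isSpectralFamily_eigenprojection hΩ bc)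
      (fun r hr => subMarkovian_resolvent hΩ bc hr) hs0 hs1 (mul_nonneg ht hd)

section Contraction

variable (hΩ : IsBoundedRegularOpen Ω) (hs0 : 0 < s) (hs1 : s ≤ 1) (hd : 0 ≤ d)

include hΩ hs0 hs1 hd

theorem semigroupL2_add_right {t : ℝ} (ht : 0 ≤ t) (u v : L2 Ω) :
    semigroupL2 Ω bc s d t (u + v) = semigroupL2 Ω bc s d t u + semigroupL2 Ω bc s d t v :=
  (isSpectralFamily_eigenprojection hΩ bc).calculus_add_right
    (subMarkovian_semigroup hΩ bc hs0 hs1 hd ht).abs_le u v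

theorem inner_semigroupL2_left {t : ℝ} (ht : 0 ≤ t) (u v : L2 Ω) :
    inner ℝ (semigroupL2 Ω bc s d t u) v = inner ℝ u (semigroupL2 Ω bc s d t v) :=
  (isSpectralFamily_eigenprojection hΩ bc).inner_calculus_left
    (subMarkovian_semigroup hΩ bc hs0 hs1 hd ht).abs_le u v

theorem semigroupL2_add {t t' : ℝ} (ht : 0 ≤ t) (ht' : 0 ≤ t') (u : L2 Ω) :
    semigroupL2 Ω bc s d (t + t') u
      = semigroupL2 Ω bc s d t (semigroupL2 Ω bc s d t' u) := by
  have hexp : (fun a : ℝ => Real.exp (-((t + t') * (d * a ^ s))))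
      = fun a => Real.exp (-(t * (d * a ^ s))) * Real.exp (-(t' * (d * a ^ s))) := by
    funext a
    rw [← Real.exp_add]
    congr 1
    ring
  change spectralCalculus (eigenprojection Ω bc) (fun a => Real.exp (-((t + t') * (d * a ^ s)))) u
    = _
  rw [hexp]
  exact (isSpectralFamily_eigenprojection hΩ bc).calculus_mul
    (subMarkovian_semigroup hΩ bc hs0 hs1 hd ht).abs_le
    (subMarkovian_semigroup hΩ bc hs0 hs1 hd ht').abs_le u

theorem norm_semigroupL2_le {t : ℝ} (ht : 0 ≤ t) (u : L2 Ω) :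
    ‖semigroupL2 Ω bc s d t u‖ ≤ ‖u‖ :=
  ((isSpectralFamily_eigenprojection hΩ bc).norm_calculus_le
    (subMarkovian_semigroup hΩ bc hs0 hs1 hd ht).abs_le u).trans_eq (one_mul _)

theorem semigroupL2_ae_abs_le {t : ℝ} (ht : 0 ≤ t) {u : L2 Ω} {c : ℝ} (hc : 0 ≤ c)
    (hu : ∀ᵐ x ∂volume.restrict Ω, |u x| ≤ c) :
    ∀ᵐ x ∂volume.restrict Ω, |semigroupL2 Ω bc s d t u x| ≤ c :=
  ((subMarkovian_semigroup hΩ bc hs0 hs1 hd ht).ae_abs_le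
    (isSpectralFamily_eigenprojection hΩ bc) hc hu).mono fun _ hx => hx.trans_eq (one_mul c)

theorem integral_abs_semigroupL2_le {t : ℝ} (ht : 0 ≤ t) (u : L2 Ω) :
    ∫ x in Ω, |semigroupL2 Ω bc s d t u x| ≤ ∫ x in Ω, |u x| := by
  have := hΩ.isFiniteMeasure
  exact ((subMarkovian_semigroup hΩ bc hs0 hs1 hd ht).integral_abs_le
    (isSpectralFamily_eigenprojection hΩ bc) u).trans_eq (one_mul _)

end Contraction

theorem exp_neg_sq_mul_le (hs0 : 0 < s) (hd : 0 < d) {t a : ℝ} (ht : 0 < t) (ha : 0 ≤ a) :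
    Real.exp (-(t * (d * a ^ s))) ^ 2 * a
      ≤ (s * d) ^ (-s⁻¹) * t ^ (-s⁻¹) * Real.exp (-(t / 2 * (d * a ^ s))) ^ 2 := by
  have hle := le_rpow_mul_exp (c := d * t) hs0 (by positivity) ha
  rw [← mul_assoc s d t, Real.mul_rpow (by positivity) ht.le] at hle
  calc Real.exp (-(t * (d * a ^ s))) ^ 2 * a
      ≤ Real.exp (-(t * (d * a ^ s))) ^ 2 *
        ((s * d) ^ (-s⁻¹) * t ^ (-s⁻¹) * Real.exp (d * t * a ^ s)) := by gcongr
    _ = (s * d) ^ (-s⁻¹) * t ^ (-s⁻¹) * Real.exp (-(t / 2 * (d * a ^ s))) ^ 2 := by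
        rw [← Real.exp_nat_mul, ← Real.exp_nat_mul, mul_left_comm, ← Real.exp_add]
        congr 2
        push_cast
        ring

variable (hΩ : IsBoundedRegularOpen Ω) (hs0 : 0 < s) (hs1 : s ≤ 1) (hd : 0 < d)

include hΩ hs0 hs1 hd

theorem exists_semigroupL2_nash :
    ∃ C : ℝ, 0 < C ∧ ∀ t, 0 < t → ∀ τ, 0 < τ → τ ≤ 1 → ∀ g : L2 Ω,
      ‖semigroupL2 Ω bc s d t g‖ ^ 2 ≤ C * ((τ ^ N)⁻¹ * (∫ x in Ω, |g x|) ^ 2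
        + τ ^ 2 * t ^ (-s⁻¹) * ‖semigroupL2 Ω bc s d (t / 2) g‖ ^ 2) := by
  obtain ⟨C, hC, hnash⟩ := exists_calculus_nash hΩ bc
  set κ : ℝ := (s * d) ^ (-s⁻¹)
  have hκ : 0 < κ := by positivity
  refine ⟨C * (1 + κ), by positivity, fun t ht τ hτ hτ1 g => ?_⟩
  have hL2 := hnash τ hτ hτ1 _ _ 1 1 (κ * t ^ (-s⁻¹))
    (subMarkovian_semigroup hΩ bc hs0 hs1 hd.le ht.le).abs_le
    (subMarkovian_semigroup hΩ bc hs0 hs1 hd.le (half_pos ht).le).abs_le (by positivity)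
    (fun a ha => exp_neg_sq_mul_le hs0 hd ht ha) g
  have hL1 := integral_abs_semigroupL2_le (bc := bc) hΩ hs0 hs1 hd.le ht.le g
  calc ‖semigroupL2 Ω bc s d t g‖ ^ 2
      ≤ C * ((τ ^ N)⁻¹ * (∫ x in Ω, |semigroupL2 Ω bc s d t g x|) ^ 2
        + τ ^ 2 * (κ * t ^ (-s⁻¹) * ‖semigroupL2 Ω bc s d (t / 2) g‖ ^ 2)) := hL2
    _ ≤ C * ((1 + κ) * ((τ ^ N)⁻¹ * (∫ x in Ω, |g x|) ^ 2)
        + (1 + κ) * (τ ^ 2 * t ^ (-s⁻¹) * ‖semigroupL2 Ω bc s d (t / 2) g‖ ^ 2)) := by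
        gcongr C * (?_ + ?_)
        · calc (τ ^ N)⁻¹ * (∫ x in Ω, |semigroupL2 Ω bc s d t g x|) ^ 2
              ≤ 1 * ((τ ^ N)⁻¹ * (∫ x in Ω, |g x|) ^ 2) := by
                rw [one_mul]
                gcongr
            _ ≤ _ := by
                gcongr
                linarith
        · calc τ ^ 2 * (κ * t ^ (-s⁻¹) * ‖semigroupL2 Ω bc s d (t / 2) g‖ ^ 2)
              = κ * (τ ^ 2 * t ^ (-s⁻¹) * ‖semigroupL2 Ω bc s d (t / 2) g‖ ^ 2) := by ring
            _ ≤ _ := by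
                gcongr
                linarith
    _ = _ := by ring

/-- Nash's inequality at the scale `τ = δ t^(1/(2s))` bounds `t^(N/(2s)) ‖T_s(t) g‖²` by the square
of the `L^1` norm and half of the value at `t / 2`. -/
theorem exists_rpow_mul_norm_sq_semigroupL2_le (T : ℝ) :
    ∃ b : ℝ, 0 < b ∧ ∀ t, 0 < t → t ≤ T → ∀ g : L2 Ω,
      t ^ (N / (2 * s)) * ‖semigroupL2 Ω bc s d t g‖ ^ 2 ≤ b * (∫ x in Ω, |g x|) ^ 2
        + (t / 2) ^ (N / (2 * s)) * ‖semigroupL2 Ω bc s d (t / 2) g‖ ^ 2 / 2 := by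
  obtain ⟨C, hC, hnash⟩ := exists_semigroupL2_nash (bc := bc) hΩ hs0 hs1 hd
  set β : ℝ := N / (2 * s) with hβ
  obtain ⟨δ, hδ, hδT, hδC⟩ :=
    exists_pos_mul_le_one_and_sq_mul_le_half (T ^ (1 / (2 * s))) (C * 2 ^ β)
  refine ⟨C * (δ ^ N)⁻¹, by positivity, fun t ht htT g => ?_⟩
  set τ := δ * t ^ (1 / (2 * s)) with hτ
  have hτ0 : 0 < τ := by positivity
  have hτ1 : τ ≤ 1 :=
    (mul_le_mul_of_nonneg_left (Real.rpow_le_rpow ht.le htT (by positivity)) hδ.le).trans hδT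
  have hτN : τ ^ N = δ ^ N * t ^ β := by
    rw [hτ, mul_pow, ← Real.rpow_natCast (t ^ (1 / (2 * s))), ← Real.rpow_mul ht.le, hβ]
    congr 2
    field_simp
  have hτ2 : τ ^ 2 * t ^ (-s⁻¹) = δ ^ 2 := by
    have hexp : 1 / (2 * s) * (2 : ℕ) + -s⁻¹ = 0 := by
      push_cast
      field_simp
      norm_num
    rw [hτ, mul_pow, ← Real.rpow_natCast (t ^ (1 / (2 * s))), ← Real.rpow_mul ht.le, mul_assoc,
      ← Real.rpow_add ht, hexp, Real.rpow_zero, mul_one]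
  have htβ : t ^ β = 2 ^ β * (t / 2) ^ β := by
    rw [← Real.mul_rpow (by norm_num) (by positivity), mul_div_cancel₀ _ two_ne_zero]
  set A := ∫ x in Ω, |g x|
  set y := ‖semigroupL2 Ω bc s d (t / 2) g‖ ^ 2
  have hy : 0 ≤ y := by positivity
  calc t ^ β * ‖semigroupL2 Ω bc s d t g‖ ^ 2
      ≤ t ^ β * (C * ((τ ^ N)⁻¹ * A ^ 2 + τ ^ 2 * t ^ (-s⁻¹) * y)) := by
        gcongr
        exact hnash t ht τ hτ0 hτ1 g
    _ = C * (δ ^ N)⁻¹ * A ^ 2 + δ ^ 2 * C * (t ^ β * y) := by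
        rw [hτN, hτ2]
        field_simp
    _ = C * (δ ^ N)⁻¹ * A ^ 2 + δ ^ 2 * (C * 2 ^ β) * ((t / 2) ^ β * y) := by
        rw [htβ]
        ring
    _ ≤ C * (δ ^ N)⁻¹ * A ^ 2 + 1 / 2 * ((t / 2) ^ β * y) := by gcongr
    _ = _ := by ring

theorem exists_norm_sq_semigroupL2_le (T : ℝ) :
    ∃ K : ℝ, 0 < K ∧ ∀ t, 0 < t → t ≤ T → ∀ g : L2 Ω,
      ‖semigroupL2 Ω bc s d t g‖ ^ 2 ≤ K * t ^ (-(N / (2 * s))) * (∫ x in Ω, |g x|) ^ 2 := by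
  obtain ⟨b, hb, hhalf⟩ := exists_rpow_mul_norm_sq_semigroupL2_le (bc := bc) hΩ hs0 hs1 hd T
  refine ⟨2 * b, by positivity, fun t ht htT g => ?_⟩
  have hbound : ∀ t, 0 < t → t ≤ T →
      t ^ (N / (2 * s)) * ‖semigroupL2 Ω bc s d t g‖ ^ 2 ≤ T ^ (N / (2 * s)) * ‖g‖ ^ 2 :=
    fun t ht htT => by
      have hT : 0 < T := ht.trans_le htT
      have hnorm := norm_semigroupL2_le (bc := bc) hΩ hs0 hs1 hd.le ht.le g
      gcongr
  have hle := le_two_mul_of_le_add_half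
    (z := fun t => t ^ (N / (2 * s)) * ‖semigroupL2 Ω bc s d t g‖ ^ 2) (by positivity) hbound
    (fun t ht htT => hhalf t ht htT g) ht htT
  rw [Real.rpow_neg ht.le, mul_right_comm, ← div_eq_mul_inv, le_div_iff₀ (by positivity)]
  linarith

/-- As `T_s(t / 2)` is symmetric, its bound from `L^1` to `L^2` is also one from `L^2` to `L^∞`. -/
theorem exists_semigroupL2_ae_abs_le_integral (T : ℝ) :
    ∃ K : ℝ, 0 < K ∧ ∀ t, 0 < t → t ≤ T → ∀ g : L2 Ω, ∀ᵐ x ∂volume.restrict Ω,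
      |semigroupL2 Ω bc s d t g x| ≤ K * t ^ (-(N / (2 * s))) * ∫ y in Ω, |g y| := by
  have := hΩ.isFiniteMeasure
  obtain ⟨K, hK, hL2⟩ := exists_norm_sq_semigroupL2_le (bc := bc) hΩ hs0 hs1 hd T
  set β : ℝ := N / (2 * s)
  refine ⟨K * 2 ^ β, by positivity, fun t ht htT g => ae_abs_le_of_forall_inner_le fun φ => ?_⟩
  have hhalf : K * (t / 2) ^ (-β) = K * 2 ^ β * t ^ (-β) := by
    rw [Real.div_rpow ht.le two_pos.le, Real.rpow_neg two_pos.le, div_inv_eq_mul]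
    ring
  set k := K * 2 ^ β * t ^ (-β)
  have hk : 0 ≤ k := by positivity
  have hsq : ∀ u : L2 Ω, ‖semigroupL2 Ω bc s d (t / 2) u‖ ^ 2 ≤ k * (∫ y in Ω, |u y|) ^ 2 :=
    fun u => hhalf ▸ hL2 (t / 2) (half_pos ht) (by linarith) u
  have hnonneg : ∀ u : L2 Ω, 0 ≤ ∫ y in Ω, |u y| := fun u => integral_nonneg fun _ => abs_nonneg _
  have hsplit : semigroupL2 Ω bc s d t g
      = semigroupL2 Ω bc s d (t / 2) (semigroupL2 Ω bc s d (t / 2) g) := by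
    rw [← semigroupL2_add hΩ hs0 hs1 hd.le (half_pos ht).le (half_pos ht).le, add_halves]
  rw [hsplit, inner_semigroupL2_left hΩ hs0 hs1 hd.le (half_pos ht).le]
  refine (real_inner_le_norm _ _).trans (abs_le_of_sq_le_sq' ?_ ?_).2
  · calc (‖semigroupL2 Ω bc s d (t / 2) g‖ * ‖semigroupL2 Ω bc s d (t / 2) φ‖) ^ 2
        = ‖semigroupL2 Ω bc s d (t / 2) g‖ ^ 2 * ‖semigroupL2 Ω bc s d (t / 2) φ‖ ^ 2 :=
          mul_pow _ _ _
      _ ≤ (k * (∫ y in Ω, |g y|) ^ 2) * (k * (∫ y in Ω, |φ y|) ^ 2) :=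
          mul_le_mul (hsq g) (hsq φ) (sq_nonneg _) (mul_nonneg hk (sq_nonneg _))
      _ = _ := by ring
  · exact mul_nonneg (mul_nonneg hk (hnonneg g)) (hnonneg φ)

theorem exists_semigroupL2_ae_abs_le (T : ℝ) {p : ℝ≥0∞} (hp1 : 1 ≤ p) (hp : p ≠ ∞) :
    ∃ K : ℝ, 0 < K ∧ ∀ t, 0 < t → t ≤ T → ∀ g : L2 Ω, MemLp g p (volume.restrict Ω) →
      ∀ᵐ x ∂volume.restrict Ω, |semigroupL2 Ω bc s d t g x| ≤
        K * t ^ (-(N / (2 * s * p.toReal))) * (eLpNorm g p (volume.restrict Ω)).toReal := by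
  have := hΩ.isFiniteMeasure
  have hp0 : p ≠ 0 := (zero_lt_one.trans_le hp1).ne'
  have hp1' : 1 ≤ p.toReal := by simpa using ENNReal.toReal_mono hp hp1
  obtain ⟨K, hK, hint⟩ := exists_semigroupL2_ae_abs_le_integral (bc := bc) hΩ hs0 hs1 hd T
  refine ⟨2 * K ^ p.toReal⁻¹, by positivity, fun t ht htT g hg => ?_⟩
  have hle := ae_abs_le_of_ae_abs_le_integral
    (semigroupL2_add_right (bc := bc) hΩ hs0 hs1 hd.le ht.le)
    (fun u c hc hu => semigroupL2_ae_abs_le hΩ hs0 hs1 hd.le ht.le hc hu)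
    (by positivity) (hint t ht htT) hp1' (hg.integrable_norm_rpow hp0 hp)
  have hexp : -(N / (2 * s)) * p.toReal⁻¹ = -(N / (2 * s * p.toReal)) := by field_simp
  rw [toReal_eLpNorm hg.aestronglyMeasurable,
    lpNorm_eq_integral_norm_rpow_toReal hp0 hp hg.aestronglyMeasurable]
  rwa [Real.mul_rpow (by positivity) (integral_nonneg fun _ => by positivity),
    Real.mul_rpow hK.le (by positivity), ← Real.rpow_mul ht.le, hexp, ← mul_assoc,
    ← mul_assoc] at hle

end Semigroup

section LpBounds

variable {X : Type*} [MeasurableSpace X] {μ : Measure X} {p : ℝ≥0∞}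

theorem toLpOrZero_of_memLp {f : X → ℝ} (hf : MemLp f p μ) : toLpOrZero p μ f = hf.toLp f :=
  dif_pos hf

theorem coeFn_toLpOrZero {f : X → ℝ} (hf : MemLp f p μ) : toLpOrZero p μ f =ᵐ[μ] f := by
  rw [toLpOrZero_of_memLp hf]
  exact hf.coeFn_toLp

theorem isOrderedModule_Lp : IsOrderedModule ℝ (Lp ℝ p μ) :=
  .of_smul_nonneg fun c hc f hf => by
    rw [← Lp.coeFn_nonneg] at hf ⊢
    filter_upwards [hf, Lp.coeFn_smul c f] with x hfx hsmul
    rw [hsmul]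
    exact mul_nonneg hc hfx

variable [IsFiniteMeasure μ]

variable (μ p) in
/-- The constant function `1` in `L^p`. A bound `|v| ≤ c` almost everywhere is the inequality
`|v| ≤ c • oneLp μ p` in the ordered space `L^p`, where it passes to limits and to integrals. -/
def oneLp : Lp ℝ p μ := (memLp_const (1 : ℝ)).toLp _

theorem abs_le_smul_oneLp_iff {v : Lp ℝ p μ} {c : ℝ} :
    |v| ≤ c • oneLp μ p ↔ ∀ᵐ x ∂μ, |v x| ≤ c := by
  have hone : c • oneLp μ p =ᵐ[μ] fun _ => c := by
    filter_upwards [Lp.coeFn_smul c (oneLp μ p), (memLp_const (1 : ℝ)).coeFn_toLp] with x hc h1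
    rw [hc, Pi.smul_apply, oneLp, h1, smul_eq_mul, mul_one]
  rw [← Lp.coeFn_le]
  exact eventually_congr <| by
    filter_upwards [Lp.coeFn_abs v, hone] with x habs hc
    rw [habs, hc]

theorem abs_integral_le_smul_oneLp [Fact (1 ≤ p)] {α : Type*} [MeasurableSpace α] {ν : Measure α}
    {F : α → Lp ℝ p μ} {φ : α → ℝ} (hφ : Integrable φ ν) (hφ0 : ∀ᵐ t ∂ν, 0 ≤ φ t)
    (h : ∀ᵐ t ∂ν, |F t| ≤ φ t • oneLp μ p) :
    |∫ t, F t ∂ν| ≤ (∫ t, φ t ∂ν) • oneLp μ p := by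
  have := isOrderedModule_Lp (μ := μ) (p := p)
  by_cases hF : Integrable F ν
  · rw [← integral_smul_const]
    refine abs_le'.2 ⟨integral_mono_ae hF (hφ.smul_const _) ?_, ?_⟩
    · filter_upwards [h] with t ht
      exact (le_abs_self _).trans ht
    · rw [← integral_neg]
      refine integral_mono_ae hF.neg (hφ.smul_const _) ?_
      filter_upwards [h] with t ht
      exact (neg_le_abs _).trans ht
  · rw [integral_undef hF, abs_zero]
    refine smul_nonneg (integral_nonneg_of_ae hφ0) ((Lp.coeFn_nonneg _).1 ?_)
    filter_upwards [(memLp_const (1 : ℝ)).coeFn_toLp (μ := μ) (p := p)] with x hx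
    rw [oneLp, hx]
    exact zero_le_one

theorem denseRange_memLp_two [Fact (1 ≤ p)] (hp : p ≠ ∞) :
    DenseRange (Subtype.val : {g : Lp ℝ p μ // MemLp g 2 μ} → Lp ℝ p μ) := by
  rw [denseRange_subtype_val]
  refine (Lp.simpleFunc.dense (E := ℝ) (μ := μ) hp).mono fun f hf => ?_
  exact (SimpleFunc.memLp_of_isFiniteMeasure (Lp.simpleFunc.toSimpleFunc ⟨f, hf⟩) 2 μ).ae_eq
    (Lp.simpleFunc.toSimpleFunc_eq_toFun ⟨f, hf⟩)

theorem neBot_comap_val_nhds [Fact (1 ≤ p)] (hp : p ≠ ∞) (f : Lp ℝ p μ) :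
    (comap (Subtype.val : {g : Lp ℝ p μ // MemLp g 2 μ} → _) (𝓝 f)).NeBot :=
  mem_closure_iff_comap_neBot.1 (denseRange_subtype_val.1 (denseRange_memLp_two hp) f)

end LpBounds

section Extension

variable {X : Type*} [MeasurableSpace X] {μ : Measure X} {p : ℝ≥0∞}

/-- The restriction to `L^2 ∩ L^p`, with values in `L^p`, of an operator on `L^2`. The value is `0`
at those `g` whose image is not in `L^p`. -/
def restrictLp (S : Lp ℝ 2 μ → Lp ℝ 2 μ) (g : {g : Lp ℝ p μ // MemLp g 2 μ}) : Lp ℝ p μ :=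
  toLpOrZero p μ (S (toLpOrZero 2 μ g.1))

/-- The extension by continuity to `L^p` of the restriction to `L^2 ∩ L^p` of an operator on `L^2`,
of which `semigroupLp` is the case of `semigroupL2`. -/
def extendLp [Fact (1 ≤ p)] (S : Lp ℝ 2 μ → Lp ℝ 2 μ) (f : Lp ℝ p μ) : Lp ℝ p μ :=
  limUnder (comap (Subtype.val : {g : Lp ℝ p μ // MemLp g 2 μ} → _) (𝓝 f)) (restrictLp S)

theorem toLpOrZero_sub_coeFn {g g' : Lp ℝ p μ} (hg : MemLp g 2 μ) (hg' : MemLp g' 2 μ) :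
    toLpOrZero 2 μ g = toLpOrZero 2 μ (g - g' : Lp ℝ p μ) + toLpOrZero 2 μ g' := by
  have hsub : MemLp (g - g' : Lp ℝ p μ) 2 μ := (hg.sub hg').ae_eq (Lp.coeFn_sub g g').symm
  rw [toLpOrZero_of_memLp hg, toLpOrZero_of_memLp hg', toLpOrZero_of_memLp hsub, ← MemLp.toLp_add]
  refine MemLp.toLp_congr _ _ ?_
  filter_upwards [Lp.coeFn_sub g g'] with x hx
  rw [Pi.add_apply, hx, Pi.sub_apply, sub_add_cancel]

variable {S : Lp ℝ 2 μ → Lp ℝ 2 μ} {k : ℝ}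
  (hbd : ∀ u : Lp ℝ 2 μ, MemLp u p μ → ∀ᵐ x ∂μ, |S u x| ≤ k * (eLpNorm u p μ).toReal)

include hbd

theorem ae_abs_le_norm_of_memLp (g : {g : Lp ℝ p μ // MemLp g 2 μ}) :
    ∀ᵐ x ∂μ, |S (toLpOrZero 2 μ g.1) x| ≤ k * ‖g.1‖ := by
  have heq := coeFn_toLpOrZero g.2
  have hle := hbd (toLpOrZero 2 μ g.1) ((Lp.memLp g.1).ae_eq heq.symm)
  rwa [eLpNorm_congr_ae heq, ← Lp.norm_def] at hle

variable [IsFiniteMeasure μ]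

theorem coeFn_restrictLp (g : {g : Lp ℝ p μ // MemLp g 2 μ}) :
    restrictLp S g =ᵐ[μ] S (toLpOrZero 2 μ g.1) :=
  coeFn_toLpOrZero (MemLp.of_bound (Lp.aestronglyMeasurable _) _ (ae_abs_le_norm_of_memLp hbd g))

theorem restrictLp_ae_abs_le (g : {g : Lp ℝ p μ // MemLp g 2 μ}) :
    ∀ᵐ x ∂μ, |restrictLp S g x| ≤ k * ‖g.1‖ := by
  filter_upwards [coeFn_restrictLp hbd g, ae_abs_le_norm_of_memLp hbd g] with x heq hle
  rwa [heq]

variable (hadd : ∀ u v, S (u + v) = S u + S v)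

include hadd

theorem restrictLp_sub (g g' : {g : Lp ℝ p μ // MemLp g 2 μ}) :
    restrictLp S g - restrictLp S g'
      = restrictLp S ⟨g.1 - g'.1, (g.2.sub g'.2).ae_eq (Lp.coeFn_sub _ _).symm⟩ := by
  set g'' : {g : Lp ℝ p μ // MemLp g 2 μ} :=
    ⟨g.1 - g'.1, (g.2.sub g'.2).ae_eq (Lp.coeFn_sub _ _).symm⟩
  have hg : restrictLp S g
      =ᵐ[μ] (S (toLpOrZero 2 μ g''.1) + S (toLpOrZero 2 μ g'.1) : Lp ℝ 2 μ) := by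
    rw [← hadd, ← toLpOrZero_sub_coeFn g.2 g'.2]
    exact coeFn_restrictLp hbd g
  refine Lp.ext ?_
  filter_upwards [Lp.coeFn_sub (restrictLp S g) (restrictLp S g'), hg, coeFn_restrictLp hbd g',
    coeFn_restrictLp hbd g'', Lp.coeFn_add (S (toLpOrZero 2 μ g''.1)) (S (toLpOrZero 2 μ g'.1))]
    with x hsub hgx hgx' hgx'' hsum
  rw [hsub, Pi.sub_apply, hgx, hgx', hgx'', hsum, Pi.add_apply, add_sub_cancel_right]

variable [Fact (1 ≤ p)]

theorem lipschitzWith_restrictLp (hk : 0 ≤ k) :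
    LipschitzWith ((measureUnivNNReal μ : ℝ) ^ p.toReal⁻¹ * k).toNNReal
      (restrictLp (p := p) S) := by
  refine LipschitzWith.of_dist_le_mul fun g g' => ?_
  rw [dist_eq_norm, restrictLp_sub hbd hadd, Real.coe_toNNReal _ (by positivity), Subtype.dist_eq,
    dist_eq_norm, mul_assoc]
  exact Lp.norm_le_of_ae_bound (by positivity) (restrictLp_ae_abs_le hbd _)

theorem tendsto_restrictLp (hp : p ≠ ∞) (hk : 0 ≤ k) (f : Lp ℝ p μ) :
    Tendsto (restrictLp S) (comap Subtype.val (𝓝 f)) (𝓝 (extendLp S f)) :=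
  tendsto_nhds_limUnder (uniformly_extend_exists (isUniformInducing_val _)
    (denseRange_memLp_two hp) (lipschitzWith_restrictLp hbd hadd hk).uniformContinuous f)

theorem extendLp_ae_abs_le (hp : p ≠ ∞) (hk : 0 ≤ k) (f : Lp ℝ p μ) :
    ∀ᵐ x ∂μ, |extendLp S f x| ≤ k * ‖f‖ := by
  have := neBot_comap_val_nhds hp f
  have habs : Continuous fun v : Lp ℝ p μ => |v| := continuous_id.sup continuous_neg
  have hbound : Tendsto (fun g : {g : Lp ℝ p μ // MemLp g 2 μ} => (k * ‖g.1‖) • oneLp μ p)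
      (comap Subtype.val (𝓝 f)) (𝓝 ((k * ‖f‖) • oneLp μ p)) :=
    (tendsto_comap.norm.const_mul k).smul_const _
  rw [← abs_le_smul_oneLp_iff]
  exact le_of_tendsto_of_tendsto' ((habs.tendsto _).comp (tendsto_restrictLp hbd hadd hp hk f))
    hbound fun g => abs_le_smul_oneLp_iff.2 (restrictLp_ae_abs_le hbd g)

theorem extendLp_ae_eq (hp : p ≠ ∞) (hk : 0 ≤ k) {f : Lp ℝ p μ} (hf : MemLp f 2 μ) :
    extendLp S f =ᵐ[μ] S (toLpOrZero 2 μ f) := by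
  have := neBot_comap_val_nhds hp f
  have hcont := (lipschitzWith_restrictLp hbd hadd hk).continuous.tendsto ⟨f, hf⟩
  rw [nhds_subtype_eq_comap] at hcont
  rw [tendsto_nhds_unique (tendsto_restrictLp hbd hadd hp hk f) hcont]
  exact coeFn_restrictLp hbd ⟨f, hf⟩

end Extension

section SemigroupLp

variable {bc : BoundaryCondition} {s d : ℝ} {p : ℝ≥0∞} [Fact (1 ≤ p)]

variable (hΩ : IsBoundedRegularOpen Ω) (hs0 : 0 < s) (hs1 : s ≤ 1) (hd : 0 < d)

include hΩ hs0 hs1 hd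

theorem exists_semigroupLp_ae_abs_le (T : ℝ) (hp : p ≠ ∞) :
    ∃ K : ℝ, 0 < K ∧ ∀ t, 0 < t → t ≤ T → ∀ f : Lp ℝ p (volume.restrict Ω),
      ∀ᵐ x ∂volume.restrict Ω,
        |semigroupLp Ω bc s d p t f x| ≤ K * t ^ (-(N / (2 * s * p.toReal))) * ‖f‖ := by
  have := hΩ.isFiniteMeasure
  obtain ⟨K, hK, hL2⟩ :=
    exists_semigroupL2_ae_abs_le (bc := bc) hΩ hs0 hs1 hd T (Fact.out : 1 ≤ p) hp
  exact ⟨K, hK, fun t ht htT f => extendLp_ae_abs_le (hL2 t ht htT)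
    (semigroupL2_add_right hΩ hs0 hs1 hd.le ht.le) hp (by positivity) f⟩

theorem semigroupLp_ae_abs_le (hp : p ≠ ∞) {t : ℝ} (ht : 0 < t) {f : Lp ℝ p (volume.restrict Ω)}
    {c : ℝ} (hc : 0 ≤ c) (hf : ∀ᵐ x ∂volume.restrict Ω, |f x| ≤ c) :
    ∀ᵐ x ∂volume.restrict Ω, |semigroupLp Ω bc s d p t f x| ≤ c := by
  have := hΩ.isFiniteMeasure
  have hf2 : MemLp f 2 (volume.restrict Ω) := MemLp.of_bound (Lp.aestronglyMeasurable _) c hf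
  obtain ⟨K, hK, hL2⟩ :=
    exists_semigroupL2_ae_abs_le (bc := bc) hΩ hs0 hs1 hd t (Fact.out : 1 ≤ p) hp
  have heq : semigroupLp Ω bc s d p t f
      =ᵐ[volume.restrict Ω] semigroupL2 Ω bc s d t (toLpOrZero 2 (volume.restrict Ω) f) :=
    extendLp_ae_eq (hL2 t ht le_rfl) (semigroupL2_add_right hΩ hs0 hs1 hd.le ht.le) hp
      (by positivity) hf2
  have hf2_le : ∀ᵐ x ∂volume.restrict Ω, |toLpOrZero 2 (volume.restrict Ω) f x| ≤ c := by
    filter_upwards [coeFn_toLpOrZero hf2, hf] with x hx hfx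
    rwa [hx]
  filter_upwards [heq, semigroupL2_ae_abs_le (bc := bc) hΩ hs0 hs1 hd.le ht.le hc hf2_le]
    with x hx hle
  rwa [hx]

end SemigroupLp

section Convolution

theorem integrableOn_sub_rpow {r t : ℝ} (hr : r < 1) (ht : 0 ≤ t) :
    IntegrableOn (fun τ => (t - τ) ^ (-r)) (Ioo 0 t) := by
  have hint := (intervalIntegral.intervalIntegrable_rpow' (a := 0) (b := t) (r := -r)
    (by linarith)).comp_sub_left t
  rw [sub_zero, sub_self] at hint
  exact (intervalIntegrable_iff_integrableOn_Ioo_of_le ht).1 hint.symm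

theorem integral_sub_rpow {r t : ℝ} (hr : r < 1) (ht : 0 ≤ t) :
    ∫ τ in Ioo 0 t, (t - τ) ^ (-r) = t ^ (1 - r) / (1 - r) := by
  rw [← integral_Ioc_eq_integral_Ioo, ← intervalIntegral.integral_of_le ht,
    intervalIntegral.integral_comp_sub_left (fun x => x ^ (-r)) t, sub_self, sub_zero,
    integral_rpow (Or.inl (by linarith)), Real.zero_rpow (by linarith), sub_zero,
    show -r + 1 = 1 - r by ring]

theorem memLp_sub_rpow {γ q t : ℝ} (hq : 0 < q) (hγq : γ * q < 1) (ht : 0 ≤ t) :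
    MemLp (fun τ => (t - τ) ^ (-γ)) (ENNReal.ofReal q) (volume.restrict (Ioo 0 t)) := by
  have hmeas : AEStronglyMeasurable (fun τ => (t - τ) ^ (-γ)) (volume.restrict (Ioo 0 t)) :=
    ((measurable_const.sub measurable_id).pow_const _).aestronglyMeasurable
  rw [← integrable_norm_rpow_iff hmeas (by simpa using hq) ENNReal.ofReal_ne_top,
    ENNReal.toReal_ofReal hq.le]
  refine (integrableOn_sub_rpow hγq ht).congr_fun (fun τ hτ => ?_) measurableSet_Ioo
  have hτt : 0 ≤ t - τ := by linarith [hτ.2]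
  simp only [Real.norm_of_nonneg (Real.rpow_nonneg hτt _)]
  rw [← Real.rpow_mul hτt, neg_mul]

theorem memLp_rpow_inv {X : Type*} [MeasurableSpace X] {μ : Measure X} {m : X → ℝ} {p : ℝ}
    (hp : 0 < p) (hm0 : ∀ x, 0 ≤ m x) (hm : Integrable m μ) :
    MemLp (fun x => m x ^ p⁻¹) (ENNReal.ofReal p) μ := by
  have hmeas : AEStronglyMeasurable (fun x => m x ^ p⁻¹) μ :=
    (hm.aestronglyMeasurable.aemeasurable.pow_const _).aestronglyMeasurable
  rw [← integrable_norm_rpow_iff hmeas (by simpa using hp) ENNReal.ofReal_ne_top,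
    ENNReal.toReal_ofReal hp.le]
  refine hm.congr (Eventually.of_forall fun x => ?_)
  simp only [Real.norm_of_nonneg (Real.rpow_nonneg (hm0 x) _)]
  exact (Real.rpow_inv_rpow (hm0 x) hp.ne').symm

variable {p q γ t T : ℝ} {m : ℝ → ℝ}

theorem integrableOn_sub_rpow_mul (hpq : p.HolderConjugate q) (hγq : γ * q < 1) (ht : 0 ≤ t)
    (hm0 : ∀ τ, 0 ≤ m τ) (hm : IntegrableOn m (Ioo 0 t)) :
    IntegrableOn (fun τ => (t - τ) ^ (-γ) * m τ ^ p⁻¹) (Ioo 0 t) :=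
  have := hpq.symm.ennrealOfReal
  (memLp_sub_rpow hpq.symm.pos hγq ht).integrable_mul (memLp_rpow_inv hpq.pos hm0 hm)

theorem integral_sub_rpow_mul_le (hpq : p.HolderConjugate q) (hγq : γ * q < 1) (ht : 0 ≤ t)
    (htT : t ≤ T) (hm0 : ∀ τ, 0 ≤ m τ) (hm : IntegrableOn m (Ioo 0 T)) :
    ∫ τ in Ioo 0 t, (t - τ) ^ (-γ) * m τ ^ p⁻¹ ≤
      (T ^ (1 - γ * q) / (1 - γ * q)) ^ (1 / q) * (∫ τ in Ioo 0 T, m τ) ^ p⁻¹ := by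
  have hp := hpq.pos
  have hq := hpq.symm.pos
  have hγq' : 0 < 1 - γ * q := by linarith
  have hsub : Ioo 0 t ⊆ Ioo 0 T := Ioo_subset_Ioo_right htT
  have hpow : ∀ τ ∈ Ioo 0 t, ((t - τ) ^ (-γ)) ^ q = (t - τ) ^ (-(γ * q)) := fun τ hτ => by
    rw [← Real.rpow_mul (by linarith [hτ.2]), neg_mul]
  calc ∫ τ in Ioo 0 t, (t - τ) ^ (-γ) * m τ ^ p⁻¹
      ≤ (∫ τ in Ioo 0 t, ((t - τ) ^ (-γ)) ^ q) ^ (1 / q)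
          * (∫ τ in Ioo 0 t, (m τ ^ p⁻¹) ^ p) ^ (1 / p) :=
        integral_mul_le_Lp_mul_Lq_of_nonneg hpq.symm
          ((ae_restrict_mem measurableSet_Ioo).mono fun τ hτ =>
            Real.rpow_nonneg (by linarith [hτ.2]) _)
          (Eventually.of_forall fun τ => Real.rpow_nonneg (hm0 τ) _)
          (memLp_sub_rpow hq hγq ht) (memLp_rpow_inv hp hm0 (hm.mono_set hsub))
    _ = (t ^ (1 - γ * q) / (1 - γ * q)) ^ (1 / q) * (∫ τ in Ioo 0 t, m τ) ^ p⁻¹ := by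
        rw [setIntegral_congr_fun measurableSet_Ioo hpow, integral_sub_rpow hγq ht, one_div p]
        simp only [Real.rpow_inv_rpow (hm0 _) hp.ne']
    _ ≤ _ := by
        have hmono : ∫ τ in Ioo 0 t, m τ ≤ ∫ τ in Ioo 0 T, m τ :=
          setIntegral_mono_set hm (Eventually.of_forall hm0) hsub.eventuallyLE
        have hnonneg : 0 ≤ ∫ τ in Ioo 0 t, m τ := integral_nonneg hm0
        have hT : 0 ≤ T := ht.trans htT
        gcongr

end Convolution

section Cylinder

variable {T : ℝ} {p : ℝ≥0∞} {h : ℝ × Space N → ℝ}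

theorem volume_restrict_cylinder : volume.restrict (cylinder Ω T)
    = (volume.restrict (Ioo 0 T)).prod (volume.restrict Ω) := by
  rw [Measure.prod_restrict, ← Measure.volume_eq_prod]
  rfl

theorem eLpNorm_top_cylinder_le {w : ℝ × Space N → ℝ}
    (hw : AEStronglyMeasurable w (volume.restrict (cylinder Ω T))) {c : ℝ}
    (hbound : ∀ t ∈ Ioo 0 T, ∀ᵐ x ∂volume.restrict Ω, |w (t, x)| ≤ c) :
    eLpNorm w ∞ (volume.restrict (cylinder Ω T)) ≤ ENNReal.ofReal c := by
  rw [eLpNorm_exponent_top]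
  refine eLpNormEssSup_le_of_ae_bound ?_
  rw [volume_restrict_cylinder] at hw ⊢
  have hmeas : MeasurableSet {z | ‖hw.mk w z‖ ≤ c} :=
    measurableSet_le hw.stronglyMeasurable_mk.measurable.norm measurable_const
  have hmk : ∀ᵐ z ∂(volume.restrict (Ioo 0 T)).prod (volume.restrict Ω), ‖hw.mk w z‖ ≤ c := by
    rw [Measure.ae_prod_iff_ae_ae hmeas]
    filter_upwards [Measure.ae_ae_of_ae_prod hw.ae_eq_mk,
      ae_restrict_mem measurableSet_Ioo] with t heq ht
    filter_upwards [heq, hbound t ht] with x hx hle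
    rwa [← hx]
  filter_upwards [hmk, hw.ae_eq_mk] with z hle hz
  rwa [hz]

theorem integrable_norm_rpow_cylinder (hp0 : p ≠ 0) (hp : p ≠ ∞)
    (hh : MemLp h p (volume.restrict (cylinder Ω T))) :
    Integrable (fun z => ‖h z‖ ^ p.toReal)
      ((volume.restrict (Ioo 0 T)).prod (volume.restrict Ω)) := by
  rw [← volume_restrict_cylinder]
  exact hh.integrable_norm_rpow hp0 hp

theorem integral_integral_rpow_eq_eLpNorm (hp0 : p ≠ 0) (hp : p ≠ ∞)
    (hh : MemLp h p (volume.restrict (cylinder Ω T))) :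
    (∫ τ in Ioo 0 T, ∫ x in Ω, ‖h (τ, x)‖ ^ p.toReal) ^ p.toReal⁻¹
      = (eLpNorm h p (volume.restrict (cylinder Ω T))).toReal := by
  rw [toReal_eLpNorm hh.aestronglyMeasurable,
    lpNorm_eq_integral_norm_rpow_toReal hp0 hp hh.aestronglyMeasurable, volume_restrict_cylinder,
    integral_prod _ (integrable_norm_rpow_cylinder hp0 hp hh)]

theorem ae_norm_toLpOrZero_slice (hp0 : p ≠ 0) (hp : p ≠ ∞)
    (hh : MemLp h p (volume.restrict (cylinder Ω T))) :
    ∀ᵐ τ ∂volume.restrict (Ioo 0 T), ‖toLpOrZero p (volume.restrict Ω) (fun x => h (τ, x))‖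
      = (∫ x in Ω, ‖h (τ, x)‖ ^ p.toReal) ^ p.toReal⁻¹ := by
  have hmeas := hh.aestronglyMeasurable
  rw [volume_restrict_cylinder] at hmeas
  filter_upwards [(integrable_norm_rpow_cylinder hp0 hp hh).prod_right_ae,
    hmeas.prodMk_left] with τ hint hmeasτ
  have hslice : MemLp (fun x => h (τ, x)) p (volume.restrict Ω) :=
    (integrable_norm_rpow_iff hmeasτ hp0 hp).1 hint
  rw [toLpOrZero_of_memLp hslice, Lp.norm_toLp, toReal_eLpNorm hmeasτ,
    lpNorm_eq_integral_norm_rpow_toReal hp0 hp hmeasτ]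

theorem ae_sub_rpow_mul_norm_slice_eq (hp0 : p ≠ 0) (hp : p ≠ ∞)
    (hh : MemLp h p (volume.restrict (cylinder Ω T))) {γ t : ℝ} (htT : t ≤ T) :
    (fun τ => (t - τ) ^ (-γ) * ‖toLpOrZero p (volume.restrict Ω) (fun x => h (τ, x))‖)
      =ᵐ[volume.restrict (Ioo 0 t)]
        fun τ => (t - τ) ^ (-γ) * (∫ x in Ω, ‖h (τ, x)‖ ^ p.toReal) ^ p.toReal⁻¹ := by
  filter_upwards [ae_restrict_of_ae_restrict_of_subset (Ioo_subset_Ioo_right htT)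
    (ae_norm_toLpOrZero_slice hp0 hp hh)] with τ hτ
  rw [hτ]

theorem integrableOn_sub_rpow_mul_norm_slice (hp : p ≠ ∞)
    (hh : MemLp h p (volume.restrict (cylinder Ω T))) {q γ t : ℝ}
    (hpq : p.toReal.HolderConjugate q) (hγq : γ * q < 1) (ht : 0 ≤ t) (htT : t ≤ T) :
    IntegrableOn
      (fun τ => (t - τ) ^ (-γ) * ‖toLpOrZero p (volume.restrict Ω) (fun x => h (τ, x))‖)
      (Ioo 0 t) := by
  have hp0 : p ≠ 0 := (ENNReal.toReal_pos_iff.1 hpq.pos).1.ne'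
  refine (integrableOn_sub_rpow_mul hpq hγq ht (fun τ => ?_) ?_).congr
    (ae_sub_rpow_mul_norm_slice_eq hp0 hp hh htT).symm
  · positivity
  · exact IntegrableOn.mono_set (integrable_norm_rpow_cylinder hp0 hp hh).integral_prod_left
      (Ioo_subset_Ioo_right htT)

theorem integral_sub_rpow_mul_norm_slice_le (hp : p ≠ ∞)
    (hh : MemLp h p (volume.restrict (cylinder Ω T))) {q γ t : ℝ}
    (hpq : p.toReal.HolderConjugate q) (hγq : γ * q < 1) (ht : 0 ≤ t) (htT : t ≤ T) :
    ∫ τ in Ioo 0 t, (t - τ) ^ (-γ) * ‖toLpOrZero p (volume.restrict Ω) (fun x => h (τ, x))‖ ≤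
      (T ^ (1 - γ * q) / (1 - γ * q)) ^ (1 / q)
        * (eLpNorm h p (volume.restrict (cylinder Ω T))).toReal := by
  have hp0 : p ≠ 0 := (ENNReal.toReal_pos_iff.1 hpq.pos).1.ne'
  rw [integral_congr_ae (ae_sub_rpow_mul_norm_slice_eq hp0 hp hh htT),
    ← integral_integral_rpow_eq_eLpNorm hp0 hp hh]
  exact integral_sub_rpow_mul_le hpq hγq ht htT (fun τ => by positivity)
    (integrable_norm_rpow_cylinder hp0 hp hh).integral_prod_left

end Cylinder

section Duhamel

variable {bc : BoundaryCondition} {s d T : ℝ} {p : ℝ≥0∞} [Fact (1 ≤ p)]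

/-- The condition on `p` makes the kernel `(t - τ)^(-N/(2sp))` of the smoothing estimate an
element of `L^q` in time, where `q` is the conjugate exponent. -/
theorem div_mul_conjExponent_lt_one {n s p : ℝ} (hn : 0 ≤ n) (hs0 : 0 < s)
    (hp : (n + 2 * s) / (2 * s) < p) : n / (2 * s * p) * p.conjExponent < 1 := by
  have hlt : n / (2 * s) < p - 1 := by
    rw [add_div, div_self (by positivity)] at hp
    linarith
  have hp1 : 0 < p - 1 := (by positivity : 0 ≤ n / (2 * s)).trans_lt hlt
  have hp0 : p ≠ 0 := by linarith
  have heq : n / (2 * s * p) * p.conjExponent = n / (2 * s) / (p - 1) := by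
    rw [Real.conjExponent]
    field_simp
  rwa [heq, div_lt_one hp1]

variable (hΩ : IsBoundedRegularOpen Ω) (hs0 : 0 < s) (hs1 : s ≤ 1) (hd : 0 < d)

include hΩ hs0 hs1 hd

theorem semigroupLp_ae_abs_le_eLpNorm_top (hp : p ≠ ∞) {t : ℝ} (ht : 0 < t) {w₀ : Space N → ℝ}
    (hw₀ : MemLp w₀ ∞ (volume.restrict Ω)) :
    ∀ᵐ x ∂volume.restrict Ω,
      |semigroupLp Ω bc s d p t (toLpOrZero p (volume.restrict Ω) w₀) x|
        ≤ (eLpNorm w₀ ∞ (volume.restrict Ω)).toReal := by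
  have := hΩ.isFiniteMeasure
  refine semigroupLp_ae_abs_le hΩ hs0 hs1 hd hp ht ENNReal.toReal_nonneg ?_
  filter_upwards [coeFn_toLpOrZero (hw₀.mono_exponent le_top),
    ae_le_eLpNormEssSup (f := w₀)] with x hx hle
  rw [hx, ← Real.norm_eq_abs, ← toReal_enorm]
  rw [← eLpNorm_exponent_top] at hle
  exact ENNReal.toReal_mono hw₀.eLpNorm_ne_top hle

theorem exists_duhamel_ae_abs_le (hT : 0 < T) (hp : p ≠ ∞)
    (hp' : (N + 2 * s) / (2 * s) < p.toReal) :
    ∃ C : ℝ, 0 < C ∧ ∀ h : ℝ × Space N → ℝ, MemLp h p (volume.restrict (cylinder Ω T)) →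
      ∀ t ∈ Ioo 0 T, ∀ᵐ x ∂volume.restrict Ω,
        |(∫ τ in (0 : ℝ)..t, semigroupLp Ω bc s d p (t - τ)
          (toLpOrZero p (volume.restrict Ω) (fun x => h (τ, x)))) x|
            ≤ C * (eLpNorm h p (volume.restrict (cylinder Ω T))).toReal := by
  have := hΩ.isFiniteMeasure
  have hp1 : 1 < p.toReal := lt_of_le_of_lt (by rw [le_div_iff₀ (by positivity)]; simp) hp'
  obtain ⟨K, hK, hsmooth⟩ := exists_semigroupLp_ae_abs_le (bc := bc) hΩ hs0 hs1 hd T hp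
  set γ : ℝ := N / (2 * s * p.toReal)
  set q : ℝ := p.toReal.conjExponent
  have hpq : p.toReal.HolderConjugate q := Real.HolderConjugate.conjExponent hp1
  have hγq : γ * q < 1 := div_mul_conjExponent_lt_one (Nat.cast_nonneg N) hs0 hp'
  have hγq' : 0 < 1 - γ * q := by linarith
  refine ⟨K * (T ^ (1 - γ * q) / (1 - γ * q)) ^ (1 / q), by positivity, fun h hh t ht => ?_⟩
  rw [intervalIntegral.integral_of_le ht.1.le, integral_Ioc_eq_integral_Ioo]
  have hduhamel := abs_integral_le_smul_oneLp
    ((integrableOn_sub_rpow_mul_norm_slice hp hh hpq hγq ht.1.le ht.2.le).const_mul K)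
    (F := fun τ => semigroupLp Ω bc s d p (t - τ)
      (toLpOrZero p (volume.restrict Ω) (fun x => h (τ, x))))
    ((ae_restrict_mem measurableSet_Ioo).mono fun τ hτ =>
      mul_nonneg hK.le (mul_nonneg (Real.rpow_nonneg (sub_pos.2 hτ.2).le _) (norm_nonneg _)))
    ((ae_restrict_mem measurableSet_Ioo).mono fun τ hτ => by
      rw [abs_le_smul_oneLp_iff, ← mul_assoc]
      exact hsmooth (t - τ) (sub_pos.2 hτ.2) (by linarith [hτ.1, ht.2]) _)
  filter_upwards [abs_le_smul_oneLp_iff.1 hduhamel] with x hx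
  refine hx.trans ?_
  rw [integral_const_mul, mul_assoc]
  exact mul_le_mul_of_nonneg_left
    (integral_sub_rpow_mul_norm_slice_le hp hh hpq hγq ht.1.le ht.2.le) hK.le

theorem exists_weakSolution_ae_abs_le (hT : 0 < T) (hp : p ≠ ∞)
    (hp' : (N + 2 * s) / (2 * s) < p.toReal) :
    ∃ C : ℝ, 0 < C ∧ ∀ (w₀ : Space N → ℝ) (h w : ℝ × Space N → ℝ),
      MemLp w₀ ∞ (volume.restrict Ω) → MemLp h p (volume.restrict (cylinder Ω T)) →
      IsWeakSolution Ω bc s d T p w₀ h w → ∀ t ∈ Ioo 0 T, ∀ᵐ x ∂volume.restrict Ω,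
        |w (t, x)| ≤ (eLpNorm w₀ ∞ (volume.restrict Ω)).toReal +
          C * (eLpNorm h p (volume.restrict (cylinder Ω T))).toReal := by
  obtain ⟨C, hC, hduhamel⟩ := exists_duhamel_ae_abs_le (bc := bc) hΩ hs0 hs1 hd hT hp hp'
  refine ⟨C, hC, fun w₀ h w hw₀ hh hw t ht => ?_⟩
  have heq := coeFn_toLpOrZero (hw.memLp t ⟨ht.1.le, ht.2.le⟩)
  rw [hw.mild t ⟨ht.1.le, ht.2⟩] at heq
  filter_upwards [semigroupLp_ae_abs_le_eLpNorm_top (bc := bc) hΩ hs0 hs1 hd hp ht.1 hw₀,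
    hduhamel h hh t ht, heq, Lp.coeFn_add (semigroupLp Ω bc s d p t
      (toLpOrZero p (volume.restrict Ω) w₀)) (∫ τ in (0 : ℝ)..t, semigroupLp Ω bc s d p (t - τ)
        (toLpOrZero p (volume.restrict Ω) (fun x => h (τ, x))))] with x hinit hsource hx hsum
  rw [← hx, hsum, Pi.add_apply]
  exact (abs_add_le _ _).trans (add_le_add hinit hsource)

end Duhamel

end SpectralFractional

end

theorem theorem2p1_general {N : ℕ} (Ω : Set (SpectralFractional.Space N))
    (hΩ : SpectralFractional.IsBoundedRegularOpen Ω)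
    (bc : SpectralFractional.BoundaryCondition)
    (s : ℝ) (hs0 : 0 < s) (hs1 : s ≤ 1) (d : ℝ) (hd : 0 < d) (T : ℝ) (hT : 0 < T)
    (p : ℝ≥0∞) [Fact (1 ≤ p)] (hp_top : p ≠ ∞)
    (hp : ENNReal.ofReal ((N + 2 * s) / (2 * s)) < p) :
    ∃ C : ℝ, 0 < C ∧
      ∀ (w₀ : SpectralFractional.Space N → ℝ) (h w : ℝ × SpectralFractional.Space N → ℝ),
        MemLp w₀ ∞ (volume.restrict Ω) →
        MemLp h p (volume.restrict (SpectralFractional.cylinder Ω T)) →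
        SpectralFractional.IsWeakSolution Ω bc s d T p w₀ h w →
        eLpNorm w ∞ (volume.restrict (SpectralFractional.cylinder Ω T)) ≤
          eLpNorm w₀ ∞ (volume.restrict Ω) +
            ENNReal.ofReal C *
              eLpNorm h p (volume.restrict (SpectralFractional.cylinder Ω T)) := by
  have hp' : (N + 2 * s) / (2 * s) < p.toReal := by
    rwa [ENNReal.ofReal_lt_iff_lt_toReal (by positivity) hp_top] at hp
  obtain ⟨C, hC, hbound⟩ :=
    SpectralFractional.exists_weakSolution_ae_abs_le (bc := bc) hΩ hs0 hs1 hd hT hp_top hp'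
  refine ⟨C, hC, fun w₀ h w hw₀ hh hw => ?_⟩
  refine (SpectralFractional.eLpNorm_top_cylinder_le hw.aestronglyMeasurable
    (hbound w₀ h w hw₀ hh hw)).trans_eq ?_
  rw [ENNReal.ofReal_add ENNReal.toReal_nonneg (by positivity), ENNReal.ofReal_mul hC.le,
    ENNReal.ofReal_toReal hw₀.eLpNorm_ne_top, ENNReal.ofReal_toReal hh.eLpNorm_ne_top]

theorem theorem2p1 {N : ℕ} (hN : 1 ≤ N) (Ω : Set (SpectralFractional.Space N))
    (hΩ : SpectralFractional.IsBoundedRegularOpen Ω)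
    (bc : SpectralFractional.BoundaryCondition)
    (s : ℝ) (hs0 : 0 < s) (hs1 : s < 1) (d : ℝ) (hd : 0 < d) (T : ℝ) (hT : 0 < T)
    (p : ℝ≥0∞) [Fact (1 ≤ p)] (hp_top : p ≠ ∞)
    (hp : ENNReal.ofReal ((N + 2 * s) / (2 * s)) < p) :
    ∃ C : ℝ, 0 < C ∧
      ∀ (w₀ : SpectralFractional.Space N → ℝ) (h w : ℝ × SpectralFractional.Space N → ℝ),
        MemLp w₀ ∞ (volume.restrict Ω) →
        MemLp h p (volume.restrict (SpectralFractional.cylinder Ω T)) →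
        SpectralFractional.IsWeakSolution Ω bc s d T p w₀ h w →
        eLpNorm w ∞ (volume.restrict (SpectralFractional.cylinder Ω T)) ≤
          eLpNorm w₀ ∞ (volume.restrict Ω) +
            ENNReal.ofReal C *
              eLpNorm h p (volume.restrict (SpectralFractional.cylinder Ω T)) :=
  theorem2p1_general Ω hΩ bc s hs0 hs1.le d hd T hT p hp_top hp
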